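/- **Setting.** There are $J$ binary interventions. A unit has a context $\mathbf X$, an unobserved confounder $\mathbf U$ and potential outcomes $Y^*(\mathbf a)$, $\mathbf a\in\{0,1\}^J$; the triple $(\mathbf X,\mathbf U,(Y^*(\mathbf a))_{\mathbf a})$ has a fixed law $Q$, and $f=(f^1,\dots,f^J)$ is a measurable map into $\{0,1\}^J$. For an observational unit one sees $(\mathbf X,\mathbf A,Y)$ with $\mathbf A=f(\mathbf X,\mathbf U)$ and $Y=Y^*(\mathbf A)$; let $P_0$ be the law of this triple. For a randomized unit in a round with randomization set $\mathbf S\subseteq\{1,\dots,J\}$, $W$ is drawn uniformly from $\mathbf S$, $A^W\sim\mathrm{Bernoulli}(1/2)$, $A^k=f^k(\mathbf X,\mathbf U)$ for $k\ne W$, $Y=Y^*(\mathbf A)$; the unit record, $W$ and the coin are independent. Round $\nu=1,2,\dots$ consists of $N_\nu$ observational and $L_\nu$ randomized units; the set $\mathbf S_\nu$ may be chosen from the history of the previous rounds (and extra randomization), and given that history all units of round $\nu$ are independent, with the laws just described. Put $\overline N_m=\sum_{\nu\le m}N_\nu$, $\overline L_m=\sum_{\nu\le m}L_\nu$, $\overline{\mathbf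 S}_m=\bigcup_{\nu\le m}\mathbf S_\nu$, and assume $\overline N_m\to\infty$. For $b\in\{0,1\}$ let $Y^*(\mu^j_b)$ be the potential outcome at $f(\mathbf X,\mathbf U)$ with $j$-th entry replaced by $b$. It is assumed integrable for all $j,b$, and $\tau^{j*}=E\,Y^*(\mu_1^j)-E\,Y^*(\mu_0^j)$, $\boldsymbol\tau^*=(\tau^{1*},\dots,\tau^{J*})$. **Estimators.** Let $\psi(\mathbf x)\in\mathbb R^d$ be a fixed measurable feature vector, $\eta(\mathbf x;\boldsymbol\beta)=\mathrm{expit}\{\psi(\mathbf x)^\top\boldsymbol\beta\}$, and let $\ell(\mathbf x,\mathbf a;\overline{\boldsymbol\beta})=-\log\prod_j\eta(\mathbf x;\boldsymbol\beta^j)^{a^j}\{1-\eta(\mathbf x;\boldsymbol\beta^j)\}^{1-a^j}$ be the negative log-likelihood. Let $\mathbb P_m$ be the empirical distribution of the $\overline N_m$ observational triples of the first $m$ rounds. The random vector $\widehat{\overline{\boldsymbol\beta}}_m$ solves $\mathbb P_m\nabla\ell(\mathbf X,\mathbf A;\overline{\boldsymbol\beta})=0$ whenever a solution exists (and is arbitrary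 otherwise), and $$\widehat\tau^j_{\mathcal O,m}=\frac{\mathbb P_m A^jY/\eta(\mathbf X;\widehat{\boldsymbol\beta}{}^j_m)}{\mathbb P_m A^j/\eta(\mathbf X;\widehat{\boldsymbol\beta}{}^j_m)}-\frac{\mathbb P_m(1-A^j)Y/\{1-\eta(\mathbf X;\widehat{\boldsymbol\beta}{}^j_m)\}}{\mathbb P_m(1-A^j)/\{1-\eta(\mathbf X;\widehat{\boldsymbol\beta}{}^j_m)\}}.$$ The RCT estimator $\widehat\tau^j_{\mathcal R,m}$ is the mean of $Y$ over the randomized units of the first $m$ rounds with $W=j,A^j=1$ minus the mean over those with $W=j,A^j=0$ (a mean over no units, like any ratio with zero denominator, is $0$). Intervention $j$ has an attribute $\mathbf v^j$ and bias features $\phi(\mathbf v^j)\in\mathbb R^{p_v}$; $\Psi$ is the $J\times p_v$ matrix with rows $\phi(\mathbf v^j)^\top$. For some $\theta^*\in\mathbb R^{p_v}$ the bias model $$E\,\widehat\tau^j_{\mathcal O,m}=\tau^{j*}+\phi(\mathbf v^j)^\top\theta^*+\rho^j_m,\qquad \sup_j|\rho_m^j|=o(\overline N_m^{-1/2})$$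 holds. $\widehat\theta_m$ is a (measurable) minimizer of $\theta\mapsto\sum_{j\in\overline{\mathbf S}_m}\{\widehat\tau^j_{\mathcal O,m}-\widehat\tau^j_{\mathcal R,m}-\phi(\mathbf v^j)^\top\theta\}^2$, and $\mathbf Z_m=\widehat{\boldsymbol\tau}_{\mathcal O,m}-\Psi\widehat\theta_m$. **Regularity conditions.** With $\tau^{j*}_{\mathcal O}(1)=\frac{P_0A^jY/\eta(\mathbf X;\boldsymbol\beta^{j*})}{P_0A^j/\eta(\mathbf X;\boldsymbol\beta^{j*})}$, $\tau^{j*}_{\mathcal O}(0)=\frac{P_0(1-A^j)Y/\{1-\eta(\mathbf X;\boldsymbol\beta^{j*})\}}{P_0(1-A^j)/\{1-\eta(\mathbf X;\boldsymbol\beta^{j*})\}}$, $\tau_{\mathcal O}^{j*}=\tau^{j*}_{\mathcal O}(1)-\tau^{j*}_{\mathcal O}(0)$, $\boldsymbol\gamma^{j*}=(\tau^{j*}_{\mathcal O}(1),\tau^{j*}_{\mathcal O}(0),\boldsymbol\beta^{j*})$ and, for $\boldsymbol\gamma=(\mu_1,\mu_0,\boldsymbol\beta)$, $$\mathbf U^j(\boldsymbol\gamma)=\Big(\tfrac{A^jY}{\eta(\mathbf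 X;\boldsymbol\beta)}-\mu_1\tfrac{A^j}{\eta(\mathbf X;\boldsymbol\beta)},\ \tfrac{(1-A^j)Y}{1-\eta(\mathbf X;\boldsymbol\beta)}-\mu_0\tfrac{1-A^j}{1-\eta(\mathbf X;\boldsymbol\beta)},\ \{A^j-\eta(\mathbf X;\boldsymbol\beta)\}\psi(\mathbf X)^\top\Big)^\top ,$$ assume: - (B0) $\overline{\boldsymbol\beta}^*$ is the unique solution of $P_0\nabla\ell(\mathbf X,\mathbf A;\overline{\boldsymbol\beta})=0$; - (B1) $P_0\|\nabla\ell(\mathbf X,\mathbf A;\overline{\boldsymbol\beta})\|^2<\infty$ for $\overline{\boldsymbol\beta}$ in a neighborhood of $\overline{\boldsymbol\beta}^*$; - (B2) $P_0\nabla^2\ell(\mathbf X,\mathbf A;\overline{\boldsymbol\beta}^*)$ exists and is positive definite; - (B3) $\psi(\mathbf X)$ is (almost surely) bounded; - (B4) for each $j$ there is $\epsilon>0$ with $\eta(\mathbf X;\boldsymbol\beta^j)\in(\epsilon,1-\epsilon)$ almost surely, for all $\boldsymbol\beta^j$ in a neighborhood of $\boldsymbol\beta^{j*}$; - (C1) for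 each $j$, $\boldsymbol\gamma^{j*}$ is the unique solution of $P_0\mathbf U^j(\boldsymbol\gamma)=0$; - (C2) $P_0\|\mathbf U^j(\boldsymbol\gamma^{j*})\|^2<\infty$ for each $j$; - (C3) for each $j$, $\mathbf U^j$ is almost surely differentiable at $\boldsymbol\gamma^{j*}$, and $P_0\,\partial\mathbf U^j/\partial\boldsymbol\gamma|_{\boldsymbol\gamma^{j*}}$ exists and is nonsingular. **Randomized interventions.** There is a set $T\subseteq\{1,\dots,J\}$ such that almost surely $\mathbf S_m\subseteq T$ for all $m$, and such that, for each $j\in T$, the fraction of the $\overline L_m$ randomized units of the first $m$ rounds that have $W=j$ converges in probability to a constant $\pi_j>0$, and $Y^*(\mu^j_1),Y^*(\mu^j_0)$ have finite second moments. For all large $m$, $|\overline{\mathbf S}_m|\ge p_v$ almost surely. With $\Psi_T$ the rows of $\Psi$ indexed by $T$, and $\widetilde\Psi_T$ the matrix $\Psi$ with the other rows replaced by $0$, $\Psi_T^\top\Psi_T$ is invertible; put $\mathbf H=\Psi(\Psi_T^\top\Psi_T)^{-1}\widetilde\Psi_T^\top$ (so $\mathbf H=\Psi(\Psi^\top\Psi)^{-1}\Psi^\top$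 if every intervention is randomized). **Lemma.** Suppose in addition that $\overline N_m/(\overline N_m+\overline L_m)\to\rho\in(0,1)$. Let $$\Gamma=\mathbf E\,\mathbf G^{-1}\,P_0\{\mathbf U(\boldsymbol\gamma^*)\mathbf U(\boldsymbol\gamma^*)^\top\}\,\mathbf G^{-\top}\mathbf E^\top,\qquad \mathbf G=P_0\,\partial\mathbf U/\partial\boldsymbol\gamma|_{\boldsymbol\gamma^*},$$ where $\mathbf U=(\mathbf U^{1\top},\dots,\mathbf U^{J\top})^\top$, $\boldsymbol\gamma^*=(\boldsymbol\gamma^{1*},\dots,\boldsymbol\gamma^{J*})$ and $\mathbf E$ extracts $(\mu_1^j-\mu_0^j)_{j\le J}$, and let $\Upsilon$ be diagonal with $\Upsilon_{jj}=\{2\operatorname{Var}Y^*(\mu_1^j)+2\operatorname{Var}Y^*(\mu_0^j)\}/\pi_j$ for $j\in T$ (the other diagonal entries are irrelevant, because the columns of $\mathbf H$ outside $T$ vanish). Then, as $m\to\infty$: 1. $\Gamma$ is the asymptotic covariance matrix of $\widehat{\boldsymbol\tau}_{\mathcal O,m}$: $\sqrt{\overline N_m}(\widehat{\boldsymbol\tau}_{\mathcal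 O,m}-\boldsymbol\tau^*_{\mathcal O})\xrightarrow{d}N(0,\Gamma)$; 2. $(\Upsilon_{jk})_{j,k\in T}$ is that of the RCT estimators: $\sqrt{\overline L_m}(\widehat\tau^j_{\mathcal R,m}-\tau^{j*})_{j\in T}\xrightarrow{d}N(0,(\Upsilon_{jk})_{j,k\in T})$; 3. the fully de-biased estimator is asymptotically normal: $$\big(\overline N_m^{-1}+\overline L_m^{-1}\big)^{-1/2}\big(\mathbf Z_m-\boldsymbol\tau^*\big)\xrightarrow{d}N(0,\Sigma),\qquad \Sigma=(1-\rho)(\mathbf I-\mathbf H)\Gamma(\mathbf I-\mathbf H)^\top+\rho\,\mathbf H\Upsilon\mathbf H^\top.$$ The three covariance matrices are positive semidefinite. -/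

import Mathlib

open MeasureTheory ProbabilityTheory Filter Topology

namespace DataFusion

noncomputable section

/-! ### Units, interventions and estimands -/

/-- The full record `(X, U, Y*)` of a unit: context, unobserved confounder, and the collection of
potential outcomes `Y*(a)`, one for every intervention status `a ∈ {0,1}^J`. -/
abbrev UnitRec (𝓧 𝓤 : Type*) (J : ℕ) := 𝓧 × 𝓤 × ((Fin J → Bool) → ℝ)

/-- A unit of a randomized study: its record, the intervention `W` that is randomized for it, and
the outcome of the coin that decides the status of that intervention. -/
abbrev RctRec (𝓧 𝓤 : Type*) (J : ℕ) := UnitRec 𝓧 𝓤 J × Fin J × Bool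

/-- An observed triple `(X, A, Y)`. -/
abbrev Obs (𝓧 : Type*) (J : ℕ) := 𝓧 × (Fin J → Bool) × ℝ

/-- The numerical value of a binary intervention status. -/
def val (a : Bool) : ℝ := if a then 1 else 0

section Units

variable {𝓧 𝓤 : Type*} {J : ℕ}

/-- What is seen of a unit in the observational study: `A = f(X, U)` and `Y = Y*(A)`. -/
def observe (f : 𝓧 × 𝓤 → Fin J → Bool) (z : UnitRec 𝓧 𝓤 J) : Obs 𝓧 J :=
  (z.1, f (z.1, z.2.1), z.2.2 (f (z.1, z.2.1)))

/-- What is seen, besides `W`, of a unit in a randomized study: `A^W` is given by the coin,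
`A^k = f^k(X, U)` for `k ≠ W`, and `Y = Y*(A)`. -/
def observeRct (f : 𝓧 × 𝓤 → Fin J → Bool) (r : RctRec 𝓧 𝓤 J) : Obs 𝓧 J :=
  let a := Function.update (f (r.1.1, r.1.2.1)) r.2.1 r.2.2
  (r.1.1, a, r.1.2.2 a)

/-- The (degenerate) behavior policy that sets intervention `j` to `b` and leaves all other
interventions as in the observational study. -/
def policy (f : 𝓧 × 𝓤 → Fin J → Bool) (j : Fin J) (b : Bool) (p : 𝓧 × 𝓤) : Fin J → Bool :=
  Function.update (f p) j b

/-- The potential outcome under the behavior policy `policy f j b`. -/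
def policyOutcome (f : 𝓧 × 𝓤 → Fin J → Bool) (j : Fin J) (b : Bool) (z : UnitRec 𝓧 𝓤 J) : ℝ :=
  z.2.2 (policy f j b (z.1, z.2.1))

variable [MeasurableSpace 𝓧] [MeasurableSpace 𝓤]

/-- The average treatment effect in the wild of intervention `j`. -/
def ate (Q : Measure (UnitRec 𝓧 𝓤 J)) (f : 𝓧 × 𝓤 → Fin J → Bool) (j : Fin J) : ℝ :=
  (∫ z, policyOutcome f j true z ∂Q) - ∫ z, policyOutcome f j false z ∂Q

/-- The law of an observed triple `(X, A, Y)` of the observational study. -/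
def obsLaw (Q : Measure (UnitRec 𝓧 𝓤 J)) (f : 𝓧 × 𝓤 → Fin J → Bool) : Measure (Obs 𝓧 J) :=
  Q.map (observe f)

/-- The law of the data of one round with `n` observational and `l` randomized units when the
interventions in `s` are open to randomization: all units are independent; unit records have
law `Q`; `W` is uniform on `s` and the coin is fair, both independent of the unit record. -/
def roundLaw (Q : Measure (UnitRec 𝓧 𝓤 J)) (n l : ℕ) (s : Finset (Fin J)) :
    Measure ((Fin n → UnitRec 𝓧 𝓤 J) × (Fin l → RctRec 𝓧 𝓤 J)) :=
  (Measure.pi fun _ : Fin n => Q).prod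
    (Measure.pi fun _ : Fin l =>
      Q.prod ((uniformOn (s : Set (Fin J))).prod (uniformOn (Set.univ : Set Bool))))

end Units

/-! ### The sequence of rounds -/

/-- The rounds are numbered from `0`. Round `m` has `N m` observational and `L m` randomized units,
and `S m` is the (possibly data dependent) set of interventions open to randomization. -/
structure Rounds (Ω 𝓧 𝓤 : Type*) (J : ℕ) where
  N : ℕ → ℕ
  L : ℕ → ℕ
  S : ℕ → Ω → Finset (Fin J)
  obs : (m : ℕ) → Fin (N m) → Ω → UnitRec 𝓧 𝓤 J
  rct : (m : ℕ) → Fin (L m) → Ω → RctRec 𝓧 𝓤 J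

namespace Rounds

variable {Ω 𝓧 𝓤 : Type*} {J : ℕ} (D : Rounds Ω 𝓧 𝓤 J)

/-- All data of round `m`. -/
def block (m : ℕ) (ω : Ω) : (Fin (D.N m) → UnitRec 𝓧 𝓤 J) × (Fin (D.L m) → RctRec 𝓧 𝓤 J) :=
  (fun i => D.obs m i ω, fun l => D.rct m l ω)

/-- The sampling scheme. `ℱ m` is the history before round `m` (it may contain additional
randomization used by the design). The set `S m` is chosen from that history, and, given the
history, the data of round `m` have law `roundLaw Q (N m) (L m) (S m)`. -/
structure IsSampled [MeasurableSpace 𝓧] [MeasurableSpace 𝓤] {mΩ : MeasurableSpace Ω}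
    (P : Measure Ω) (ℱ : Filtration ℕ mΩ) (Q : Measure (UnitRec 𝓧 𝓤 J)) : Prop where
  measurable_S : ∀ m s, MeasurableSet[ℱ m] {ω | D.S m ω = s}
  measurable_block : ∀ m, Measurable[ℱ (m + 1)] (D.block m)
  law : ∀ m s F, MeasurableSet[ℱ m] F →
    (P.restrict (F ∩ {ω | D.S m ω = s})).map (D.block m) =
      P (F ∩ {ω | D.S m ω = s}) • roundLaw Q (D.N m) (D.L m) s

/-- Cumulative observational sample size of the first `m` rounds. -/
def Nbar (m : ℕ) : ℝ := ∑ ν ∈ Finset.range m, (D.N ν : ℝ)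

/-- Cumulative randomized sample size of the first `m` rounds. -/
def Lbar (m : ℕ) : ℝ := ∑ ν ∈ Finset.range m, (D.L ν : ℝ)

/-- The interventions that were open to randomization in the first `m` rounds. -/
def Sbar (m : ℕ) (ω : Ω) : Finset (Fin J) := (Finset.range m).biUnion fun ν => D.S ν ω

/-- The number of randomized units of the first `m` rounds with `W = j`. -/
def count (m : ℕ) (ω : Ω) (j : Fin J) : ℝ :=
  ∑ ν ∈ Finset.range m, ∑ l : Fin (D.L ν), if (D.rct ν l ω).2.1 = j then (1 : ℝ) else 0

variable (f : 𝓧 × 𝓤 → Fin J → Bool)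

/-- The mean of `g` under the empirical distribution of the observational data of the first `m`
rounds. -/
def empMean (m : ℕ) (ω : Ω) (g : Obs 𝓧 J → ℝ) : ℝ :=
  (D.Nbar m)⁻¹ * ∑ ν ∈ Finset.range m, ∑ i : Fin (D.N ν), g (observe f (D.obs ν i ω))

/-- The sum of `g` over the randomized units of the first `m` rounds with `W = j`. -/
def rctSum (m : ℕ) (ω : Ω) (j : Fin J) (g : Obs 𝓧 J → ℝ) : ℝ :=
  ∑ ν ∈ Finset.range m, ∑ l : Fin (D.L ν),
    if (D.rct ν l ω).2.1 = j then g (observeRct f (D.rct ν l ω)) else 0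

/-- The RCT estimator after `m` rounds. -/
def tauR (m : ℕ) (ω : Ω) (j : Fin J) : ℝ :=
  D.rctSum f m ω j (fun o => val (o.2.1 j) * o.2.2) /
      D.rctSum f m ω j (fun o => val (o.2.1 j)) -
    D.rctSum f m ω j (fun o => (1 - val (o.2.1 j)) * o.2.2) /
      D.rctSum f m ω j (fun o => 1 - val (o.2.1 j))

end Rounds

/-! ### Logistic propensity model -/

section Calculus

variable {ι κ : Type*} [Fintype ι] [DecidableEq ι] [Fintype κ]

/-- The Jacobian matrix of `F` at `x`. -/
def jacobian (F : (ι → ℝ) → κ → ℝ) (x : ι → ℝ) : Matrix κ ι ℝ :=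
  Matrix.of fun r c => fderiv ℝ F x (Pi.single c 1) r

/-- The gradient of `g` at `x`. -/
def grad (g : (ι → ℝ) → ℝ) (x : ι → ℝ) : ι → ℝ := fun r => fderiv ℝ g x (Pi.single r 1)

/-- The Hessian matrix of `g` at `x`. -/
def hess (g : (ι → ℝ) → ℝ) (x : ι → ℝ) : Matrix ι ι ℝ := jacobian (grad g) x

end Calculus

section Logistic

variable {𝓧 : Type*} {J d : ℕ} (ψ : 𝓧 → Fin d → ℝ)

/-- `η(x; β) = expit(ψ(x)ᵀ β)`. -/
def eta (x : 𝓧) (β : Fin d → ℝ) : ℝ := Real.sigmoid (ψ x ⬝ᵥ β)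

/-- The Bernoulli likelihood of one intervention status. -/
def lik (x : 𝓧) (a : Bool) (β : Fin d → ℝ) : ℝ := if a then eta ψ x β else 1 - eta ψ x β

/-- The negative log-likelihood of the statuses of all interventions, as a function of the stacked
coefficient vector. -/
def loss (o : Obs 𝓧 J) (β : Fin J × Fin d → ℝ) : ℝ :=
  -Real.log (∏ j, lik ψ o.1 (o.2.1 j) fun k => β (j, k))

/-- The estimating function `U^j` of `γ = (μ₁, μ₀, β)`, with `μ₁ = γ (inl 0)`, `μ₀ = γ (inl 1)` and
`β = γ ∘ inr`. -/
def estFun (j : Fin J) (o : Obs 𝓧 J) (γ : Fin 2 ⊕ Fin d → ℝ) : Fin 2 ⊕ Fin d → ℝ :=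
  let η := eta ψ o.1 (γ ∘ Sum.inr)
  let a := val (o.2.1 j)
  Sum.elim
    ![a * o.2.2 / η - γ (Sum.inl 0) * (a / η),
      (1 - a) * o.2.2 / (1 - η) - γ (Sum.inl 1) * ((1 - a) / (1 - η))]
    (fun k => (a - η) * ψ o.1 k)

/-- The stacked estimating function of all interventions. -/
def stackedEstFun (o : Obs 𝓧 J) (γ : Fin J × (Fin 2 ⊕ Fin d) → ℝ) :
    Fin J × (Fin 2 ⊕ Fin d) → ℝ :=
  fun p => estFun ψ p.1 o (fun r => γ (p.1, r)) p.2

variable [MeasurableSpace 𝓧] (μ : Measure (Obs 𝓧 J)) (β : Fin J × Fin d → ℝ)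

/-- The population value of the weighted mean outcome among units with intervention `j` on. -/
def tauO1 (j : Fin J) : ℝ :=
  (∫ o, val (o.2.1 j) * o.2.2 / eta ψ o.1 (fun k => β (j, k)) ∂μ) /
    ∫ o, val (o.2.1 j) / eta ψ o.1 (fun k => β (j, k)) ∂μ

/-- The population value of the weighted mean outcome among units with intervention `j` off. -/
def tauO0 (j : Fin J) : ℝ :=
  (∫ o, (1 - val (o.2.1 j)) * o.2.2 / (1 - eta ψ o.1 (fun k => β (j, k))) ∂μ) /
    ∫ o, (1 - val (o.2.1 j)) / (1 - eta ψ o.1 (fun k => β (j, k))) ∂μ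

/-- The value `γ^{j*} = (τ_O^{j*}(1), τ_O^{j*}(0), β^{j*})`. -/
def gammaStar (j : Fin J) : Fin 2 ⊕ Fin d → ℝ :=
  Sum.elim ![tauO1 ψ μ β j, tauO0 ψ μ β j] fun k => β (j, k)

/-- The stacked parameter `(γ^{1*}, …, γ^{J*})`. -/
def gammaStarAll : Fin J × (Fin 2 ⊕ Fin d) → ℝ := fun p => gammaStar ψ μ β p.1 p.2

/-- The entrywise expectation of a random matrix. -/
def expMatrix {Z ι κ : Type*} [MeasurableSpace Z] (μ : Measure Z) (M : Z → Matrix ι κ ℝ) :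
    Matrix ι κ ℝ :=
  Matrix.of fun r c => ∫ z, M z r c ∂μ

/-- The matrix that extracts `μ₁^j - μ₀^j`, `j = 1, …, J`, from the stacked parameter. -/
def contrast : Matrix (Fin J) (Fin J × (Fin 2 ⊕ Fin d)) ℝ :=
  Matrix.of fun j p =>
    if p = (j, Sum.inl 0) then 1 else if p = (j, Sum.inl 1) then -1 else 0

/-- The asymptotic covariance matrix of the observational estimator, in sandwich form. -/
def Gam : Matrix (Fin J) (Fin J) ℝ :=
  let G := expMatrix μ fun o => jacobian (stackedEstFun ψ o) (gammaStarAll ψ μ β)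
  let V := expMatrix μ fun o =>
    Matrix.vecMulVec (stackedEstFun ψ o (gammaStarAll ψ μ β))
      (stackedEstFun ψ o (gammaStarAll ψ μ β))
  let E : Matrix (Fin J) (Fin J × (Fin 2 ⊕ Fin d)) ℝ := contrast
  E * (G⁻¹ * V * (G⁻¹).transpose) * E.transpose

/-- The regularity conditions on the logistic propensity model and the estimating equations. -/
structure Regular : Prop where
  /-- The population score equation has the unique solution `β`. -/
  b0 : ∀ b : Fin J × Fin d → ℝ, (∀ r, ∫ o, grad (loss ψ o) b r ∂μ = 0) ↔ b = β
  b1 : ∀ᶠ b in 𝓝 β, Integrable (fun o => ∑ r, grad (loss ψ o) b r ^ 2) μ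
  b2 : (∀ r c, Integrable (fun o => hess (loss ψ o) β r c) μ) ∧
    (expMatrix μ fun o => hess (loss ψ o) β).PosDef
  b3 : ∃ C : ℝ, ∀ᵐ o ∂μ, ∀ k, |ψ o.1 k| ≤ C
  b4 : ∀ j, ∃ ε > 0, ∀ᶠ b in 𝓝 (fun k => β (j, k)),
    ∀ᵐ o ∂μ, eta ψ o.1 b ∈ Set.Ioo ε (1 - ε)
  c1 : ∀ j (γ : Fin 2 ⊕ Fin d → ℝ),
    (∀ r, ∫ o, estFun ψ j o γ r ∂μ = 0) ↔ γ = gammaStar ψ μ β j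
  c2 : ∀ j, Integrable (fun o => ∑ r, estFun ψ j o (gammaStar ψ μ β j) r ^ 2) μ
  c3 : ∀ j, (∀ᵐ o ∂μ, DifferentiableAt ℝ (estFun ψ j o) (gammaStar ψ μ β j)) ∧
    (∀ r c, Integrable (fun o => jacobian (estFun ψ j o) (gammaStar ψ μ β j) r c) μ) ∧
    IsUnit (expMatrix μ fun o => jacobian (estFun ψ j o) (gammaStar ψ μ β j)).det

end Logistic

/-! ### Estimators and limiting covariance -/

namespace Rounds

variable {Ω 𝓧 𝓤 : Type*} {J d pv : ℕ} (D : Rounds Ω 𝓧 𝓤 J) (f : 𝓧 × 𝓤 → Fin J → Bool)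
  (ψ : 𝓧 → Fin d → ℝ)

/-- `b` solves the sample score equation after `m` rounds. -/
def SolvesScore (m : ℕ) (ω : Ω) (b : Fin J × Fin d → ℝ) : Prop :=
  ∀ r, D.empMean f m ω (fun o => grad (loss ψ o) b r) = 0

/-- The (normalized inverse probability weighted) observational estimator after `m` rounds, with
propensity coefficients `b`. -/
def tauO (m : ℕ) (ω : Ω) (b : Fin J × Fin d → ℝ) (j : Fin J) : ℝ :=
  let η : Obs 𝓧 J → ℝ := fun o => eta ψ o.1 fun k => b (j, k)
  D.empMean f m ω (fun o => val (o.2.1 j) * o.2.2 / η o) /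
      D.empMean f m ω (fun o => val (o.2.1 j) / η o) -
    D.empMean f m ω (fun o => (1 - val (o.2.1 j)) * o.2.2 / (1 - η o)) /
      D.empMean f m ω (fun o => (1 - val (o.2.1 j)) / (1 - η o))

/-- The least squares criterion for the bias parameter after `m` rounds. -/
def lsCrit (Ψ : Matrix (Fin J) (Fin pv) ℝ) (m : ℕ) (ω : Ω) (b : Fin J × Fin d → ℝ)
    (θ : Fin pv → ℝ) : ℝ :=
  ∑ j ∈ D.Sbar m ω, (D.tauO f ψ m ω b j - D.tauR f m ω j - Ψ j ⬝ᵥ θ) ^ 2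

/-- The fully de-biased estimator `Z = τ̂_O - Ψ θ̂` after `m` rounds. -/
def debiased (Ψ : Matrix (Fin J) (Fin pv) ℝ) (m : ℕ) (ω : Ω) (b : Fin J × Fin d → ℝ)
    (θ : Fin pv → ℝ) (j : Fin J) : ℝ :=
  D.tauO f ψ m ω b j - (Ψ.mulVec θ) j

end Rounds

section Covariance

variable {J pv : ℕ}

/-- `Ψ_Sᵀ Ψ_S`, where `Ψ_S` consists of the rows of `Ψ` indexed by `S`. -/
def gram (Ψ : Matrix (Fin J) (Fin pv) ℝ) (S : Finset (Fin J)) : Matrix (Fin pv) (Fin pv) ℝ :=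
  let ΨS : Matrix S (Fin pv) ℝ := Ψ.submatrix Subtype.val id
  ΨS.transpose * ΨS

/-- `H = Ψ (Ψ_Sᵀ Ψ_S)⁻¹ Ψ̃_Sᵀ`, where `Ψ̃_S` is `Ψ` with the rows not indexed by `S` replaced by
zero; it is `Ψ (Ψᵀ Ψ)⁻¹ Ψᵀ` when `S` contains all interventions. -/
def hat (Ψ : Matrix (Fin J) (Fin pv) ℝ) (S : Finset (Fin J)) : Matrix (Fin J) (Fin J) ℝ :=
  let Ψt : Matrix (Fin J) (Fin pv) ℝ := Matrix.of fun j k => if j ∈ S then Ψ j k else 0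
  Ψ * (gram Ψ S)⁻¹ * Ψt.transpose

/-- The asymptotic covariance matrix of the RCT estimator (on the `√L̄` scale) when intervention
`j` receives the fraction `share j` of the randomized units. -/
def Ups {𝓧 𝓤 : Type*} [MeasurableSpace 𝓧] [MeasurableSpace 𝓤] (Q : Measure (UnitRec 𝓧 𝓤 J))
    (f : 𝓧 × 𝓤 → Fin J → Bool) (share : Fin J → ℝ) : Matrix (Fin J) (Fin J) ℝ :=
  Matrix.diagonal fun j =>
    (2 * Var[policyOutcome f j true; Q] + 2 * Var[policyOutcome f j false; Q]) / share j

/-- `Σ = (1 - ρ) (I - H) Γ (I - H)ᵀ + ρ H Υ Hᵀ`. -/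
def Sig (ρ : ℝ) (H Γ Υ : Matrix (Fin J) (Fin J) ℝ) : Matrix (Fin J) (Fin J) ℝ :=
  (1 - ρ) • ((1 - H) * Γ * (1 - H).transpose) + ρ • (H * Υ * H.transpose)

end Covariance

end

end DataFusion

set_option linter.unusedSectionVars false

/-! Each estimator is, up to an error that vanishes in probability, a normalized sum `normSum` of
centred square integrable functions of the observational units and, arm by arm, of the randomized
units. One central limit theorem for such sums then gives all three limits, with covariances read
off from the influence functions.

The central limit theorem must cope with randomization sets that depend on the past. Divide the
character of every unit by its mean, using for a randomized unit the mean given its arm `W`. Each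
factor then has conditional mean one whatever the randomization set, so the product over all rounds
has mean exactly one (`integral_exp_mul_exp_neg`). The product of the normalizers depends on the
data only through the arm counts. Since the shares of the arms converge, it tends to a constant, and
this constant is the limit of the characteristic function (`tendsto_integral_exp`). No martingale
limit theorem is involved.

An RCT estimator is a difference of two ratios whose denominators, divided by `Lbar`, tend to half
the share of the arm (`littleOP_tauR`). For the observational estimator, the logistic score is
strongly monotone on the unit ball around the true coefficients as soon as the empirical second
moments of the features are nondegenerate. A small score at the truth therefore forces a root to
exist and every root to be near the truth (`exists_score_eq_zero`, `norm_sub_le_of_score_eq_zero`).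
A second order expansion of the stacked estimating function, inverted with the expected Jacobian,
gives linearity (`abs_gammaHat_sub_add_le`, `littleOP_tauO`).

The bias model speaks of the mean of the estimator, while the limit theorem centres at the
population value `tauO1 - tauO0`. The two are reconciled by convergence of the means
(`tendsto_integral_tauO`). On good samples the error has an explicit integrable bound. Bad samples
have probability `o(n⁻²)` by Hoeffding's inequality, and there the estimator is bounded by the size
of the observed outcomes, whatever the coefficients. As neither the population value nor the effect
plus modelled bias depends on `m`, they coincide.

With probability tending to one every arm of `T` has been opened, so the least squares fit is `Ψ θ̂
= H (τ̂_O - τ̂_R)`. Because `H Ψ = Ψ`, the modelled bias cancels and `Z - τ* = (I - H)(τ̂_O - τ_O*)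
+ H (τ̂_R - τ*)`. The scaling `(1/N + 1/L)^(-1/2)` equals both `√(L/(N+L)) √N` and `√(N/(N+L)) √L`,
which produces the weights `1 - ρ` and `ρ`. Cross terms vanish because one family of influence
functions lives on observational units and the other on randomized ones. -/

namespace DataFusion

noncomputable section

/-! ### Integrals over one round -/

section RoundLaw

variable {𝓧 𝓤 : Type*} [MeasurableSpace 𝓧] [MeasurableSpace 𝓤] {J : ℕ}
  {Q : Measure (UnitRec 𝓧 𝓤 J)}

/-- The law of a fair coin. -/
def coin : Measure Bool := uniformOn (Set.univ : Set Bool)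

instance : IsProbabilityMeasure coin :=
  isProbabilityMeasure_uniformOn Set.finite_univ Set.univ_nonempty

/-- The law of a unit record together with a fair coin. -/
abbrev coinLaw (Q : Measure (UnitRec 𝓧 𝓤 J)) : Measure (UnitRec 𝓧 𝓤 J × Bool) := Q.prod coin

/-- The law of one randomized unit when the interventions in `s` are open to randomization. -/
abbrev rctLaw (Q : Measure (UnitRec 𝓧 𝓤 J)) (s : Finset (Fin J)) : Measure (RctRec 𝓧 𝓤 J) :=
  Q.prod ((uniformOn (s : Set (Fin J))).prod coin)

variable [IsProbabilityMeasure Q]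

omit [IsProbabilityMeasure Q] in
lemma roundLaw_eq (n l : ℕ) (s : Finset (Fin J)) :
    roundLaw Q n l s = (Measure.pi fun _ : Fin n => Q).prod (Measure.pi fun _ : Fin l => rctLaw Q s) :=
  rfl

instance (n l : ℕ) (s : Finset (Fin J)) : IsFiniteMeasure (roundLaw Q n l s) := by
  rw [roundLaw_eq]; infer_instance

/-- Condition on `W` by Fubini: every arm contributes the same mean `c`, and averaging a constant
over `s` returns it. The independence of the answer from `s` is what makes an adaptive choice of `s`
harmless. -/
lemma integral_rctLaw_eq {s : Finset (Fin J)} (hs : s.Nonempty)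
    {F : Fin J → UnitRec 𝓧 𝓤 J × Bool → ℂ} (hF : ∀ j, Measurable (F j)) {C : ℝ}
    (hC : ∀ j p, ‖F j p‖ ≤ C) {c : ℂ} (hc : ∀ j, ∫ p, F j p ∂(coinLaw Q) = c) :
    ∫ r, F r.2.1 (r.1, r.2.2) ∂(rctLaw Q s) = c := by
  have : IsProbabilityMeasure (uniformOn (s : Set (Fin J))) :=
    isProbabilityMeasure_uniformOn s.finite_toSet (by simpa using hs)
  have hm : Measurable fun q : Fin J × (UnitRec 𝓧 𝓤 J × Bool) => F q.1 q.2 :=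
    measurable_from_prod_countable_right hF
  have hm' : Measurable fun r : RctRec 𝓧 𝓤 J => F r.2.1 (r.1, r.2.2) :=
    hm.comp (g := fun q : Fin J × (UnitRec 𝓧 𝓤 J × Bool) => F q.1 q.2)
      (f := fun r : RctRec 𝓧 𝓤 J => (r.2.1, (r.1, r.2.2))) (by fun_prop)
  have hint : Integrable (fun r : RctRec 𝓧 𝓤 J => F r.2.1 (r.1, r.2.2)) (rctLaw Q s) :=
    Integrable.of_bound hm'.aestronglyMeasurable C (ae_of_all _ fun r => hC _ _)
  have hint2 : ∀ z, Integrable (fun q : Fin J × Bool => F q.1 (z, q.2))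
      ((uniformOn (s : Set (Fin J))).prod coin) := fun z =>
    Integrable.of_bound (hm'.comp (measurable_prodMk_left (x := z))).aestronglyMeasurable C
      (ae_of_all _ fun r => hC _ _)
  rw [integral_prod _ hint]
  have h1 : ∀ z, ∫ q : Fin J × Bool, F q.1 (z, q.2)
      ∂((uniformOn (s : Set (Fin J))).prod coin) =
      ∫ j, ∫ b, F j (z, b) ∂coin ∂(uniformOn (s : Set (Fin J))) :=
    fun z => integral_prod _ (hint2 z)
  simp_rw [h1]
  have hm3 : Measurable fun q : UnitRec 𝓧 𝓤 J × Fin J =>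
      ∫ b, F q.2 (q.1, b) ∂coin := by
    have : StronglyMeasurable fun q : (UnitRec 𝓧 𝓤 J × Fin J) × Bool => F q.1.2 (q.1.1, q.2) :=
      (hm.comp (g := fun q : Fin J × (UnitRec 𝓧 𝓤 J × Bool) => F q.1 q.2)
        (f := fun q : (UnitRec 𝓧 𝓤 J × Fin J) × Bool => (q.1.2, (q.1.1, q.2)))
        (by fun_prop)).stronglyMeasurable
    exact this.integral_prod_right'.measurable
  have hb3 : ∀ q : UnitRec 𝓧 𝓤 J × Fin J,
      ‖∫ b, F q.2 (q.1, b) ∂coin‖ ≤ C := fun q => by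
    have h := norm_integral_le_of_norm_le_const (μ := coin) (ae_of_all _ fun b => hC q.2 (q.1, b))
    rwa [probReal_univ, mul_one] at h
  rw [integral_integral_swap (f := fun z j => ∫ b, F j (z, b) ∂coin)
    (Integrable.of_bound hm3.aestronglyMeasurable C (ae_of_all _ hb3))]
  have h4 : ∀ j, ∫ z, ∫ b, F j (z, b) ∂coin ∂Q = c := fun j => by
    rw [← hc j, integral_prod _
      (Integrable.of_bound (hF j).aestronglyMeasurable C (ae_of_all _ fun r => hC _ _))]
  simp [h4]

/-- The integral over a round of a product of factors, one for every unit. -/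
lemma integral_roundLaw_prod {n l : ℕ} {s : Finset (Fin J)} (A : Fin n → UnitRec 𝓧 𝓤 J → ℂ)
    (B : RctRec 𝓧 𝓤 J → ℂ) :
    ∫ x, (∏ i, A i (x.1 i)) * ∏ k, B (x.2 k) ∂(roundLaw Q n l s) =
      (∏ i, ∫ z, A i z ∂Q) * (∫ r, B r ∂(rctLaw Q s)) ^ l := by
  rw [roundLaw_eq, integral_prod_mul (fun x : Fin n → UnitRec 𝓧 𝓤 J => ∏ i, A i (x i))
    (fun x : Fin l → RctRec 𝓧 𝓤 J => ∏ k, B (x k)), integral_fintype_prod_eq_prod,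
    integral_fintype_prod_eq_pow, Fintype.card_fin]

end RoundLaw

/-! ### The sampling scheme: integrating out rounds, independence of the observational units -/

section Sampling

variable {Ω 𝓧 𝓤 : Type*} {mΩ : MeasurableSpace Ω} [MeasurableSpace 𝓧] [MeasurableSpace 𝓤]
  {P : Measure Ω} [IsProbabilityMeasure P] {J : ℕ}
  {Q : Measure (UnitRec 𝓧 𝓤 J)} [IsProbabilityMeasure Q]
  {D : Rounds Ω 𝓧 𝓤 J} {ℱ : Filtration ℕ mΩ}

namespace Rounds.IsSampled

/-- On the event that `s` is open to randomization, the data of a round are independent of the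
history. -/
lemma map_prodMk (hD : D.IsSampled P ℱ Q) {m : ℕ} {E : Type*} [MeasurableSpace E] {X : Ω → E}
    (hX : Measurable[ℱ m] X) (s : Finset (Fin J)) :
    (P.restrict {ω | D.S m ω = s}).map (fun ω => (X ω, D.block m ω)) =
      ((P.restrict {ω | D.S m ω = s}).map X).prod (roundLaw Q (D.N m) (D.L m) s) := by
  have hX' : Measurable X := hX.mono (ℱ.le m) le_rfl
  have hb : Measurable (D.block m) := (hD.measurable_block m).mono (ℱ.le _) le_rfl
  refine (Measure.prod_eq fun A B hA hB => ?_).symm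
  have h := congrArg (fun μ => μ B) (hD.law m s (X ⁻¹' A) (hX hA))
  simp only [Measure.smul_apply, smul_eq_mul] at h
  rw [Measure.map_apply hb hB, Measure.restrict_apply (hb hB)] at h
  rw [Measure.map_apply (hX'.prodMk hb) (hA.prod hB), Measure.map_apply hX' hA,
    Measure.restrict_apply ((hX'.prodMk hb) (hA.prod hB)), Measure.restrict_apply (hX' hA), ← h]
  congr 1
  ext ω
  simp only [Set.mem_inter_iff, Set.mem_preimage, Set.mem_prod]
  tauto

lemma measurableSet_S (hD : D.IsSampled P ℱ Q) (m : ℕ) (s : Finset (Fin J)) :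
    MeasurableSet {ω | D.S m ω = s} := (ℱ.le m) _ (hD.measurable_S m s)

lemma measurable_block' (hD : D.IsSampled P ℱ Q) (m : ℕ) : Measurable (D.block m) :=
  (hD.measurable_block m).mono (ℱ.le _) le_rfl

lemma measurable_obs (hD : D.IsSampled P ℱ Q) (m : ℕ) (i : Fin (D.N m)) :
    Measurable (D.obs m i) :=
  (measurable_pi_apply i).comp (measurable_fst.comp (hD.measurable_block' m))

lemma measurable_rct (hD : D.IsSampled P ℱ Q) (m : ℕ) (l : Fin (D.L m)) :
    Measurable (D.rct m l) :=
  (measurable_pi_apply l).comp (measurable_snd.comp (hD.measurable_block' m))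

/-- A factor that depends on the data of a round, and whose mean given the history is constant,
can be integrated out. -/
lemma integral_mul_block (hD : D.IsSampled P ℱ Q) {m : ℕ} {X : Ω → ℂ} (hX : Measurable[ℱ m] X)
    {B : (Fin (D.N m) → UnitRec 𝓧 𝓤 J) × (Fin (D.L m) → RctRec 𝓧 𝓤 J) → ℂ} (hB : Measurable B)
    {C C' : ℝ} (hXC : ∀ ω, ‖X ω‖ ≤ C) (hBC : ∀ x, ‖B x‖ ≤ C') {c : ℂ}
    (hc : ∀ s, P {ω | D.S m ω = s} ≠ 0 → ∫ x, B x ∂(roundLaw Q (D.N m) (D.L m) s) = c) :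
    ∫ ω, X ω * B (D.block m ω) ∂P = (∫ ω, X ω ∂P) * c := by
  have hX' : Measurable X := hX.mono (ℱ.le m) le_rfl
  have hb := hD.measurable_block' m
  have hint : Integrable (fun ω => X ω * B (D.block m ω)) P :=
    Integrable.of_bound (hX'.mul (hB.comp hb)).aestronglyMeasurable (C * C')
      (ae_of_all _ fun ω => by
        rw [norm_mul]
        exact mul_le_mul (hXC ω) (hBC _) (norm_nonneg _) ((norm_nonneg _).trans (hXC ω)))
  have hintX : Integrable X P := Integrable.of_bound hX'.aestronglyMeasurable C (ae_of_all _ hXC)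
  have hU : (⋃ s ∈ (Finset.univ : Finset (Finset (Fin J))), {ω | D.S m ω = s}) = Set.univ := by
    ext ω; simp
  have hdisj : Set.PairwiseDisjoint (↑(Finset.univ : Finset (Finset (Fin J))))
      (fun s => {ω | D.S m ω = s}) := by
    intro s _ t _ hst
    refine Set.disjoint_left.2 fun ω h1 h2 => hst ?_
    simp only [Set.mem_ofPred_eq] at h1 h2
    rw [← h1, ← h2]
  have hsplit : ∀ Y : Ω → ℂ, Integrable Y P →
      ∫ ω, Y ω ∂P = ∑ s : Finset (Fin J), ∫ ω in {ω | D.S m ω = s}, Y ω ∂P := fun Y hY => by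
    rw [← integral_biUnion_finset _ (fun s _ => hD.measurableSet_S m s) hdisj
      (fun s _ => hY.integrableOn), hU, Measure.restrict_univ]
  rw [hsplit _ hint, hsplit _ hintX, Finset.sum_mul]
  refine Finset.sum_congr rfl fun s _ => ?_
  by_cases h0 : P {ω | D.S m ω = s} = 0
  · simp [Measure.restrict_eq_zero.2 h0]
  rw [← hc s h0]
  have h1 : ∫ ω in {ω | D.S m ω = s}, X ω * B (D.block m ω) ∂P =
      ∫ y, y.1 * B y.2 ∂((P.restrict {ω | D.S m ω = s}).map (fun ω => (X ω, D.block m ω))) := by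
    rw [integral_map (hX'.prodMk hb).aemeasurable
      (by fun_prop)]
  rw [h1, hD.map_prodMk hX s, integral_prod_mul (fun y : ℂ => y) B,
    integral_map hX'.aemeasurable (by fun_prop)]

/-- Induction on the rounds, integrating out the last one. Since the mean of each factor is the same
for all randomization sets of positive probability, the expectation factorizes although the rounds
are dependent. -/
lemma integral_prod_block (hD : D.IsSampled P ℱ Q)
    {B : ∀ m, (Fin (D.N m) → UnitRec 𝓧 𝓤 J) × (Fin (D.L m) → RctRec 𝓧 𝓤 J) → ℂ}
    (hB : ∀ m, Measurable (B m)) {C : ℕ → ℝ} (hBC : ∀ m x, ‖B m x‖ ≤ C m) {c : ℕ → ℂ}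
    (hc : ∀ m s, P {ω | D.S m ω = s} ≠ 0 → ∫ x, B m x ∂(roundLaw Q (D.N m) (D.L m) s) = c m)
    (m : ℕ) :
    ∫ ω, ∏ ν ∈ Finset.range m, B ν (D.block ν ω) ∂P = ∏ ν ∈ Finset.range m, c ν := by
  induction m with
  | zero => simp
  | succ m ih =>
    have hmeas : Measurable[ℱ m] fun ω => ∏ ν ∈ Finset.range m, B ν (D.block ν ω) := by
      refine Finset.measurable_fun_prod _ fun ν hν => ?_
      exact (hB ν).comp ((hD.measurable_block ν).mono
        (ℱ.mono (Nat.succ_le_of_lt (Finset.mem_range.1 hν))) le_rfl)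
    simp_rw [Finset.prod_range_succ]
    rw [hD.integral_mul_block hmeas (hB m) (C := ∏ ν ∈ Finset.range m, C ν) ?_ (hBC m) (hc m), ih]
    intro ω
    rw [norm_prod]
    exact Finset.prod_le_prod (fun _ _ => norm_nonneg _) fun ν _ => hBC ν _

/-- `uniformOn ∅` is the zero measure, so with at least one randomized unit the law of the round
would be zero. Comparing total masses leaves no room for the empty set. -/
lemma measure_S_eq_empty (hD : D.IsSampled P ℱ Q) {m : ℕ} (hL : D.L m ≠ 0) :
    P {ω | D.S m ω = ∅} = 0 := by
  have h := congrArg (fun μ => μ Set.univ) (hD.law m ∅ Set.univ MeasurableSet.univ)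
  have : Nonempty (Fin (D.L m)) := ⟨⟨0, Nat.pos_of_ne_zero hL⟩⟩
  have h0 : roundLaw Q (D.N m) (D.L m) (∅ : Finset (Fin J)) = 0 := by
    rw [roundLaw_eq, ← Measure.measure_univ_eq_zero, ← Set.univ_prod_univ, Measure.prod_prod,
      Measure.pi_univ (fun _ : Fin (D.L m) => rctLaw Q ∅)]
    simp [rctLaw, hL]
  rw [h0] at h
  simpa [Measure.map_apply (hD.measurable_block' m) MeasurableSet.univ] using h

/-- On each of the finitely many events `S m = s`, the law of `W` is `uniformOn s`, which does not
charge the complement of `s`. -/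
lemma ae_W_mem (hD : D.IsSampled P ℱ Q) :
    ∀ᵐ ω ∂P, ∀ m (l : Fin (D.L m)), (D.rct m l ω).2.1 ∈ D.S m ω := by
  rw [ae_all_iff]; intro m
  rw [ae_all_iff]; intro l
  have key : ∀ s, P ({ω | D.S m ω = s} ∩ {ω | (D.rct m l ω).2.1 ∉ s}) = 0 := by
    intro s
    set B : Set ((Fin (D.N m) → UnitRec 𝓧 𝓤 J) × (Fin (D.L m) → RctRec 𝓧 𝓤 J)) :=
      {x | (x.2 l).2.1 ∉ s} with hBdef
    have hBm : MeasurableSet B := by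
      have : Measurable fun x : (Fin (D.N m) → UnitRec 𝓧 𝓤 J) × (Fin (D.L m) → RctRec 𝓧 𝓤 J) =>
        (x.2 l).2.1 := by fun_prop
      exact this (s.measurableSet.compl)
    have h := congrArg (fun μ => μ B) (hD.law m s Set.univ MeasurableSet.univ)
    have h0 : roundLaw Q (D.N m) (D.L m) s B = 0 := by
      have hB' : B = Set.univ ×ˢ (Set.univ.pi fun k => if k = l then
          (Set.univ ×ˢ (((s : Set (Fin J))ᶜ) ×ˢ Set.univ) : Set (RctRec 𝓧 𝓤 J))
          else Set.univ) := by
        ext x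
        simp only [hBdef, Set.mem_ofPred_eq, Set.mem_prod, Set.mem_univ, true_and, Set.mem_pi,
          forall_const]
        constructor
        · intro hx k
          split_ifs with hk
          · subst hk; simpa using hx
          · trivial
        · intro hx
          simpa using hx l
      rw [hB', roundLaw_eq, Measure.prod_prod]
      refine mul_eq_zero_of_right _ ?_
      rw [Measure.pi_pi]
      refine Finset.prod_eq_zero (Finset.mem_univ l) ?_
      simp only [if_true]
      rw [Measure.prod_prod, Measure.prod_prod]
      have : uniformOn (s : Set (Fin J)) ((s : Set (Fin J))ᶜ) = 0 := by
        simp [uniformOn, cond_apply s.measurableSet]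
      simp [this]
    rw [Measure.smul_apply, h0, Measure.map_apply (hD.measurable_block' m) hBm,
      Measure.restrict_apply (hD.measurable_block' m hBm)] at h
    simp only [smul_zero, Set.univ_inter] at h
    rw [← h, Set.inter_comm]
    rfl
  have : {ω | ¬ (D.rct m l ω).2.1 ∈ D.S m ω} ⊆
      ⋃ s : Finset (Fin J), ({ω | D.S m ω = s} ∩ {ω | (D.rct m l ω).2.1 ∉ s}) := by
    intro ω hω
    exact Set.mem_iUnion.2 ⟨D.S m ω, rfl, hω⟩
  exact measure_mono_null this (measure_iUnion_null key)

/-- The observational units of the first `m` rounds are independent with law `Q`. -/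
lemma map_obs (hD : D.IsSampled P ℱ Q) (m : ℕ) :
    P.map (fun ω (p : Σ ν : Fin m, Fin (D.N ν)) => D.obs p.1 p.2 ω) = Measure.pi fun _ => Q := by
  have hm : Measurable fun ω (p : Σ ν : Fin m, Fin (D.N ν)) => D.obs p.1 p.2 ω :=
    measurable_pi_lambda _ fun p => hD.measurable_obs _ _
  refine (Measure.pi_eq fun A hA => ?_).symm
  have : IsProbabilityMeasure (P.map fun ω (p : Σ ν : Fin m, Fin (D.N ν)) => D.obs p.1 p.2 ω) :=
    Measure.isProbabilityMeasure_map hm.aemeasurable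
  rw [Measure.map_apply hm (MeasurableSet.univ_pi hA)]
  -- `integral_prod_block` wants factors for all rounds, so the box is continued by `Set.univ` past
  -- round `m`. The probability of the box is then the mean of a product of indicators.
  set A' : ∀ ν, Fin (D.N ν) → Set (UnitRec 𝓧 𝓤 J) :=
    fun ν i => if h : ν < m then A ⟨⟨ν, h⟩, i⟩ else Set.univ with hA'
  have hA'm : ∀ ν i, MeasurableSet (A' ν i) := fun ν i => by
    simp only [hA']; split_ifs with h
    · exact hA _
    · exact MeasurableSet.univ
  have key := hD.integral_prod_block
    (B := fun ν x => (∏ i, (A' ν i).indicator (fun _ => (1 : ℂ)) (x.1 i)) * ∏ _k : Fin (D.L ν), 1)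
    (fun ν => by
      refine Measurable.mul (Finset.measurable_fun_prod _ fun i _ => ?_) (by fun_prop)
      exact (measurable_const.indicator (hA'm ν i)).comp
        ((measurable_pi_apply i).comp measurable_fst))
    (C := fun _ => 1)
    (fun ν x => by
      simp only [Finset.prod_const_one, mul_one, norm_prod]
      refine Finset.prod_le_one (fun _ _ => norm_nonneg _) fun i _ => ?_
      by_cases hx : x.1 i ∈ A' ν i <;> simp [hx])
    (c := fun ν => ∏ i, (Q.real (A' ν i) : ℂ))
    (fun ν s hs => by
      rw [integral_roundLaw_prod (fun i => (A' ν i).indicator fun _ => (1 : ℂ)) (fun _ => 1)]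
      -- If `s` is empty, `rctLaw Q s` has mass zero. This can only happen on a non-null event when
      -- there are no randomized units, and then the exponent is zero.
      have h1 : (∫ _r, (1 : ℂ) ∂(rctLaw Q s)) ^ D.L ν = 1 := by
        by_cases hL : D.L ν = 0
        · simp [hL]
        · have hs' : s.Nonempty := by
            rw [Finset.nonempty_iff_ne_empty]
            rintro rfl
            exact hs (hD.measure_S_eq_empty hL)
          have : IsProbabilityMeasure (uniformOn (s : Set (Fin J))) :=
            isProbabilityMeasure_uniformOn s.finite_toSet (by simpa using hs')
          simp
      rw [h1, mul_one]
      refine Finset.prod_congr rfl fun i _ => ?_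
      rw [integral_indicator_const _ (hA'm ν i)]
      simp) m
  have hpt : ∀ ω, ∏ ν ∈ Finset.range m, ((∏ i, (A' ν i).indicator (fun _ => (1 : ℂ))
      ((D.block ν ω).1 i)) * ∏ _k : Fin (D.L ν), 1) =
      ((fun ω (p : Σ ν : Fin m, Fin (D.N ν)) => D.obs p.1 p.2 ω) ⁻¹' (Set.univ.pi A)).indicator
        (fun _ => (1 : ℂ)) ω := by
    intro ω
    simp only [Finset.prod_const_one, mul_one, block]
    rw [Finset.prod_range fun ν => ∏ i, (A' ν i).indicator (fun _ => (1 : ℂ)) (D.obs ν i ω)]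
    rw [← Fintype.prod_sigma' (fun (ν : Fin m) (i : Fin (D.N ν)) =>
      (A' ν i).indicator (fun _ => (1 : ℂ)) (D.obs ν i ω))]
    by_cases h : ω ∈ (fun ω (p : Σ ν : Fin m, Fin (D.N ν)) => D.obs p.1 p.2 ω) ⁻¹' (Set.univ.pi A)
    · rw [Set.indicator_of_mem h]
      refine Finset.prod_eq_one fun p _ => ?_
      rw [Set.indicator_of_mem]
      have := h p (Set.mem_univ p)
      simpa [hA'] using this
    · rw [Set.indicator_of_notMem h]
      simp only [Set.mem_preimage, Set.mem_pi, Set.mem_univ, forall_const, not_forall] at h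
      obtain ⟨p, hp⟩ := h
      refine Finset.prod_eq_zero (Finset.mem_univ p) ?_
      rw [Set.indicator_of_notMem]
      simpa [hA'] using hp
  simp_rw [hpt] at key
  rw [integral_indicator_const _ (hm (MeasurableSet.univ_pi hA)),
    Finset.prod_range fun ν => ∏ i, (Q.real (A' ν i) : ℂ),
    ← Fintype.prod_sigma' (fun (ν : Fin m) (i : Fin (D.N ν)) => (Q.real (A' ν i) : ℂ))] at key
  have key' : P.real ((fun ω (p : Σ ν : Fin m, Fin (D.N ν)) => D.obs p.1 p.2 ω) ⁻¹'
      (Set.univ.pi A)) = ∏ p, Q.real (A p) := by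
    have h2 : ∏ p : Σ ν : Fin m, Fin (D.N ν), (Q.real (A' p.1 p.2) : ℂ) =
        ((∏ p, Q.real (A p) : ℝ) : ℂ) := by
      push_cast
      exact Finset.prod_congr rfl fun p _ => by simp [hA']
    rw [h2] at key
    simpa [← Complex.ofReal_inj] using key
  rw [← ENNReal.toReal_eq_toReal_iff' (measure_ne_top _ _)
    (ENNReal.prod_ne_top fun p _ => measure_ne_top _ _), ENNReal.toReal_prod]
  exact key'

end Rounds.IsSampled

end Sampling

/-! ### Second order expansions of characteristic functions -/

section CharFun

variable {Ω : Type*} {mΩ : MeasurableSpace Ω} {P : Measure Ω} [IsProbabilityMeasure P]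

lemma charFun_map_real {X : Ω → ℝ} (hX : Measurable X) (t : ℝ) :
    charFun (P.map X) t = ∫ ω, Complex.exp (Complex.I * (t * X ω : ℝ)) ∂P := by
  rw [charFun_apply_real, integral_map hX.aemeasurable (by fun_prop)]
  refine integral_congr_ae (ae_of_all _ fun ω => ?_)
  push_cast
  ring_nf

/-- Combine the second order Taylor expansion of the characteristic function at zero with `log z =
(z - 1) + o(z - 1)` at one; the linear term drops because `X` is centred. -/
lemma isLittleO_log_charFun {X : Ω → ℝ} (hX : Measurable X) (h2 : MemLp X 2 P)
    (h0 : ∫ ω, X ω ∂P = 0) :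
    (fun t : ℝ => Complex.log (charFun (P.map X) t) + ((∫ ω, X ω ^ 2 ∂P : ℝ) / 2 * t ^ 2 : ℂ))
      =o[𝓝 0] fun t : ℝ => t ^ 2 := by
  have : IsProbabilityMeasure (P.map X) := Measure.isProbabilityMeasure_map hX.aemeasurable
  have hmem : MemLp id 2 (P.map X) := by
    rw [memLp_map_measure_iff (by fun_prop) hX.aemeasurable]
    exact h2
  set v : ℝ := ∫ ω, X ω ^ 2 ∂P with hv
  have h1 : (fun t : ℝ => charFun (P.map X) t - (1 - v / 2 * t ^ 2 : ℂ)) =o[𝓝 0]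
      fun t : ℝ => t ^ 2 := by
    have h := taylor_isLittleO_univ (f := charFun (P.map X)) (x₀ := 0) (n := 2)
      (contDiff_charFun (n := 2) hmem)
    refine (h.congr (fun t => ?_) (fun t => by simp))
    rw [taylorWithinEval_charFun_two_zero hX.aemeasurable hmem]
    simp only [h0, Pi.pow_apply, ← hv]
    push_cast
    ring
  have h3 : (fun t : ℝ => charFun (P.map X) t - 1) =O[𝓝 0] fun t : ℝ => t ^ 2 := by
    have hb : (fun t : ℝ => (-(v / 2 * t ^ 2) : ℂ)) =O[𝓝 0] fun t : ℝ => t ^ 2 := by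
      refine Asymptotics.IsBigO.of_bound (|v / 2|) (Eventually.of_forall fun t => ?_)
      simp [abs_div]
    refine (h1.isBigO.add hb).congr_left fun t => by ring
  have hlog : (fun z : ℂ => Complex.log z - (z - 1)) =o[𝓝 1] fun z : ℂ => z - 1 := by
    have := (Complex.hasDerivAt_log Complex.one_mem_slitPlane).isLittleO
    simpa using this
  have hφ : Tendsto (fun t : ℝ => charFun (P.map X) t) (𝓝 0) (𝓝 1) := by
    have := (continuous_charFun (μ := P.map X)).tendsto 0
    simpa using this
  have h4 : (fun t : ℝ => Complex.log (charFun (P.map X) t) - (charFun (P.map X) t - 1)) =o[𝓝 0]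
      fun t : ℝ => t ^ 2 := (hlog.comp_tendsto hφ).trans_isBigO h3
  exact (h4.add h1).congr_left fun t => by ring

lemma charFun_ne_zero_eventually {X : Ω → ℝ} (hX : Measurable X) :
    ∀ᶠ t in 𝓝 (0 : ℝ), charFun (P.map X) t ≠ 0 := by
  have : IsProbabilityMeasure (P.map X) := Measure.isProbabilityMeasure_map hX.aemeasurable
  have h := (continuous_charFun (μ := P.map X)).tendsto 0
  exact h.eventually_ne (by simp)

lemma tendsto_inv_sqrt {r : ℕ → ℝ} (hr : Tendsto r atTop atTop) :
    Tendsto (fun m => (√(r m))⁻¹) atTop (𝓝 0) :=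
  tendsto_inv_atTop_zero.comp (Real.tendsto_sqrt_atTop.comp hr)

/-- The expansion at `t = r^(-1/2)`, multiplied by `r = t⁻²`: the logarithm of the normalizer of
about `r` units tends to minus half the variance. -/
lemma tendsto_mul_log_charFun {X : Ω → ℝ} (hX : Measurable X) (h2 : MemLp X 2 P)
    (h0 : ∫ ω, X ω ∂P = 0) {r : ℕ → ℝ} (hr : Tendsto r atTop atTop) :
    Tendsto (fun m => (r m : ℂ) * Complex.log (charFun (P.map X) (√(r m))⁻¹) +
      ((∫ ω, X ω ^ 2 ∂P : ℝ) / 2 : ℂ)) atTop (𝓝 0) := by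
  have h := ((isLittleO_log_charFun hX h2 h0).comp_tendsto (tendsto_inv_sqrt hr))
  have h' := (h.norm_right.norm_left).tendsto_div_nhds_zero
  rw [tendsto_zero_iff_norm_tendsto_zero]
  refine h'.congr' ?_
  filter_upwards [hr.eventually_gt_atTop 0] with m hm
  simp only [Function.comp_apply]
  have hsq : ((√(r m))⁻¹) ^ 2 = (r m)⁻¹ := by rw [inv_pow, Real.sq_sqrt hm.le]
  have hsqC : ((((√(r m))⁻¹ : ℝ) : ℂ)) ^ 2 = ((r m : ℂ))⁻¹ := by
    rw [← Complex.ofReal_pow, hsq, Complex.ofReal_inv]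
  have hne : (r m : ℂ) ≠ 0 := by exact_mod_cast hm.ne'
  have hn : ‖(r m : ℂ)‖ = r m := by rw [Complex.norm_real, Real.norm_of_nonneg hm.le]
  rw [hsqC, hsq, Real.norm_of_nonneg (inv_nonneg.2 hm.le), div_inv_eq_mul]
  conv_lhs => rw [← hn, ← norm_mul, hn]
  congr 1
  field_simp

/-- Bounded convergence in probability implies convergence in mean. -/
lemma tendsto_integral_abs_sub_of_tendstoInMeasure {X : ℕ → Ω → ℝ} {c K : ℝ}
    (hX : ∀ m, AEStronglyMeasurable (X m) P) (hK : ∀ m ω, |X m ω| ≤ K)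
    (h : TendstoInMeasure P X atTop fun _ => c) :
    Tendsto (fun m => ∫ ω, |X m ω - c| ∂P) atTop (𝓝 0) := by
  -- Every subsequence has a further subsequence that converges almost everywhere, to which
  -- dominated convergence applies.
  refine tendsto_of_subseq_tendsto fun ns hns => ?_
  obtain ⟨ms, -, hms⟩ := (h.comp hns).exists_seq_tendsto_ae'
  refine ⟨ms, ?_⟩
  have := tendsto_integral_of_dominated_convergence (μ := P) (f := fun _ => (0 : ℝ))
    (F := fun n ω => |X (ns (ms n)) ω - c|) (fun _ => K + |c|)
    (fun n => (((hX _).sub aestronglyMeasurable_const).norm)) (integrable_const _)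
    (fun n => ae_of_all _ fun ω => by
      rw [Real.norm_eq_abs, abs_abs]
      exact (abs_sub _ _).trans (add_le_add (hK _ _) le_rfl)) ?_
  · simpa using this
  · filter_upwards [hms] with ω hω
    have := (hω.sub_const c).abs
    simpa using this

end CharFun

/-! ### The central limit theorem under adaptive randomization -/

namespace Rounds

variable {Ω 𝓧 𝓤 : Type*} {J : ℕ} (D : Rounds Ω 𝓧 𝓤 J)

/-- The sum of `g` over the observational units of the first `m` rounds. -/
def unitSum (g : UnitRec 𝓧 𝓤 J → ℝ) (m : ℕ) (ω : Ω) : ℝ :=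
  ∑ ν ∈ Finset.range m, ∑ i : Fin (D.N ν), g (D.obs ν i ω)

/-- The sum of `h W` over the randomized units of the first `m` rounds. -/
def armSum (h : Fin J → UnitRec 𝓧 𝓤 J × Bool → ℝ) (m : ℕ) (ω : Ω) : ℝ :=
  ∑ ν ∈ Finset.range m, ∑ l : Fin (D.L ν),
    h (D.rct ν l ω).2.1 ((D.rct ν l ω).1, (D.rct ν l ω).2.2)

lemma count_nonneg (m : ℕ) (ω : Ω) (j : Fin J) : 0 ≤ D.count m ω j :=
  Finset.sum_nonneg fun _ _ => Finset.sum_nonneg fun _ _ => by split_ifs <;> norm_num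

lemma count_le (m : ℕ) (ω : Ω) (j : Fin J) : D.count m ω j ≤ D.Lbar m := by
  refine Finset.sum_le_sum fun ν _ => ?_
  calc _ ≤ ∑ l : Fin (D.L ν), (1 : ℝ) := Finset.sum_le_sum fun _ _ => by split_ifs <;> norm_num
    _ = _ := by simp

lemma Lbar_nonneg (m : ℕ) : 0 ≤ D.Lbar m := Finset.sum_nonneg fun _ _ => Nat.cast_nonneg _

lemma Nbar_nonneg (m : ℕ) : 0 ≤ D.Nbar m := Finset.sum_nonneg fun _ _ => Nat.cast_nonneg _

lemma abs_count_div_le (m : ℕ) (ω : Ω) (j : Fin J) : |D.count m ω j / D.Lbar m| ≤ 1 := by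
  rw [abs_of_nonneg (div_nonneg (D.count_nonneg m ω j) (D.Lbar_nonneg m))]
  exact div_le_one_of_le₀ (D.count_le m ω j) (D.Lbar_nonneg m)

/-- A sum over the randomized units of a quantity that depends on `W` only. -/
lemma sum_W {E : Type*} [AddCommMonoid E] [Module ℝ E] (c : Fin J → E) (m : ℕ) (ω : Ω) :
    ∑ ν ∈ Finset.range m, ∑ l : Fin (D.L ν), c (D.rct ν l ω).2.1 = ∑ j, D.count m ω j • c j := by
  simp only [count, Finset.sum_smul, ite_smul, one_smul, zero_smul]
  rw [Finset.sum_comm]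
  refine Finset.sum_congr rfl fun ν _ => ?_
  rw [Finset.sum_comm]
  refine Finset.sum_congr rfl fun l _ => ?_
  simp

variable [mΩ : MeasurableSpace Ω] [MeasurableSpace 𝓧] [MeasurableSpace 𝓤]
  {P : Measure Ω} [IsProbabilityMeasure P]
  {Q : Measure (UnitRec 𝓧 𝓤 J)} [IsProbabilityMeasure Q]
  {D} {ℱ : Filtration ℕ mΩ}

namespace IsSampled

lemma measurable_unitSum (hD : D.IsSampled P ℱ Q) {g : UnitRec 𝓧 𝓤 J → ℝ} (hg : Measurable g)
    (m : ℕ) : Measurable (D.unitSum g m) :=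
  Finset.measurable_fun_sum _ fun ν _ => Finset.measurable_fun_sum _ fun i _ =>
    hg.comp (hD.measurable_obs ν i)

lemma measurable_arm {E : Type*} [MeasurableSpace E] {h : Fin J → UnitRec 𝓧 𝓤 J × Bool → E}
    (hh : ∀ j, Measurable (h j)) :
    Measurable fun r : RctRec 𝓧 𝓤 J => h r.2.1 (r.1, r.2.2) := by
  have hm : Measurable fun q : Fin J × (UnitRec 𝓧 𝓤 J × Bool) => h q.1 q.2 :=
    measurable_from_prod_countable_right hh
  exact hm.comp (g := fun q : Fin J × (UnitRec 𝓧 𝓤 J × Bool) => h q.1 q.2)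
      (f := fun r : RctRec 𝓧 𝓤 J => (r.2.1, (r.1, r.2.2))) (by fun_prop)

lemma measurable_armSum (hD : D.IsSampled P ℱ Q) {h : Fin J → UnitRec 𝓧 𝓤 J × Bool → ℝ}
    (hh : ∀ j, Measurable (h j)) (m : ℕ) : Measurable (D.armSum h m) :=
  Finset.measurable_fun_sum _ fun ν _ => Finset.measurable_fun_sum _ fun l _ =>
    (measurable_arm hh).comp (hD.measurable_rct ν l)

lemma measurable_count (hD : D.IsSampled P ℱ Q) (m : ℕ) (j : Fin J) :
    Measurable fun ω => D.count m ω j :=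
  Finset.measurable_fun_sum _ fun ν _ => Finset.measurable_fun_sum _ fun l _ =>
    Measurable.ite ((by fun_prop : Measurable fun r : RctRec 𝓧 𝓤 J => r.2.1).comp
      (hD.measurable_rct ν l) (measurableSet_singleton j)) measurable_const measurable_const

/-- Normalizing the characters of the units by their means gives a variable of mean one. -/
lemma integral_exp_mul_exp_neg (hD : D.IsSampled P ℱ Q) {g : UnitRec 𝓧 𝓤 J → ℝ} (hg : Measurable g)
    {h : Fin J → UnitRec 𝓧 𝓤 J × Bool → ℝ} (hh : ∀ j, Measurable (h j)) (a b : ℝ)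
    (hga : charFun (Q.map g) a ≠ 0) (hhb : ∀ j, charFun ((coinLaw Q).map (h j)) b ≠ 0) (m : ℕ) :
    ∫ ω, Complex.exp (Complex.I * (a * D.unitSum g m ω + b * D.armSum h m ω : ℝ)) *
      Complex.exp (-(D.Nbar m * Complex.log (charFun (Q.map g) a) +
        ∑ j, (D.count m ω j : ℂ) * Complex.log (charFun ((coinLaw Q).map (h j)) b))) ∂P = 1 := by
  set cg := Complex.log (charFun (Q.map g) a) with hcg
  set ch := fun j => Complex.log (charFun ((coinLaw Q).map (h j)) b) with hch
  -- Dividing by the mean is written as subtracting its logarithm in the exponent, so that the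
  -- product over the units becomes the exponential of a sum in which only the arm counts remain.
  set A : UnitRec 𝓧 𝓤 J → ℂ := fun z => Complex.exp (Complex.I * (a * g z : ℝ) - cg) with hA
  set F : Fin J → UnitRec 𝓧 𝓤 J × Bool → ℂ :=
    fun j p => Complex.exp (Complex.I * (b * h j p : ℝ) - ch j) with hF
  have hAm : Measurable A := by
    have : Measurable fun z => ((a * g z : ℝ) : ℂ) := by fun_prop
    fun_prop
  have hFm : ∀ j, Measurable (F j) := fun j => by
    have h1 := hh j
    have : Measurable fun z => ((b * h j z : ℝ) : ℂ) := by fun_prop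
    fun_prop
  have hnorm : ∀ (x : ℝ) (c : ℂ), ‖Complex.exp (Complex.I * (x : ℝ) - c)‖ = Real.exp (-c.re) := by
    intro x c
    rw [Complex.norm_exp]
    simp
  have hAint : ∫ z, A z ∂Q = 1 := by
    simp only [hA, Complex.exp_sub]
    rw [integral_div, ← charFun_map_real hg, hcg, Complex.exp_log hga, div_self hga]
  have hFint : ∀ j, ∫ p, F j p ∂(coinLaw Q) = 1 := fun j => by
    simp only [hF, Complex.exp_sub]
    rw [integral_div, ← charFun_map_real (hh j)]
    simp only [hch]
    rw [Complex.exp_log (hhb j), div_self (hhb j)]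
  set K : ℝ := ∑ j, Real.exp (-(ch j).re) with hK
  have hFK : ∀ j p, ‖F j p‖ ≤ K := fun j p => by
    simp only [hF, hnorm]
    exact Finset.single_le_sum (f := fun j => Real.exp (-(ch j).re))
      (fun _ _ => (Real.exp_pos _).le) (Finset.mem_univ j)
  have key := hD.integral_prod_block
    (B := fun ν x => (∏ i, A (x.1 i)) * ∏ l, F (x.2 l).2.1 ((x.2 l).1, (x.2 l).2.2))
    (fun ν => by
      refine Measurable.mul (Finset.measurable_fun_prod _ fun i _ => ?_)
        (Finset.measurable_fun_prod _ fun l _ => ?_)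
      · exact hAm.comp ((measurable_pi_apply i).comp measurable_fst)
      · exact (measurable_arm hFm).comp ((measurable_pi_apply l).comp measurable_snd))
    (C := fun ν => (∏ _i : Fin (D.N ν), Real.exp (-cg.re)) * ∏ _l : Fin (D.L ν), K)
    (fun ν x => by
      rw [norm_mul, norm_prod, norm_prod]
      refine mul_le_mul ?_ ?_ (by positivity) (by positivity)
      · exact Finset.prod_le_prod (fun _ _ => norm_nonneg _) fun i _ => (hnorm _ _).le
      · exact Finset.prod_le_prod (fun _ _ => norm_nonneg _) fun l _ => hFK _ _)
    (c := fun _ => 1)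
    (fun ν s hs => by
      rw [integral_roundLaw_prod (fun _ => A) fun r => F r.2.1 (r.1, r.2.2)]
      simp only [hAint, Finset.prod_const_one, one_mul]
      by_cases hL : D.L ν = 0
      · simp [hL]
      · have hs' : s.Nonempty := by
          rw [Finset.nonempty_iff_ne_empty]
          rintro rfl
          exact hs (hD.measure_S_eq_empty hL)
        rw [integral_rctLaw_eq hs' hFm hFK hFint, one_pow]) m
  rw [Finset.prod_const_one] at key
  rw [← key]
  refine integral_congr_ae (ae_of_all _ fun ω => ?_)
  simp only [hA, hF, block, ← Complex.exp_sum, ← Complex.exp_add]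
  congr 1
  have h2 : ∑ ν ∈ Finset.range m, ∑ l : Fin (D.L ν), ch (D.rct ν l ω).2.1 =
      ∑ j, (D.count m ω j : ℂ) * ch j := by
    rw [D.sum_W ch m ω]; simp only [Complex.real_smul]
  rw [Finset.sum_add_distrib]
  simp only [Finset.sum_sub_distrib]
  rw [h2]
  simp only [unitSum, armSum, Nbar]
  push_cast
  simp only [Finset.mul_sum, Finset.sum_mul, Finset.sum_const, Finset.card_univ, Fintype.card_fin,
    nsmul_eq_mul, hch, mul_add, ← mul_assoc]
  ring

variable {q : Fin J → ℝ}

/-- The central limit theorem for sums over the observational and the randomized units, in terms of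
characteristic functions. -/
theorem tendsto_integral_exp (hD : D.IsSampled P ℱ Q) (hN : Tendsto D.Nbar atTop atTop)
    (hL : Tendsto D.Lbar atTop atTop)
    (hq : ∀ j, TendstoInMeasure P (fun m ω => D.count m ω j / D.Lbar m) atTop fun _ => q j)
    {g : UnitRec 𝓧 𝓤 J → ℝ} (hg : Measurable g) (hg2 : MemLp g 2 Q) (hg0 : ∫ z, g z ∂Q = 0)
    {h : Fin J → UnitRec 𝓧 𝓤 J × Bool → ℝ} (hh : ∀ j, Measurable (h j))
    (hh2 : ∀ j, MemLp (h j) 2 (coinLaw Q)) (hh0 : ∀ j, ∫ p, h j p ∂(coinLaw Q) = 0) :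
    Tendsto (fun m => ∫ ω, Complex.exp (Complex.I *
      ((√(D.Nbar m))⁻¹ * D.unitSum g m ω + (√(D.Lbar m))⁻¹ * D.armSum h m ω : ℝ)) ∂P) atTop
      (𝓝 (Complex.exp (-(((∫ z, g z ^ 2 ∂Q) + ∑ j, q j * ∫ p, h j p ^ 2 ∂(coinLaw Q)) / 2 : ℝ)))) := by
  set vg := ∫ z, g z ^ 2 ∂Q with hvg
  set vh := fun j => ∫ p, h j p ^ 2 ∂(coinLaw Q) with hvh
  set cg := fun m => Complex.log (charFun (Q.map g) (√(D.Nbar m))⁻¹) with hcg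
  set ch := fun m j => Complex.log (charFun ((coinLaw Q).map (h j)) (√(D.Lbar m))⁻¹) with hch
  set κ : ℂ := -(((vg + ∑ j, q j * vh j) / 2 : ℝ) : ℂ) with hκ
  -- The logarithm of the product of all normalizers; it is random only through the arm counts, and
  -- `κ` is its limit.
  set d : ℕ → Ω → ℂ := fun m ω => D.Nbar m * cg m + ∑ j, (D.count m ω j : ℂ) * ch m j with hd
  set S : ℕ → Ω → ℝ := fun m ω =>
    (√(D.Nbar m))⁻¹ * D.unitSum g m ω + (√(D.Lbar m))⁻¹ * D.armSum h m ω with hS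
  -- The distance of `d` from `κ` splits into `ε`, the deterministic error of the expansions, and
  -- `R`, the deviation of the shares from their limits.
  set ε : ℕ → ℝ := fun m => ‖(D.Nbar m : ℂ) * cg m + (vg / 2 : ℂ)‖ +
    ∑ j, ‖(D.Lbar m : ℂ) * ch m j + (vh j / 2 : ℂ)‖ with hε
  set R : ℕ → Ω → ℝ := fun m ω => ∑ j, |vh j / 2| * |D.count m ω j / D.Lbar m - q j| with hR
  have hSm : ∀ m, Measurable (S m) := fun m =>
    ((hD.measurable_unitSum hg m).const_mul _).add ((hD.measurable_armSum hh m).const_mul _)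
  have hcm : ∀ m j, Measurable fun ω => D.count m ω j := fun m j => hD.measurable_count m j
  have hdm : ∀ m, Measurable (d m) := fun m => by
    simp only [hd]
    have : ∀ j, Measurable fun ω => (D.count m ω j : ℂ) := fun j =>
      Complex.measurable_ofReal.comp (hcm m j)
    fun_prop
  have hRm : ∀ m, Measurable (R m) := fun m => by
    simp only [hR]
    have := hcm m
    fun_prop
  have hε0 : Tendsto ε atTop (𝓝 0) := by
    have h1 := (tendsto_mul_log_charFun hg hg2 hg0 hN).norm
    have h2 := fun j => (tendsto_mul_log_charFun (hh j) (hh2 j) (hh0 j) hL).norm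
    have h3 := h1.add (tendsto_finsetSum Finset.univ fun j _ => h2 j)
    simpa using h3
  have hdist : ∀ᶠ m in atTop, ∀ ω, ‖κ - d m ω‖ ≤ ε m + R m ω := by
    filter_upwards [hL.eventually_gt_atTop 0] with m hm ω
    have hmC : (D.Lbar m : ℂ) ≠ 0 := by exact_mod_cast hm.ne'
    have hrew : κ - d m ω = -((D.Nbar m : ℂ) * cg m + (vg / 2 : ℂ)) +
        ∑ j, (-((D.count m ω j / D.Lbar m : ℝ) * ((D.Lbar m : ℂ) * ch m j + (vh j / 2 : ℂ))) +
          (vh j / 2 : ℝ) * (D.count m ω j / D.Lbar m - q j : ℝ)) := by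
      have : ∑ j, (-((D.count m ω j / D.Lbar m : ℝ) * ((D.Lbar m : ℂ) * ch m j + (vh j / 2 : ℂ))) +
          (vh j / 2 : ℝ) * (D.count m ω j / D.Lbar m - q j : ℝ)) =
          ∑ j, (-(D.count m ω j * ch m j) - (q j * vh j : ℝ) / 2) := by
        refine Finset.sum_congr rfl fun j _ => ?_
        push_cast
        field_simp
        ring
      rw [this, Finset.sum_sub_distrib, Finset.sum_neg_distrib, ← Finset.sum_div,
        ← Complex.ofReal_sum]
      simp only [hκ, hd]
      push_cast
      ring
    rw [hrew]
    refine (norm_add_le _ _).trans ?_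
    rw [norm_neg]
    simp only [hε, hR]
    rw [add_assoc, ← Finset.sum_add_distrib]
    refine add_le_add le_rfl ((norm_sum_le _ _).trans (Finset.sum_le_sum fun j _ => ?_))
    refine (norm_add_le _ _).trans (add_le_add ?_ ?_)
    · rw [norm_neg, norm_mul, Complex.norm_real, Real.norm_eq_abs]
      exact mul_le_of_le_one_left (norm_nonneg _) (D.abs_count_div_le m ω j)
    · rw [norm_mul, Complex.norm_real, Complex.norm_real, Real.norm_eq_abs, Real.norm_eq_abs]
  set K : ℝ := ∑ j, |vh j / 2| * (1 + |q j|) with hK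
  have hRK : ∀ m ω, R m ω ≤ K := fun m ω => Finset.sum_le_sum fun j _ =>
    mul_le_mul_of_nonneg_left ((abs_sub _ _).trans (add_le_add (D.abs_count_div_le m ω j) le_rfl))
      (abs_nonneg _)
  have hR0 : ∀ m ω, 0 ≤ R m ω := fun m ω =>
    Finset.sum_nonneg fun j _ => mul_nonneg (abs_nonneg _) (abs_nonneg _)
  -- The shares lie in `[0, 1]`, so their convergence in probability is also convergence in mean.
  have hRint : Tendsto (fun m => ∫ ω, R m ω ∂P) atTop (𝓝 0) := by
    have h1 : ∀ m, ∫ ω, R m ω ∂P =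
        ∑ j, |vh j / 2| * ∫ ω, |D.count m ω j / D.Lbar m - q j| ∂P := fun m => by
      simp only [hR]
      rw [integral_finsetSum]
      · simp_rw [integral_const_mul]
      · intro j _
        refine Integrable.const_mul (Integrable.of_bound (C := 1 + |q j|) ?_ (ae_of_all _ fun ω => ?_)) _
        · exact (((hcm m j).div_const _).sub_const _).norm.aestronglyMeasurable
        · rw [Real.norm_eq_abs, abs_abs]
          exact (abs_sub _ _).trans (add_le_add (D.abs_count_div_le m ω j) le_rfl)
    simp_rw [h1]
    have h2 := tendsto_finsetSum (Finset.univ : Finset (Fin J)) fun j _ =>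
      (tendsto_integral_abs_sub_of_tendstoInMeasure
        (fun m => ((hcm m j).div_const _).aestronglyMeasurable)
        (fun m ω => D.abs_count_div_le m ω j) (hq j)).const_mul |vh j / 2|
    simpa using h2
  rw [tendsto_iff_norm_sub_tendsto_zero]
  have hmain : ∀ᶠ m in atTop, ‖(∫ ω, Complex.exp (Complex.I * (S m ω : ℝ)) ∂P) - Complex.exp κ‖ ≤
      Real.exp (1 + K) * (ε m + ∫ ω, R m ω ∂P) := by
    have hga := (tendsto_inv_sqrt hN).eventually (charFun_ne_zero_eventually (P := Q) hg)
    have hhb : ∀ᶠ m in atTop, ∀ j, charFun ((coinLaw Q).map (h j)) (√(D.Lbar m))⁻¹ ≠ 0 :=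
      eventually_all.2 fun j =>
        (tendsto_inv_sqrt hL).eventually (charFun_ne_zero_eventually (P := coinLaw Q) (hh j))
    filter_upwards [hga, hhb, hdist, hε0.eventually_lt_const one_pos] with m h1 h2 h3 h4
    have hone : ∫ ω, Complex.exp (Complex.I * (S m ω : ℝ)) * Complex.exp (-d m ω) ∂P = 1 :=
      hD.integral_exp_mul_exp_neg hg hh _ _ h1 h2 m
    have hexp1 : ∀ ω, ‖Complex.exp (Complex.I * (S m ω : ℝ))‖ = 1 := fun ω => by
      rw [mul_comm]; exact Complex.norm_exp_ofReal_mul_I _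
    -- From `|exp z - 1| ≤ |z| exp |z|`, where `|z| ≤ 1 + K` because `ε m < 1` and `R ≤ K`.
    have hbd : ∀ ω, ‖1 - Complex.exp (κ - d m ω)‖ ≤ Real.exp (1 + K) * (ε m + R m ω) := fun ω => by
      have h5 : ‖κ - d m ω‖ ≤ 1 + K := (h3 ω).trans (add_le_add h4.le (hRK m ω))
      rw [norm_sub_rev]
      have h6 := Complex.norm_exp_sub_sum_le_norm_mul_exp (κ - d m ω) 1
      simp only [Finset.range_one, Finset.sum_singleton, pow_zero, Nat.factorial_zero, Nat.cast_one,
        div_one, pow_one] at h6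
      refine h6.trans ?_
      rw [mul_comm]
      exact mul_le_mul (Real.exp_le_exp.2 h5) (h3 ω) (norm_nonneg _) (Real.exp_pos _).le
    have hi1 : Integrable (fun ω => Complex.exp (Complex.I * (S m ω : ℝ))) P := by
      refine Integrable.of_bound (C := 1) ?_ (ae_of_all _ fun ω => (hexp1 ω).le)
      have := hSm m
      have : Measurable fun ω => ((S m ω : ℝ) : ℂ) := Complex.measurable_ofReal.comp this
      exact Measurable.aestronglyMeasurable (by fun_prop)
    have hi3 : Integrable (fun ω => R m ω) P :=
      Integrable.of_bound (hRm m).aestronglyMeasurable K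
        (ae_of_all _ fun ω => by rw [Real.norm_of_nonneg (hR0 m ω)]; exact hRK m ω)
    have hi2 : Integrable (fun ω => Complex.exp (Complex.I * (S m ω : ℝ)) *
        (1 - Complex.exp (κ - d m ω))) P := by
      refine Integrable.of_bound (C := Real.exp (1 + K) * (1 + K)) ?_ (ae_of_all _ fun ω => ?_)
      · have := hSm m
        have h6 : Measurable fun ω => ((S m ω : ℝ) : ℂ) := Complex.measurable_ofReal.comp this
        have h7 := hdm m
        exact Measurable.aestronglyMeasurable (by fun_prop)
      · rw [norm_mul, hexp1, one_mul]
        exact (hbd ω).trans (mul_le_mul_of_nonneg_left (add_le_add h4.le (hRK m ω))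
          (Real.exp_pos _).le)
    -- Multiply the exact identity `E exp(iS - d) = 1` by the constant `exp κ` and subtract: the
    -- characters have modulus one, so only the distance of `exp (κ - d)` from one matters.
    have heq : (∫ ω, Complex.exp (Complex.I * (S m ω : ℝ)) ∂P) - Complex.exp κ =
        ∫ ω, Complex.exp (Complex.I * (S m ω : ℝ)) * (1 - Complex.exp (κ - d m ω)) ∂P := by
      have h8 : Complex.exp κ = ∫ ω, (Complex.exp (Complex.I * (S m ω : ℝ)) -
          Complex.exp (Complex.I * (S m ω : ℝ)) * (1 - Complex.exp (κ - d m ω))) ∂P := by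
        have : ∀ ω, Complex.exp (Complex.I * (S m ω : ℝ)) -
          Complex.exp (Complex.I * (S m ω : ℝ)) * (1 - Complex.exp (κ - d m ω)) =
          (Complex.exp (Complex.I * (S m ω : ℝ)) * Complex.exp (-d m ω)) * Complex.exp κ := by
          intro ω
          rw [sub_eq_add_neg κ, Complex.exp_add]
          ring
        simp_rw [this]
        rw [integral_mul_const, hone, one_mul]
      rw [h8, integral_sub hi1 hi2]
      ring
    rw [heq]
    refine (norm_integral_le_integral_norm _).trans ?_
    have h9 : ∫ ω, (ε m + R m ω) ∂P = ε m + ∫ ω, R m ω ∂P := by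
      rw [integral_add (integrable_const _) hi3]; simp
    rw [← h9, ← integral_const_mul]
    refine integral_mono hi2.norm (((integrable_const _).add hi3).const_mul _) fun ω => ?_
    simp only [norm_mul, hexp1, one_mul]
    exact hbd ω
  refine squeeze_zero' (Eventually.of_forall fun _ => norm_nonneg _) hmain ?_
  have := (hε0.add hRint).const_mul (Real.exp (1 + K))
  simpa using this

end IsSampled

end Rounds

/-! ### Calculus of stochastic orders -/

section StochasticOrder

variable {Ω : Type*} {mΩ : MeasurableSpace Ω} (P : Measure Ω)

/-- The events `G m` have probability tending to one. -/
def Whp (G : ℕ → Set Ω) : Prop := Tendsto (fun m => P (G m)ᶜ) atTop (𝓝 0)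

/-- `X m` converges to zero in probability. -/
def LittleOP (X : ℕ → Ω → ℝ) : Prop := ∀ ε > 0, Whp P fun m => {ω | |X m ω| < ε}

/-- `X m` is bounded in probability. -/
def BigOP (X : ℕ → Ω → ℝ) : Prop :=
  ∀ δ : ENNReal, 0 < δ → ∃ K > 0, ∀ᶠ m in atTop, P {ω | |X m ω| ≤ K}ᶜ ≤ δ

variable {P}

lemma Whp.mono {G G' : ℕ → Set Ω} (h : Whp P G) (hGG' : ∀ᶠ m in atTop, G m ⊆ G' m) : Whp P G' := by
  refine tendsto_of_tendsto_of_tendsto_of_le_of_le' tendsto_const_nhds h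
    (Eventually.of_forall fun _ => zero_le) ?_
  filter_upwards [hGG'] with m hm
  exact measure_mono (Set.compl_subset_compl.2 hm)

lemma Whp.inter {G G' : ℕ → Set Ω} (h : Whp P G) (h' : Whp P G') :
    Whp P fun m => G m ∩ G' m := by
  have := h.add h'
  rw [add_zero] at this
  refine tendsto_of_tendsto_of_tendsto_of_le_of_le tendsto_const_nhds this (fun _ => zero_le) ?_
  intro m
  show P (G m ∩ G' m)ᶜ ≤ _
  rw [Set.compl_inter]
  exact measure_union_le _ _

lemma whp_univ : Whp P fun _ => Set.univ := by
  simp [Whp]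

lemma Whp.iInter {ι : Type*} (s : Finset ι) {G : ι → ℕ → Set Ω} (h : ∀ i ∈ s, Whp P (G i)) :
    Whp P fun m => ⋂ i ∈ s, G i m := by
  classical
  induction s using Finset.induction_on with
  | empty => simpa using whp_univ
  | insert a s ha ih =>
    have := (h a (Finset.mem_insert_self a s)).inter
      (ih fun i hi => h i (Finset.mem_insert_of_mem hi))
    simpa [Finset.set_biInter_insert] using this

lemma whp_of_ae {G : ℕ → Set Ω} (h : ∀ m, ∀ᵐ ω ∂P, ω ∈ G m) : Whp P G := by
  have : ∀ m, P (G m)ᶜ = 0 := fun m => h m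
  simp [Whp, this]

lemma LittleOP.whp {X : ℕ → Ω → ℝ} (h : LittleOP P X) {ε : ℝ} (hε : 0 < ε) :
    Whp P fun m => {ω | |X m ω| < ε} := h ε hε

lemma LittleOP.of_le {X Y : ℕ → Ω → ℝ} (h : LittleOP P X) {G : ℕ → Set Ω} (hG : Whp P G)
    (hXY : ∀ᶠ m in atTop, ∀ ω ∈ G m, |Y m ω| ≤ |X m ω|) : LittleOP P Y := by
  intro ε hε
  refine ((h ε hε).inter hG).mono ?_
  filter_upwards [hXY] with m hm ω hω
  exact (hm ω hω.2).trans_lt hω.1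

lemma LittleOP.of_abs_le {X Y : ℕ → Ω → ℝ} (h : LittleOP P X)
    (hXY : ∀ m ω, |Y m ω| ≤ |X m ω|) : LittleOP P Y :=
  h.of_le whp_univ (Eventually.of_forall fun m ω _ => hXY m ω)

lemma BigOP.of_le {X Y : ℕ → Ω → ℝ} (h : BigOP P X) {G : ℕ → Set Ω} (hG : Whp P G)
    (hXY : ∀ᶠ m in atTop, ∀ ω ∈ G m, |Y m ω| ≤ |X m ω|) : BigOP P Y := by
  intro δ hδ
  obtain ⟨K, hK, hm⟩ := h (δ / 2) (ENNReal.half_pos hδ.ne')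
  refine ⟨K, hK, ?_⟩
  filter_upwards [hXY, hm, hG.eventually_lt_const (ENNReal.half_pos hδ.ne')] with m h1 h2 h3
  calc P {ω | |Y m ω| ≤ K}ᶜ ≤ P ({ω | |X m ω| ≤ K}ᶜ ∪ (G m)ᶜ) := by
        rw [← Set.compl_inter]
        exact measure_mono (Set.compl_subset_compl.2 fun ω hω => (h1 ω hω.2).trans hω.1)
    _ ≤ δ / 2 + δ / 2 := (measure_union_le _ _).trans (add_le_add h2 h3.le)
    _ = δ := ENNReal.add_halves δ

lemma BigOP.of_abs_le {X Y : ℕ → Ω → ℝ} (h : BigOP P X)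
    (hXY : ∀ m ω, |Y m ω| ≤ |X m ω|) : BigOP P Y :=
  h.of_le whp_univ (Eventually.of_forall fun m ω _ => hXY m ω)

lemma LittleOP.add {X Y : ℕ → Ω → ℝ} (hX : LittleOP P X) (hY : LittleOP P Y) :
    LittleOP P fun m ω => X m ω + Y m ω := by
  intro ε hε
  refine ((hX (ε / 2) (half_pos hε)).inter (hY (ε / 2) (half_pos hε))).mono
    (Eventually.of_forall fun m ω hω => ?_)
  have h1 : |X m ω| < ε / 2 := hω.1
  have h2 : |Y m ω| < ε / 2 := hω.2
  show |X m ω + Y m ω| < ε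
  linarith [abs_add_le (X m ω) (Y m ω)]

lemma littleOP_zero : LittleOP P fun _ _ => 0 := by
  intro ε hε
  simpa [hε] using (whp_univ (P := P))

lemma LittleOP.sum {ι : Type*} (s : Finset ι) {X : ι → ℕ → Ω → ℝ}
    (h : ∀ i ∈ s, LittleOP P (X i)) : LittleOP P fun m ω => ∑ i ∈ s, X i m ω := by
  classical
  induction s using Finset.induction_on with
  | empty => simpa using littleOP_zero
  | insert a s ha ih =>
    simp_rw [Finset.sum_insert ha]
    exact (h a (Finset.mem_insert_self a s)).add (ih fun i hi => h i (Finset.mem_insert_of_mem hi))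

lemma BigOP.add {X Y : ℕ → Ω → ℝ} (hX : BigOP P X) (hY : BigOP P Y) :
    BigOP P fun m ω => X m ω + Y m ω := by
  intro δ hδ
  obtain ⟨K, hK, h1⟩ := hX (δ / 2) (ENNReal.half_pos hδ.ne')
  obtain ⟨K', hK', h2⟩ := hY (δ / 2) (ENNReal.half_pos hδ.ne')
  refine ⟨K + K', by positivity, ?_⟩
  filter_upwards [h1, h2] with m h1 h2
  calc _ ≤ P ({ω | |X m ω| ≤ K}ᶜ ∪ {ω | |Y m ω| ≤ K'}ᶜ) := by
        rw [← Set.compl_inter]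
        refine measure_mono (Set.compl_subset_compl.2 fun ω hω => ?_)
        show |X m ω + Y m ω| ≤ K + K'
        exact (abs_add_le _ _).trans (add_le_add hω.1 hω.2)
    _ ≤ δ / 2 + δ / 2 := (measure_union_le _ _).trans (add_le_add h1 h2)
    _ = δ := ENNReal.add_halves δ

lemma LittleOP.bigOP {X : ℕ → Ω → ℝ} (h : LittleOP P X) : BigOP P X := by
  intro δ hδ
  refine ⟨1, one_pos, ?_⟩
  filter_upwards [(h 1 one_pos).eventually_lt_const hδ] with m hm
  refine (measure_mono (Set.compl_subset_compl.2 fun ω hω => ?_)).trans hm.le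
  have h1 : |X m ω| < 1 := hω
  exact h1.le

lemma BigOP.sum {ι : Type*} (s : Finset ι) {X : ι → ℕ → Ω → ℝ}
    (h : ∀ i ∈ s, BigOP P (X i)) : BigOP P fun m ω => ∑ i ∈ s, X i m ω := by
  classical
  induction s using Finset.induction_on with
  | empty => simpa using (littleOP_zero (P := P)).bigOP
  | insert a s ha ih =>
    simp_rw [Finset.sum_insert ha]
    exact (h a (Finset.mem_insert_self a s)).add (ih fun i hi => h i (Finset.mem_insert_of_mem hi))

lemma bigOP_const (c : ℝ) : BigOP P fun _ _ => c := by
  intro δ _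
  refine ⟨|c| + 1, by positivity, Eventually.of_forall fun m => ?_⟩
  have : {ω : Ω | |c| ≤ |c| + 1} = Set.univ := by simp
  rw [this]; simp

lemma BigOP.mul {X Y : ℕ → Ω → ℝ} (hX : BigOP P X) (hY : BigOP P Y) :
    BigOP P fun m ω => X m ω * Y m ω := by
  intro δ hδ
  obtain ⟨K, hK, h1⟩ := hX (δ / 2) (ENNReal.half_pos hδ.ne')
  obtain ⟨K', hK', h2⟩ := hY (δ / 2) (ENNReal.half_pos hδ.ne')
  refine ⟨K * K', by positivity, ?_⟩
  filter_upwards [h1, h2] with m h1 h2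
  calc _ ≤ P ({ω | |X m ω| ≤ K}ᶜ ∪ {ω | |Y m ω| ≤ K'}ᶜ) := by
        rw [← Set.compl_inter]
        refine measure_mono (Set.compl_subset_compl.2 fun ω hω => ?_)
        show |X m ω * Y m ω| ≤ K * K'
        rw [abs_mul]
        exact mul_le_mul hω.1 hω.2 (abs_nonneg _) hK.le
    _ ≤ δ / 2 + δ / 2 := (measure_union_le _ _).trans (add_le_add h1 h2)
    _ = δ := ENNReal.add_halves δ

lemma BigOP.mul_littleOP {X Y : ℕ → Ω → ℝ} (hX : BigOP P X) (hY : LittleOP P Y) :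
    LittleOP P fun m ω => X m ω * Y m ω := by
  intro ε hε
  refine ENNReal.tendsto_nhds_zero.2 fun δ hδ => ?_
  obtain ⟨K, hK, h1⟩ := hX (δ / 2) (ENNReal.half_pos hδ.ne')
  filter_upwards [h1, (hY (ε / K) (by positivity)).eventually_lt_const (ENNReal.half_pos hδ.ne')]
    with m h1 h2
  calc _ ≤ P ({ω | |X m ω| ≤ K}ᶜ ∪ {ω | |Y m ω| < ε / K}ᶜ) := by
        rw [← Set.compl_inter]
        refine measure_mono (Set.compl_subset_compl.2 fun ω hω => ?_)
        show |X m ω * Y m ω| < ε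
        rw [abs_mul]
        have h3 : |X m ω| ≤ K := hω.1
        have h4 : |Y m ω| < ε / K := hω.2
        calc |X m ω| * |Y m ω| ≤ K * |Y m ω| := mul_le_mul_of_nonneg_right h3 (abs_nonneg _)
          _ < K * (ε / K) := mul_lt_mul_of_pos_left h4 hK
          _ = ε := by field_simp
    _ ≤ δ / 2 + δ / 2 := (measure_union_le _ _).trans (add_le_add h1 h2.le)
    _ = δ := ENNReal.add_halves δ

lemma LittleOP.const_mul {X : ℕ → Ω → ℝ} (h : LittleOP P X) (c : ℝ) :
    LittleOP P fun m ω => c * X m ω := (bigOP_const c).mul_littleOP h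

lemma BigOP.const_mul {X : ℕ → Ω → ℝ} (h : BigOP P X) (c : ℝ) :
    BigOP P fun m ω => c * X m ω := (bigOP_const c).mul h

lemma littleOP_of_tendsto {c : ℕ → ℝ} (hc : Tendsto c atTop (𝓝 0)) :
    LittleOP P fun m _ => c m := by
  intro ε hε
  refine (whp_univ (P := P)).mono ?_
  have h := hc.abs
  rw [abs_zero] at h
  filter_upwards [h.eventually_lt_const hε] with m hm ω _
  exact hm

lemma LittleOP.abs {X : ℕ → Ω → ℝ} (h : LittleOP P X) : LittleOP P fun m ω => |X m ω| :=
  h.of_abs_le fun m ω => by rw [abs_abs]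

lemma BigOP.abs {X : ℕ → Ω → ℝ} (h : BigOP P X) : BigOP P fun m ω => |X m ω| :=
  h.of_abs_le fun m ω => by rw [abs_abs]

lemma littleOP_iff_tendstoInMeasure {X : ℕ → Ω → ℝ} :
    LittleOP P X ↔ TendstoInMeasure P X atTop fun _ => 0 := by
  rw [tendstoInMeasure_iff_norm]
  refine forall_congr' fun ε => forall_congr' fun _ => ?_
  have : ∀ m, {ω | |X m ω| < ε}ᶜ = {x | ε ≤ ‖X m x - 0‖} := fun m => by
    ext ω; simp
  simp only [Whp, this]

lemma littleOP_sub_iff {X : ℕ → Ω → ℝ} {c : ℝ} :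
    LittleOP P (fun m ω => X m ω - c) ↔ TendstoInMeasure P X atTop fun _ => c := by
  rw [littleOP_iff_tendstoInMeasure, tendstoInMeasure_iff_norm, tendstoInMeasure_iff_norm]
  simp

/-- Pointwise convergence of characteristic functions to a function continuous at zero implies
tightness; a compact set of mass close to one is contained in a ball. -/
lemma bigOP_of_tendsto_charFun [IsProbabilityMeasure P] {X : ℕ → Ω → ℝ}
    (hX : ∀ m, Measurable (X m)) {f : ℝ → ℂ} (hf : ContinuousAt f 0)
    (h : ∀ t, Tendsto (fun m => charFun (P.map (X m)) t) atTop (𝓝 (f t))) : BigOP P X := by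
  have : ∀ m, IsProbabilityMeasure (P.map (X m)) := fun m =>
    Measure.isProbabilityMeasure_map (hX m).aemeasurable
  have ht := isTightMeasureSet_of_tendsto_charFun hf h
  rw [isTightMeasureSet_iff_exists_isCompact_measure_compl_le] at ht
  intro δ hδ
  obtain ⟨C, hC, hCδ⟩ := ht δ hδ
  obtain ⟨K, hK, hCK⟩ := hC.isBounded.exists_pos_norm_le
  refine ⟨K, hK, Eventually.of_forall fun m => ?_⟩
  refine le_trans ?_ (hCδ _ ⟨m, rfl⟩)
  rw [Measure.map_apply (hX m) hC.measurableSet.compl]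
  exact measure_mono fun ω hω hC' => hω (hCK _ hC')

end StochasticOrder

/-! ### Joint asymptotic normality of asymptotically linear vectors -/

namespace Rounds

variable {Ω 𝓧 𝓤 : Type*} {J : ℕ} (D : Rounds Ω 𝓧 𝓤 J)

/-- The normalized sum over the observational and the randomized units of the first `m` rounds. -/
def normSum (g : UnitRec 𝓧 𝓤 J → ℝ) (h : Fin J → UnitRec 𝓧 𝓤 J × Bool → ℝ) (m : ℕ) (ω : Ω) : ℝ :=
  (√(D.Nbar m))⁻¹ * D.unitSum g m ω + (√(D.Lbar m))⁻¹ * D.armSum h m ω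

lemma unitSum_const_mul (c : ℝ) (g : UnitRec 𝓧 𝓤 J → ℝ) (m : ℕ) (ω : Ω) :
    D.unitSum (fun z => c * g z) m ω = c * D.unitSum g m ω := by
  simp only [unitSum, Finset.mul_sum]

lemma armSum_const_mul (c : ℝ) (h : Fin J → UnitRec 𝓧 𝓤 J × Bool → ℝ) (m : ℕ) (ω : Ω) :
    D.armSum (fun j p => c * h j p) m ω = c * D.armSum h m ω := by
  simp only [armSum, Finset.mul_sum]

lemma unitSum_sum {ι : Type*} (s : Finset ι) (g : ι → UnitRec 𝓧 𝓤 J → ℝ) (m : ℕ) (ω : Ω) :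
    D.unitSum (fun z => ∑ i ∈ s, g i z) m ω = ∑ i ∈ s, D.unitSum (g i) m ω := by
  simp only [unitSum]
  rw [Finset.sum_comm]
  refine Finset.sum_congr rfl fun ν _ => ?_
  rw [Finset.sum_comm]

lemma armSum_sum {ι : Type*} (s : Finset ι) (h : ι → Fin J → UnitRec 𝓧 𝓤 J × Bool → ℝ) (m : ℕ)
    (ω : Ω) : D.armSum (fun j p => ∑ i ∈ s, h i j p) m ω = ∑ i ∈ s, D.armSum (h i) m ω := by
  simp only [armSum]
  rw [Finset.sum_comm]
  refine Finset.sum_congr rfl fun ν _ => ?_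
  rw [Finset.sum_comm]

lemma normSum_sum_mul {ι : Type*} (s : Finset ι) (t : ι → ℝ) (g : ι → UnitRec 𝓧 𝓤 J → ℝ)
    (h : ι → Fin J → UnitRec 𝓧 𝓤 J × Bool → ℝ) (m : ℕ) (ω : Ω) :
    D.normSum (fun z => ∑ i ∈ s, t i * g i z) (fun j p => ∑ i ∈ s, t i * h i j p) m ω =
      ∑ i ∈ s, t i * D.normSum (g i) (h i) m ω := by
  simp only [normSum, unitSum_sum, armSum_sum, unitSum_const_mul, armSum_const_mul, Finset.mul_sum,
    ← Finset.sum_add_distrib]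
  exact Finset.sum_congr rfl fun i _ => by ring

variable [mΩ : MeasurableSpace Ω] [MeasurableSpace 𝓧] [MeasurableSpace 𝓤]
  {P : Measure Ω} [IsProbabilityMeasure P]
  {Q : Measure (UnitRec 𝓧 𝓤 J)} [IsProbabilityMeasure Q]
  {D} {ℱ : Filtration ℕ mΩ} {q : Fin J → ℝ}

/-- The sampling scheme together with growing sample sizes and converging shares of the arms. -/
structure IsAsymptotic (D : Rounds Ω 𝓧 𝓤 J) (P : Measure Ω) (ℱ : Filtration ℕ mΩ)
    (Q : Measure (UnitRec 𝓧 𝓤 J)) (q : Fin J → ℝ) : Prop where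
  sampled : D.IsSampled P ℱ Q
  tendsto_Nbar : Tendsto D.Nbar atTop atTop
  tendsto_Lbar : Tendsto D.Lbar atTop atTop
  share : ∀ j, TendstoInMeasure P (fun m ω => D.count m ω j / D.Lbar m) atTop fun _ => q j
  share_nonneg : ∀ j, 0 ≤ q j

/-- A pair of summands with mean zero and finite second moments. -/
structure IsCentered (Q : Measure (UnitRec 𝓧 𝓤 J)) (g : UnitRec 𝓧 𝓤 J → ℝ)
    (h : Fin J → UnitRec 𝓧 𝓤 J × Bool → ℝ) : Prop where
  measurable_unit : Measurable g
  memLp_unit : MemLp g 2 Q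
  integral_unit : ∫ z, g z ∂Q = 0
  measurable_arm : ∀ j, Measurable (h j)
  memLp_arm : ∀ j, MemLp (h j) 2 (coinLaw Q)
  integral_arm : ∀ j, ∫ p, h j p ∂(coinLaw Q) = 0

lemma IsCentered.sum_mul {ι : Type*} (s : Finset ι) (t : ι → ℝ) {g : ι → UnitRec 𝓧 𝓤 J → ℝ}
    {h : ι → Fin J → UnitRec 𝓧 𝓤 J × Bool → ℝ} (hc : ∀ i, IsCentered Q (g i) (h i)) :
    IsCentered Q (fun z => ∑ i ∈ s, t i * g i z) (fun j p => ∑ i ∈ s, t i * h i j p) where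
  measurable_unit := Finset.measurable_fun_sum _ fun i _ => (hc i).measurable_unit.const_mul _
  memLp_unit := memLp_finsetSum _ fun i _ => (hc i).memLp_unit.const_mul _
  integral_unit := by
    rw [integral_finsetSum _ fun i _ => ((hc i).memLp_unit.integrable (by norm_num)).const_mul _]
    simp [integral_const_mul, (hc _).integral_unit]
  measurable_arm j := Finset.measurable_fun_sum _ fun i _ => ((hc i).measurable_arm j).const_mul _
  memLp_arm j := memLp_finsetSum _ fun i _ => ((hc i).memLp_arm j).const_mul _
  integral_arm j := by
    rw [integral_finsetSum _ fun i _ => (((hc i).memLp_arm j).integrable (by norm_num)).const_mul _]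
    simp [integral_const_mul, (hc _).integral_arm]

lemma measurable_normSum (hD : D.IsSampled P ℱ Q) {g : UnitRec 𝓧 𝓤 J → ℝ}
    {h : Fin J → UnitRec 𝓧 𝓤 J × Bool → ℝ} (hg : Measurable g) (hh : ∀ j, Measurable (h j)) (m : ℕ) :
    Measurable (D.normSum g h m) :=
  ((hD.measurable_unitSum hg m).const_mul _).add ((hD.measurable_armSum hh m).const_mul _)

/-- The argument `t` is absorbed into the summands, so that the central limit theorem for the
character at one gives the characteristic function at every `t`. The sum over the one-point type
`Unit` only serves to reuse `IsCentered.sum_mul`. -/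
lemma IsAsymptotic.tendsto_charFun (hA : D.IsAsymptotic P ℱ Q q) {g : UnitRec 𝓧 𝓤 J → ℝ}
    {h : Fin J → UnitRec 𝓧 𝓤 J × Bool → ℝ} (hc : IsCentered Q g h) (t : ℝ) :
    Tendsto (fun m => charFun (P.map (D.normSum g h m)) t) atTop
      (𝓝 (Complex.exp (-((t ^ 2 *
        ((∫ z, g z ^ 2 ∂Q) + ∑ j, q j * ∫ p, h j p ^ 2 ∂(coinLaw Q)) / 2 : ℝ))))) := by
  have hc' := IsCentered.sum_mul (Finset.univ : Finset Unit) (fun _ => t) (fun _ => hc)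
  have h1 := hA.sampled.tendsto_integral_exp hA.tendsto_Nbar hA.tendsto_Lbar hA.share
    hc'.measurable_unit hc'.memLp_unit hc'.integral_unit hc'.measurable_arm hc'.memLp_arm
    hc'.integral_arm
  simp only [Finset.univ_unique, Finset.sum_singleton, mul_pow, integral_const_mul] at h1
  have h2 : t ^ 2 * (∫ z, g z ^ 2 ∂Q) + ∑ j, q j * (t ^ 2 * ∫ p, h j p ^ 2 ∂(coinLaw Q)) =
      t ^ 2 * ((∫ z, g z ^ 2 ∂Q) + ∑ j, q j * ∫ p, h j p ^ 2 ∂(coinLaw Q)) := by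
    rw [mul_add, Finset.mul_sum]
    congr 1
    exact Finset.sum_congr rfl fun j _ => by ring
  rw [h2] at h1
  refine h1.congr fun m => ?_
  rw [charFun_map_real (measurable_normSum hA.sampled hc.measurable_unit hc.measurable_arm m)]
  refine integral_congr_ae (ae_of_all _ fun ω => ?_)
  simp only [normSum, unitSum_const_mul, armSum_const_mul]
  congr 3
  ring

lemma IsAsymptotic.bigOP_normSum (hA : D.IsAsymptotic P ℱ Q q) {g : UnitRec 𝓧 𝓤 J → ℝ}
    {h : Fin J → UnitRec 𝓧 𝓤 J × Bool → ℝ} (hc : IsCentered Q g h) :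
    BigOP P (D.normSum g h) :=
  bigOP_of_tendsto_charFun
    (measurable_normSum hA.sampled hc.measurable_unit hc.measurable_arm)
    (f := fun t => Complex.exp (-((t ^ 2 *
        ((∫ z, g z ^ 2 ∂Q) + ∑ j, q j * ∫ p, h j p ^ 2 ∂(coinLaw Q)) / 2 : ℝ))))
    (Continuous.continuousAt (by fun_prop)) (hA.tendsto_charFun hc)

/-- The covariance matrix of the limit of a vector of normalized sums. -/
def limCov {ι : Type*} (Q : Measure (UnitRec 𝓧 𝓤 J)) (q : Fin J → ℝ) (g : ι → UnitRec 𝓧 𝓤 J → ℝ)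
    (h : ι → Fin J → UnitRec 𝓧 𝓤 J × Bool → ℝ) : Matrix ι ι ℝ :=
  Matrix.of fun i k => (∫ z, g i z * g k z ∂Q) + ∑ j, q j * ∫ p, h i j p * h k j p ∂(coinLaw Q)

section Vector

variable {ι : Type*} [Fintype ι] [DecidableEq ι] {g : ι → UnitRec 𝓧 𝓤 J → ℝ}
  {h : ι → Fin J → UnitRec 𝓧 𝓤 J × Bool → ℝ}

lemma integral_sq_sum_mul {Z : Type*} [MeasurableSpace Z] {μ : Measure Z} {g : ι → Z → ℝ}
    (hg : ∀ i, MemLp (g i) 2 μ) (t : ι → ℝ) :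
    ∫ z, (∑ i, t i * g i z) ^ 2 ∂μ = ∑ i, t i * ∑ k, (∫ z, g i z * g k z ∂μ) * t k := by
  have h1 : ∀ z, (∑ i, t i * g i z) ^ 2 = ∑ i, ∑ k, t i * t k * (g i z * g k z) := fun z => by
    rw [sq, Finset.sum_mul_sum]
    exact Finset.sum_congr rfl fun i _ => Finset.sum_congr rfl fun k _ => by ring
  simp_rw [h1]
  have hi : ∀ i k, Integrable (fun z => t i * t k * (g i z * g k z)) μ := fun i k =>
    ((hg i).integrable_mul (hg k)).const_mul _
  rw [integral_finsetSum _ fun i _ => integrable_finsetSum _ fun k _ => hi i k]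
  refine Finset.sum_congr rfl fun i _ => ?_
  rw [integral_finsetSum _ fun k _ => hi i k, Finset.mul_sum]
  refine Finset.sum_congr rfl fun k _ => ?_
  rw [integral_const_mul]
  ring

/-- The right-hand side is the limiting variance of the scalar sum with coefficients `t`. It gives
positive semidefiniteness and lets the scalar theorem be read as a multivariate one. -/
lemma limCov_quadratic (hc : ∀ i, IsCentered Q (g i) (h i)) (t : ι → ℝ) :
    t ⬝ᵥ (limCov Q q g h).mulVec t = (∫ z, (∑ i, t i * g i z) ^ 2 ∂Q) +
      ∑ j, q j * ∫ p, (∑ i, t i * h i j p) ^ 2 ∂(coinLaw Q) := by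
  rw [integral_sq_sum_mul fun i => (hc i).memLp_unit]
  simp_rw [fun j => integral_sq_sum_mul (fun i => (hc i).memLp_arm j) t]
  simp only [dotProduct, Matrix.mulVec, limCov, Matrix.of_apply, add_mul, Finset.sum_add_distrib,
    mul_add, Finset.mul_sum, Finset.sum_mul]
  congr 1
  rw [Finset.sum_comm (s := (Finset.univ : Finset (Fin J)))]
  refine Finset.sum_congr rfl fun i _ => ?_
  rw [Finset.sum_comm (s := (Finset.univ : Finset (Fin J)))]
  exact Finset.sum_congr rfl fun k _ => Finset.sum_congr rfl fun j _ => by ring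

lemma posSemidef_limCov (hc : ∀ i, IsCentered Q (g i) (h i)) (hq : ∀ j, 0 ≤ q j) :
    (limCov Q q g h).PosSemidef := by
  refine Matrix.PosSemidef.of_dotProduct_mulVec_nonneg ?_ fun t => ?_
  · ext i k
    simp only [limCov, Matrix.conjTranspose_apply, Matrix.of_apply, star_trivial, mul_comm]
  · rw [star_trivial, limCov_quadratic hc]
    exact add_nonneg (integral_nonneg fun _ => sq_nonneg _) (Finset.sum_nonneg fun j _ =>
      mul_nonneg (hq j) (integral_nonneg fun _ => sq_nonneg _))

/-- A vector that is asymptotically linear in the units is asymptotically normal. -/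
theorem IsAsymptotic.tendstoInDistribution (hA : D.IsAsymptotic P ℱ Q q)
    (hc : ∀ i, IsCentered Q (g i) (h i)) {Y : ℕ → Ω → ι → ℝ}
    (hY : ∀ m i, AEMeasurable (fun ω => Y m ω i) P)
    (hlin : ∀ i, LittleOP P fun m ω => Y m ω i - D.normSum (g i) (h i) m ω) :
    TendstoInDistribution (fun m ω => WithLp.toLp 2 (Y m ω)) atTop
      (id : EuclideanSpace ℝ ι → EuclideanSpace ℝ ι) (fun _ => P)
      (multivariateGaussian 0 (limCov Q q g h)) := by
  have hms : ∀ m i, Measurable (D.normSum (g i) (h i) m) := fun m i =>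
    measurable_normSum hA.sampled (hc i).measurable_unit (hc i).measurable_arm m
  have hVm : ∀ m, Measurable fun ω =>
      (WithLp.toLp 2 fun i => D.normSum (g i) (h i) m ω : EuclideanSpace ℝ ι) := fun m =>
    (WithLp.measurable_toLp 2 _).comp (measurable_pi_lambda _ fun i => hms m i)
  have hYm : ∀ m, AEMeasurable (fun ω => (WithLp.toLp 2 (Y m ω) : EuclideanSpace ℝ ι)) P := fun m =>
    (WithLp.measurable_toLp 2 _).comp_aemeasurable (aemeasurable_pi_lambda _ fun i => hY m i)
  have hlim : TendstoInDistribution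
      (fun m ω => (WithLp.toLp 2 fun i => D.normSum (g i) (h i) m ω : EuclideanSpace ℝ ι)) atTop
      (id : EuclideanSpace ℝ ι → EuclideanSpace ℝ ι) (fun _ => P)
      (multivariateGaussian 0 (limCov Q q g h)) := by
    refine ⟨fun m => (hVm m).aemeasurable, aemeasurable_id, ?_⟩
    -- Cramér–Wold: the characteristic function of the vector at `t` is the mean character of the
    -- scalar normalized sum with coefficients `t`.
    refine ProbabilityMeasure.tendsto_iff_tendsto_charFun.2 fun t => ?_
    simp only [ProbabilityMeasure.coe_mk, Measure.map_id]
    rw [charFun_multivariateGaussian (posSemidef_limCov hc hA.share_nonneg)]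
    have hc' := IsCentered.sum_mul Finset.univ (fun i => t i) hc
    have h1 := hA.sampled.tendsto_integral_exp hA.tendsto_Nbar hA.tendsto_Lbar hA.share
      hc'.measurable_unit hc'.memLp_unit hc'.integral_unit hc'.measurable_arm hc'.memLp_arm
      hc'.integral_arm
    rw [← limCov_quadratic hc] at h1
    have h3 : Complex.exp (-((((fun i => t i) ⬝ᵥ (limCov Q q g h).mulVec fun i => t i) / 2 : ℝ) : ℂ)) =
        Complex.exp ((inner ℝ t (0 : EuclideanSpace ℝ ι) : ℝ) * Complex.I -
          ((t : ι → ℝ) ⬝ᵥ (limCov Q q g h).mulVec (t : ι → ℝ) : ℝ) / 2) := by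
      congr 1
      simp
    rw [h3] at h1
    refine h1.congr fun m => ?_
    rw [charFun_apply, integral_map (hVm m).aemeasurable (by fun_prop)]
    refine integral_congr_ae (ae_of_all _ fun ω => ?_)
    have h2 := D.normSum_sum_mul Finset.univ (fun i => t i) g h m ω
    rw [normSum] at h2
    simp only [h2, PiLp.inner_apply, RCLike.inner_apply, conj_trivial]
    rw [mul_comm]
  -- Slutsky: the Euclidean distance to the linear approximation is at most the sum of the
  -- coordinate errors.
  refine tendstoInDistribution_of_tendstoInMeasure_sub _ _ hlim ?_ hYm
  rw [tendstoInMeasure_iff_norm]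
  intro ε hε
  have hsum : LittleOP P fun m ω => ∑ i, |Y m ω i - D.normSum (g i) (h i) m ω| :=
    LittleOP.sum _ fun i _ => (hlin i).abs
  refine tendsto_of_tendsto_of_tendsto_of_le_of_le tendsto_const_nhds (hsum ε hε)
    (fun _ => zero_le) fun m => measure_mono fun ω hω => ?_
  simp only [Set.mem_compl_iff, Set.mem_ofPred_eq, not_lt] at hω ⊢
  refine hω.trans ?_
  rw [abs_of_nonneg (Finset.sum_nonneg fun _ _ => abs_nonneg _)]
  simp only [Pi.sub_apply, Pi.zero_apply, sub_zero]
  rw [← WithLp.toLp_sub, EuclideanSpace.norm_eq]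
  refine Real.sqrt_le_iff.2 ⟨Finset.sum_nonneg fun _ _ => abs_nonneg _, ?_⟩
  simp only [Real.norm_eq_abs, Pi.sub_apply]
  exact Finset.sum_sq_le_sq_sum_of_nonneg fun i _ => abs_nonneg _

end Vector

end Rounds

section StochasticOrder

variable {Ω : Type*} {mΩ : MeasurableSpace Ω} {P : Measure Ω}

/-- On the event `|X - c| < |c| / 2` one has `|X| ≥ |c| / 2`, so inversion is Lipschitz there with
constant `2 / |c|²`. -/
lemma LittleOP.inv_sub_inv {X : ℕ → Ω → ℝ} {c : ℝ} (h : LittleOP P fun m ω => X m ω - c)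
    (hc : c ≠ 0) : LittleOP P fun m ω => (X m ω)⁻¹ - c⁻¹ := by
  have hc' : 0 < |c| := abs_pos.2 hc
  refine (h.const_mul (2 / |c| ^ 2)).of_le (h.whp (half_pos hc'))
    (Eventually.of_forall fun m ω hω => ?_)
  have h1 : |X m ω - c| < |c| / 2 := hω
  have h2 : |c| / 2 ≤ |X m ω| := by
    have := abs_sub_abs_le_abs_sub c (X m ω)
    rw [abs_sub_comm] at this
    linarith
  have h3 : X m ω ≠ 0 := by
    intro h0
    rw [h0, abs_zero] at h2
    linarith
  rw [_root_.inv_sub_inv h3 hc, abs_div, abs_mul, abs_mul, abs_of_nonneg (by positivity : 0 ≤ 2 / |c| ^ 2),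
    abs_sub_comm c, div_mul_eq_mul_div, div_le_div_iff₀ (by positivity) (by positivity)]
  nlinarith [mul_le_mul_of_nonneg_left h2 (by positivity : 0 ≤ |X m ω - c| * (2 * |c|))]

end StochasticOrder

/-! ### The influence function of the RCT estimator -/

section Units

variable {𝓧 𝓤 : Type*} [MeasurableSpace 𝓧] [MeasurableSpace 𝓤] {J : ℕ}

/-- A potential outcome evaluated at a random status is measurable because there are only finitely
many statuses. -/
lemma measurable_eval_apply : Measurable fun p : (Fin J → Bool) × ((Fin J → Bool) → ℝ) => p.2 p.1 :=
  measurable_from_prod_countable_right fun a => measurable_pi_apply a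

lemma measurable_policyOutcome {f : 𝓧 × 𝓤 → Fin J → Bool} (hf : Measurable f) (j : Fin J) (b : Bool) :
    Measurable (policyOutcome f j b) := by
  have h1 : Measurable fun z : UnitRec 𝓧 𝓤 J => policy f j b (z.1, z.2.1) := by
    have h2 : Measurable fun a : Fin J → Bool => Function.update a j b := measurable_of_countable _
    exact h2.comp (hf.comp (measurable_fst.prodMk (measurable_fst.comp measurable_snd)))
  exact measurable_eval_apply.comp (h1.prodMk (measurable_snd.comp measurable_snd))

lemma measurable_policyOutcome_fst {f : 𝓧 × 𝓤 → Fin J → Bool} (hf : Measurable f) (j : Fin J)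
    (b : Bool) : Measurable fun p : UnitRec 𝓧 𝓤 J × Bool => policyOutcome f j b p.1 :=
  (measurable_policyOutcome hf j b).comp measurable_fst

lemma measurable_val_snd : Measurable fun p : UnitRec 𝓧 𝓤 J × Bool => val p.2 :=
  (measurable_of_countable val).comp measurable_snd

lemma measurable_val : Measurable val := measurable_of_countable _

@[simp] lemma val_true : val true = 1 := rfl

@[simp] lemma val_false : val false = 0 := rfl

lemma abs_val_le (b : Bool) : |val b| ≤ 1 := by cases b <;> simp

lemma val_mul_self (b : Bool) : val b * val b = val b := by cases b <;> simp

lemma coin_real_singleton (b : Bool) : coin.real {b} = 1 / 2 := by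
  rw [coin, measureReal_def, uniformOn_univ]
  simp

lemma integral_coin (F : Bool → ℝ) : ∫ b, F b ∂coin = (F true + F false) / 2 := by
  rw [integral_fintype (Integrable.of_finite)]
  simp only [Fintype.sum_bool, coin_real_singleton, smul_eq_mul]
  ring

variable {Q : Measure (UnitRec 𝓧 𝓤 J)} [IsProbabilityMeasure Q]

lemma integral_coinLaw_mul (F : UnitRec 𝓧 𝓤 J → ℝ) (G : Bool → ℝ) :
    ∫ p, G p.2 * F p.1 ∂(coinLaw Q) = (G true + G false) / 2 * ∫ z, F z ∂Q := by
  simp_rw [mul_comm (G _)]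
  rw [integral_prod_mul F G, integral_coin, mul_comm]

lemma memLp_coinLaw_mul {F : UnitRec 𝓧 𝓤 J → ℝ} (hF : MemLp F 2 Q) (G : Bool → ℝ) :
    MemLp (fun p : UnitRec 𝓧 𝓤 J × Bool => G p.2 * F p.1) 2 (coinLaw Q) := by
  have h1 : MemLp (fun p : UnitRec 𝓧 𝓤 J × Bool => F p.1) 2 (coinLaw Q) := hF.comp_fst coin
  refine MemLp.mono (h1.const_mul (|G true| + |G false|)) ?_ (ae_of_all _ fun p => ?_)
  · exact ((measurable_of_countable G).comp measurable_snd).aestronglyMeasurable.mul h1.1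
  · rw [norm_mul, norm_mul]
    refine mul_le_mul_of_nonneg_right ?_ (norm_nonneg _)
    rw [Real.norm_eq_abs, Real.norm_eq_abs, abs_of_nonneg (by positivity : 0 ≤ |G true| + |G false|)]
    cases p.2
    · linarith [abs_nonneg (G true)]
    · linarith [abs_nonneg (G false)]

/-- The summand that is `φ` for the units with `W = j` and zero for the other units. -/
def arm (j : Fin J) (φ : UnitRec 𝓧 𝓤 J × Bool → ℝ) : Fin J → UnitRec 𝓧 𝓤 J × Bool → ℝ :=
  fun k p => if k = j then φ p else 0

lemma arm_self (j : Fin J) (φ : UnitRec 𝓧 𝓤 J × Bool → ℝ) : arm j φ j = φ := by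
  funext p; simp [arm]

lemma arm_of_ne {j k : Fin J} (h : k ≠ j) (φ : UnitRec 𝓧 𝓤 J × Bool → ℝ) :
    arm j φ k = fun _ => 0 := by
  funext p; simp [arm, h]

lemma isCentered_arm (j : Fin J) {φ : UnitRec 𝓧 𝓤 J × Bool → ℝ} (hφ : Measurable φ)
    (hφ2 : MemLp φ 2 (coinLaw Q)) (hφ0 : ∫ p, φ p ∂(coinLaw Q) = 0) :
    Rounds.IsCentered Q (fun _ => 0) (arm j φ) where
  measurable_unit := measurable_const
  memLp_unit := MemLp.zero
  integral_unit := by simp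
  measurable_arm k := by
    by_cases h : k = j
    · rwa [h, arm_self]
    · rw [arm_of_ne h]; exact measurable_const
  memLp_arm k := by
    by_cases h : k = j
    · rwa [h, arm_self]
    · rw [arm_of_ne h]; exact MemLp.zero
  integral_arm k := by
    by_cases h : k = j
    · rwa [h, arm_self]
    · rw [arm_of_ne h]; simp

/-- The influence function of the RCT estimator of intervention `j` when this intervention receives
the fraction `s` of the randomized units. -/
def rctInfluence (Q : Measure (UnitRec 𝓧 𝓤 J)) (f : 𝓧 × 𝓤 → Fin J → Bool) (s : ℝ) (j : Fin J)
    (p : UnitRec 𝓧 𝓤 J × Bool) : ℝ :=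
  2 / s * (val p.2 * (policyOutcome f j true p.1 - ∫ z, policyOutcome f j true z ∂Q)) -
    2 / s * ((1 - val p.2) * (policyOutcome f j false p.1 - ∫ z, policyOutcome f j false z ∂Q))

section Influence

variable {f : 𝓧 × 𝓤 → Fin J → Bool} {j : Fin J}

lemma measurable_rctInfluence (hf : Measurable f) (s : ℝ) (j : Fin J) :
    Measurable (rctInfluence Q f s j) := by
  have h1 := measurable_policyOutcome_fst (J := J) hf j true
  have h0 := measurable_policyOutcome_fst (J := J) hf j false
  have hv := measurable_val_snd (𝓧 := 𝓧) (𝓤 := 𝓤) (J := J)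
  exact ((hv.mul (h1.sub_const _)).const_mul _).sub
    (((measurable_const.sub hv).mul (h0.sub_const _)).const_mul _)

lemma memLp_arm_mul (b : Bool) (hvar : ∀ b, MemLp (policyOutcome f j b) 2 Q) (G : Bool → ℝ) :
    MemLp (fun p : UnitRec 𝓧 𝓤 J × Bool =>
      G p.2 * (policyOutcome f j b p.1 - ∫ z, policyOutcome f j b z ∂Q)) 2 (coinLaw Q) :=
  memLp_coinLaw_mul (F := fun z => policyOutcome f j b z - ∫ z, policyOutcome f j b z ∂Q)
    ((hvar b).sub (memLp_const _)) G

lemma integral_arm_mul (b : Bool) (hvar : ∀ b, MemLp (policyOutcome f j b) 2 Q) (G : Bool → ℝ) :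
    ∫ p, G p.2 * (policyOutcome f j b p.1 - ∫ z, policyOutcome f j b z ∂Q) ∂(coinLaw Q) = 0 := by
  rw [integral_coinLaw_mul (fun z => policyOutcome f j b z - ∫ z, policyOutcome f j b z ∂Q) G,
    integral_sub ((hvar b).integrable (by norm_num)) (integrable_const _)]
  simp

lemma memLp_rctInfluence (hvar : ∀ b, MemLp (policyOutcome f j b) 2 Q) (s : ℝ) :
    MemLp (rctInfluence Q f s j) 2 (coinLaw Q) :=
  ((memLp_arm_mul true hvar val).const_mul _).sub
    ((memLp_arm_mul false hvar fun b => 1 - val b).const_mul _)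

lemma integral_rctInfluence (hvar : ∀ b, MemLp (policyOutcome f j b) 2 Q) (s : ℝ) :
    ∫ p, rctInfluence Q f s j p ∂(coinLaw Q) = 0 := by
  simp only [rctInfluence]
  rw [integral_sub, integral_const_mul, integral_const_mul, integral_arm_mul true hvar val,
    integral_arm_mul false hvar fun b => 1 - val b]
  · simp
  · exact ((memLp_arm_mul true hvar val).integrable (by norm_num)).const_mul _
  · exact ((memLp_arm_mul false hvar fun b => 1 - val b).integrable (by norm_num)).const_mul _

/-- The cross term vanishes since `val b * (1 - val b) = 0`, and each value of the coin has
probability one half, so that the prefactor is `(2 / s)² / 2 = 2 / s²`. -/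
lemma integral_rctInfluence_sq (hf : Measurable f)
    (hvar : ∀ b, MemLp (policyOutcome f j b) 2 Q) (s : ℝ) :
    ∫ p, rctInfluence Q f s j p * rctInfluence Q f s j p ∂(coinLaw Q) =
      (2 * Var[policyOutcome f j true; Q] + 2 * Var[policyOutcome f j false; Q]) / s ^ 2 := by
  have hsq : ∀ p, rctInfluence Q f s j p * rctInfluence Q f s j p =
      (2 / s) ^ 2 * (val p.2 * (policyOutcome f j true p.1 - ∫ z, policyOutcome f j true z ∂Q) ^ 2) +
      (2 / s) ^ 2 * ((1 - val p.2) *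
        (policyOutcome f j false p.1 - ∫ z, policyOutcome f j false z ∂Q) ^ 2) := fun p => by
    unfold rctInfluence
    rcases p with ⟨z, b⟩
    cases b <;> simp <;> ring
  have hi : ∀ b (G : Bool → ℝ), Integrable (fun p : UnitRec 𝓧 𝓤 J × Bool =>
      G p.2 * (policyOutcome f j b p.1 - ∫ z, policyOutcome f j b z ∂Q) ^ 2) (coinLaw Q) := by
    intro b G
    have := (Integrable.of_finite : Integrable G coin)
    have h2 : Integrable (fun z => (policyOutcome f j b z - ∫ z, policyOutcome f j b z ∂Q) ^ 2) Q :=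
      ((hvar b).sub (memLp_const _)).integrable_sq
    simpa [mul_comm] using h2.mul_prod this
  simp_rw [hsq]
  rw [integral_add ((hi true val).const_mul _) ((hi false fun b => 1 - val b).const_mul _),
    integral_const_mul, integral_const_mul,
    integral_coinLaw_mul (fun z => (policyOutcome f j true z - ∫ z, policyOutcome f j true z ∂Q) ^ 2) val,
    integral_coinLaw_mul (fun z => (policyOutcome f j false z - ∫ z, policyOutcome f j false z ∂Q) ^ 2)
      fun b => 1 - val b,
    variance_eq_integral (measurable_policyOutcome hf j true).aemeasurable,
    variance_eq_integral (measurable_policyOutcome hf j false).aemeasurable]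
  simp only [val_true, val_false]
  ring

end Influence

end Units

/-! ### Asymptotic linearity of the RCT estimator; the arms that are eventually opened -/

namespace Rounds

variable {Ω 𝓧 𝓤 : Type*} {J : ℕ} (D : Rounds Ω 𝓧 𝓤 J) (f : 𝓧 × 𝓤 → Fin J → Bool)

/-- When `W = j`, the status of `j` is the coin and the observed outcome is the potential outcome
under the policy that sets `j` to the coin. This turns observed sums into sums over the independent
pair of record and coin. -/
lemma rctSum_eq_armSum (j : Fin J) (G : Bool → ℝ → ℝ) (m : ℕ) (ω : Ω) :
    D.rctSum f m ω j (fun o => G (o.2.1 j) o.2.2) =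
      D.armSum (arm j fun p => G p.2 (policyOutcome f j p.2 p.1)) m ω := by
  simp only [rctSum, armSum, arm]
  refine Finset.sum_congr rfl fun ν _ => Finset.sum_congr rfl fun l _ => ?_
  split_ifs with h
  · subst h
    simp [observeRct, policyOutcome, policy]
  · rfl

lemma count_eq_armSum (m : ℕ) (ω : Ω) (j : Fin J) :
    D.count m ω j = D.armSum (arm j fun _ => 1) m ω := rfl

lemma normSum_zero_left (h : Fin J → UnitRec 𝓧 𝓤 J × Bool → ℝ) (m : ℕ) (ω : Ω) :
    D.normSum (fun _ => 0) h m ω = (√(D.Lbar m))⁻¹ * D.armSum h m ω := by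
  simp [normSum, unitSum]

lemma normSum_zero_right (g : UnitRec 𝓧 𝓤 J → ℝ) (m : ℕ) (ω : Ω) :
    D.normSum g (fun _ _ => 0) m ω = (√(D.Nbar m))⁻¹ * D.unitSum g m ω := by
  simp [normSum, armSum]

lemma armSum_arm_linear (j : Fin J) (a b : ℝ) (φ χ : UnitRec 𝓧 𝓤 J × Bool → ℝ) (m : ℕ) (ω : Ω) :
    D.armSum (arm j fun p => a * φ p + b * χ p) m ω =
      a * D.armSum (arm j φ) m ω + b * D.armSum (arm j χ) m ω := by
  simp only [armSum, arm, Finset.mul_sum, ← Finset.sum_add_distrib]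
  refine Finset.sum_congr rfl fun ν _ => Finset.sum_congr rfl fun l _ => ?_
  split_ifs <;> ring

variable [mΩ : MeasurableSpace Ω] [MeasurableSpace 𝓧] [MeasurableSpace 𝓤]
  {P : Measure Ω} [IsProbabilityMeasure P]
  {Q : Measure (UnitRec 𝓧 𝓤 J)} [IsProbabilityMeasure Q]
  {D} {f} {ℱ : Filtration ℕ mΩ} {q : Fin J → ℝ}

lemma measurable_tauR (hD : D.IsSampled P ℱ Q) (hf : Measurable f) (m : ℕ) (j : Fin J) :
    Measurable fun ω => D.tauR f m ω j := by
  have key : ∀ G : Bool → ℝ → ℝ, (∀ b, Measurable (G b)) →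
      Measurable fun ω => D.rctSum f m ω j (fun o => G (o.2.1 j) o.2.2) := by
    intro G hG
    simp_rw [rctSum_eq_armSum]
    refine hD.measurable_armSum (fun k => ?_) m
    by_cases h : k = j
    · subst h
      rw [arm_self]
      refine measurable_from_prod_countable_left fun b => ?_
      exact (hG b).comp (measurable_policyOutcome hf k b)
    · rw [arm_of_ne h]; exact measurable_const
  unfold tauR
  exact ((key (fun b y => val b * y) fun b => measurable_id.const_mul _).div
    (key (fun b _ => val b) fun b => measurable_const)).sub
    ((key (fun b y => (1 - val b) * y) fun b => measurable_id.const_mul _).div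
    (key (fun b _ => 1 - val b) fun b => measurable_const))

/-- The RCT estimator is asymptotically linear. -/
lemma IsAsymptotic.littleOP_tauR (hA : D.IsAsymptotic P ℱ Q q) (hf : Measurable f) {j : Fin J}
    (hq : 0 < q j) (hvar : ∀ b, MemLp (policyOutcome f j b) 2 Q) :
    LittleOP P fun m ω => √(D.Lbar m) * (D.tauR f m ω j - ate Q f j) -
      D.normSum (fun _ => 0) (arm j (rctInfluence Q f (q j) j)) m ω := by
  set m1 := ∫ z, policyOutcome f j true z ∂Q with hm1
  set m0 := ∫ z, policyOutcome f j false z ∂Q with hm0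
  set Y1 : UnitRec 𝓧 𝓤 J × Bool → ℝ := fun p => val p.2 * policyOutcome f j true p.1 with hY1
  set Y0 : UnitRec 𝓧 𝓤 J × Bool → ℝ := fun p => (1 - val p.2) * policyOutcome f j false p.1 with hY0
  set c1 : UnitRec 𝓧 𝓤 J × Bool → ℝ := fun p => val p.2 with hc1
  set c0 : UnitRec 𝓧 𝓤 J × Bool → ℝ := fun p => 1 - val p.2 with hc0
  set R1 : UnitRec 𝓧 𝓤 J × Bool → ℝ := fun p => val p.2 * (policyOutcome f j true p.1 - m1) with hR1
  set R0 : UnitRec 𝓧 𝓤 J × Bool → ℝ :=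
    fun p => (1 - val p.2) * (policyOutcome f j false p.1 - m0) with hR0
  -- The centred coin: treated units number half the arm count plus the sum of `e`, and untreated
  -- ones half the count minus it. That sum is of order `√Lbar`, so both fractions tend to `q j /
  -- 2`. The factor `1` matches the product form of the coin lemmas.
  set e : UnitRec 𝓧 𝓤 J × Bool → ℝ := fun p => (val p.2 - 1 / 2) * 1 with he
  set A := fun (φ : UnitRec 𝓧 𝓤 J × Bool → ℝ) m ω => D.armSum (arm j φ) m ω with hAdef
  have hp1 := measurable_policyOutcome_fst (J := J) hf j true
  have hp0 := measurable_policyOutcome_fst (J := J) hf j false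
  have hv := measurable_val_snd (𝓧 := 𝓧) (𝓤 := 𝓤) (J := J)
  have hR1c : IsCentered Q (fun _ => 0) (arm j R1) := isCentered_arm j (hv.mul (hp1.sub_const _))
    (memLp_arm_mul true hvar val) (integral_arm_mul true hvar val)
  have hR0c : IsCentered Q (fun _ => 0) (arm j R0) :=
    isCentered_arm j ((measurable_const.sub hv).mul (hp0.sub_const _))
    (memLp_arm_mul false hvar fun b => 1 - val b) (integral_arm_mul false hvar fun b => 1 - val b)
  have hec : IsCentered Q (fun _ => 0) (arm j e) := isCentered_arm j ((hv.sub_const _).mul_const _)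
    (memLp_coinLaw_mul (F := fun _ => (1 : ℝ)) (memLp_const _) fun b => val b - 1 / 2)
    (by rw [integral_coinLaw_mul (fun _ => (1 : ℝ)) fun b => val b - 1 / 2]; norm_num)
  have hBR1 := hA.bigOP_normSum hR1c
  have hBR0 := hA.bigOP_normSum hR0c
  have hBe := hA.bigOP_normSum hec
  have hL := hA.tendsto_Lbar
  have hcnt : LittleOP P fun m ω => D.count m ω j / D.Lbar m - q j :=
    littleOP_sub_iff.2 (hA.share j)
  have hoe : LittleOP P fun m ω => D.normSum (fun _ => 0) (arm j e) m ω * (√(D.Lbar m))⁻¹ :=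
    hBe.mul_littleOP (littleOP_of_tendsto (tendsto_inv_sqrt hL))
  have hLpos : ∀ᶠ m in atTop, 0 < D.Lbar m := hL.eventually_gt_atTop 0
  have hC1 : LittleOP P fun m ω => A c1 m ω / D.Lbar m - q j / 2 := by
    refine ((hcnt.const_mul (1 / 2)).add hoe).of_le whp_univ ?_
    filter_upwards [hLpos] with m hm ω _
    have h1 := D.armSum_arm_linear j (1 / 2) 1 (fun _ => 1) e m ω
    have h2 : (fun p : UnitRec 𝓧 𝓤 J × Bool => 1 / 2 * 1 + 1 * e p) = c1 := by
      funext p; simp only [he, hc1]; ring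
    rw [h2, ← count_eq_armSum] at h1
    rw [normSum_zero_left]
    simp only [hAdef]
    rw [h1]
    refine le_of_eq ?_
    congr 1
    have h3 : (√(D.Lbar m))⁻¹ * (√(D.Lbar m))⁻¹ = (D.Lbar m)⁻¹ := by
      rw [← mul_inv, Real.mul_self_sqrt hm.le]
    rw [div_eq_mul_inv, ← h3]
    rw [div_eq_mul_inv (D.count m ω j), ← h3]
    ring
  have hC0 : LittleOP P fun m ω => A c0 m ω / D.Lbar m - q j / 2 := by
    refine ((hcnt.const_mul (1 / 2)).add (hoe.const_mul (-1))).of_le whp_univ ?_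
    filter_upwards [hLpos] with m hm ω _
    have h1 := D.armSum_arm_linear j (1 / 2) (-1) (fun _ => 1) e m ω
    have h2 : (fun p : UnitRec 𝓧 𝓤 J × Bool => 1 / 2 * 1 + -1 * e p) = c0 := by
      funext p; simp only [he, hc0]; ring
    rw [h2, ← count_eq_armSum] at h1
    rw [normSum_zero_left]
    simp only [hAdef]
    rw [h1]
    refine le_of_eq ?_
    congr 1
    have h3 : (√(D.Lbar m))⁻¹ * (√(D.Lbar m))⁻¹ = (D.Lbar m)⁻¹ := by
      rw [← mul_inv, Real.mul_self_sqrt hm.le]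
    rw [div_eq_mul_inv, ← h3]
    rw [div_eq_mul_inv (D.count m ω j), ← h3]
    ring
  have hq2 : q j / 2 ≠ 0 := by positivity
  -- The linearization error is exactly this: centred sums, bounded in probability, times the error
  -- of replacing the inverse fractions by `2 / q j`.
  have hmain := (hBR1.mul_littleOP (hC1.inv_sub_inv hq2)).add
    ((hBR0.mul_littleOP (hC0.inv_sub_inv hq2)).const_mul (-1))
  -- On these events both fractions exceed `q j / 4`, so neither denominator vanishes and the
  -- convention for empty means plays no role.
  refine hmain.of_le ((hC1.whp (by positivity : 0 < q j / 4)).inter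
    (hC0.whp (by positivity : 0 < q j / 4))) ?_
  filter_upwards [hLpos] with m hm ω hω
  have hω1 : |A c1 m ω / D.Lbar m - q j / 2| < q j / 4 := hω.1
  have hω0 : |A c0 m ω / D.Lbar m - q j / 2| < q j / 4 := hω.2
  have hne1 : A c1 m ω ≠ 0 := by
    intro h
    rw [h, zero_div, zero_sub, abs_neg, abs_of_pos (by positivity)] at hω1
    linarith
  have hne0 : A c0 m ω ≠ 0 := by
    intro h
    rw [h, zero_div, zero_sub, abs_neg, abs_of_pos (by positivity)] at hω0
    linarith
  refine le_of_eq ?_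
  congr 1
  have hS1 : A Y1 m ω = A R1 m ω + m1 * A c1 m ω := by
    have h1 := D.armSum_arm_linear j 1 m1 R1 c1 m ω
    have h2 : (fun p : UnitRec 𝓧 𝓤 J × Bool => 1 * R1 p + m1 * c1 p) = Y1 := by
      funext p; simp only [hR1, hc1, hY1]; ring
    rw [h2, one_mul] at h1
    exact h1
  have hS0 : A Y0 m ω = A R0 m ω + m0 * A c0 m ω := by
    have h1 := D.armSum_arm_linear j 1 m0 R0 c0 m ω
    have h2 : (fun p : UnitRec 𝓧 𝓤 J × Bool => 1 * R0 p + m0 * c0 p) = Y0 := by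
      funext p; simp only [hR0, hc0, hY0]; ring
    rw [h2, one_mul] at h1
    exact h1
  have htau : D.tauR f m ω j = A Y1 m ω / A c1 m ω - A Y0 m ω / A c0 m ω := by
    unfold tauR
    rw [D.rctSum_eq_armSum f j (fun b y => val b * y), D.rctSum_eq_armSum f j (fun b _ => val b),
      D.rctSum_eq_armSum f j (fun b y => (1 - val b) * y),
      D.rctSum_eq_armSum f j (fun b _ => 1 - val b)]
    have h1 : (fun p : UnitRec 𝓧 𝓤 J × Bool => val p.2 * policyOutcome f j p.2 p.1) = Y1 := by
      funext ⟨z, b⟩; cases b <;> simp [hY1]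
    have h0 : (fun p : UnitRec 𝓧 𝓤 J × Bool => (1 - val p.2) * policyOutcome f j p.2 p.1) = Y0 := by
      funext ⟨z, b⟩; cases b <;> simp [hY0]
    rw [h1, h0]
  have hinf : D.armSum (arm j (rctInfluence Q f (q j) j)) m ω =
      2 / q j * A R1 m ω - 2 / q j * A R0 m ω := by
    have h1 := D.armSum_arm_linear j (2 / q j) (-(2 / q j)) R1 R0 m ω
    have h2 : (fun p : UnitRec 𝓧 𝓤 J × Bool => 2 / q j * R1 p + -(2 / q j) * R0 p) =
        rctInfluence Q f (q j) j := by
      funext p; simp only [hR1, hR0, rctInfluence]; ring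
    rw [h2] at h1
    rw [h1]; simp only [hAdef]; ring
  rw [htau, hS1, hS0, normSum_zero_left, normSum_zero_left, normSum_zero_left, hinf, ate]
  simp only [← hm1, ← hm0]
  have hs : √(D.Lbar m) ≠ 0 := (Real.sqrt_pos.2 hm).ne'
  have hs2 : D.Lbar m = √(D.Lbar m) * √(D.Lbar m) := (Real.mul_self_sqrt hm.le).symm
  have e1 : D.armSum (arm j R1) m ω = A R1 m ω := rfl
  have e0 : D.armSum (arm j R0) m ω = A R0 m ω := rfl
  rw [e1, e0]
  generalize A R1 m ω = r1 at *
  generalize A R0 m ω = r0 at *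
  generalize A c1 m ω = k1 at *
  generalize A c0 m ω = k0 at *
  generalize √(D.Lbar m) = s at *
  rw [hs2]
  field_simp
  ring

variable {T : Finset (Fin J)}

lemma ae_count_eq_zero (hD : D.IsSampled P ℱ Q) (hT : ∀ m, ∀ᵐ ω ∂P, D.S m ω ⊆ T) {j : Fin J}
    (hj : j ∉ T) : ∀ᵐ ω ∂P, ∀ m, D.count m ω j = 0 := by
  filter_upwards [ae_all_iff.2 hT, hD.ae_W_mem] with ω h1 h2 m
  refine Finset.sum_eq_zero fun ν _ => Finset.sum_eq_zero fun l _ => ?_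
  rw [if_neg]
  rintro rfl
  exact hj (h1 ν (h2 ν l))

/-- With probability tending to one, the interventions in `T` are those that were open to
randomization. -/
lemma IsAsymptotic.whp_Sbar_eq (hA : D.IsAsymptotic P ℱ Q q) (hT : ∀ m, ∀ᵐ ω ∂P, D.S m ω ⊆ T)
    (hq : ∀ j ∈ T, 0 < q j) : Whp P fun m => {ω | D.Sbar m ω = T} := by
  have h1 : Whp P fun m => ⋂ j ∈ T, {ω | |D.count m ω j / D.Lbar m - q j| < q j} :=
    Whp.iInter T fun j hj => (littleOP_sub_iff.2 (hA.share j)).whp (hq j hj)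
  have h2 : Whp P fun m => {ω | D.Sbar m ω ⊆ T} := by
    refine whp_of_ae fun m => ?_
    filter_upwards [ae_all_iff.2 hT] with ω hω
    exact Finset.biUnion_subset.2 fun ν _ => hω ν
  have h3 : Whp P fun _ : ℕ => {ω | ∀ m (l : Fin (D.L m)), (D.rct m l ω).2.1 ∈ D.S m ω} :=
    whp_of_ae fun _ => hA.sampled.ae_W_mem
  refine ((h1.inter h2).inter h3).mono (Eventually.of_forall fun m ω hω => ?_)
  obtain ⟨⟨hω1, hω2⟩, hω3⟩ := hω
  refine Finset.Subset.antisymm hω2 fun j hj => ?_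
  have h4 : |D.count m ω j / D.Lbar m - q j| < q j := Set.mem_iInter₂.1 hω1 j hj
  by_contra hjS
  have h5 : D.count m ω j = 0 := by
    refine Finset.sum_eq_zero fun ν hν => Finset.sum_eq_zero fun l _ => ?_
    rw [if_neg]
    rintro rfl
    exact hjS (Finset.mem_biUnion.2 ⟨ν, hν, hω3 ν l⟩)
  rw [h5, zero_div, zero_sub, abs_neg, abs_of_pos (hq j hj)] at h4
  exact lt_irrefl _ h4

/-- Arms outside `T` are almost surely never used, so their share is zero. The randomized sample
grows because the observational fraction is eventually below `(1 + ρ) / 2 < 1`, which gives `Lbar ≥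
Nbar (1 - ρ) / 2`. -/
lemma isAsymptotic_of_share (hD : D.IsSampled P ℱ Q) (hN : Tendsto D.Nbar atTop atTop) {ρ : ℝ}
    (hρ : ρ ∈ Set.Ioo (0 : ℝ) 1)
    (hρlim : Tendsto (fun m => D.Nbar m / (D.Nbar m + D.Lbar m)) atTop (𝓝 ρ))
    (hT : ∀ m, ∀ᵐ ω ∂P, D.S m ω ⊆ T) {share : Fin J → ℝ} (hshare_pos : ∀ j ∈ T, 0 < share j)
    (hshare : ∀ j ∈ T,
      TendstoInMeasure P (fun m ω => D.count m ω j / D.Lbar m) atTop (fun _ => share j)) :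
    D.IsAsymptotic P ℱ Q fun j => if j ∈ T then share j else 0 where
  sampled := hD
  tendsto_Nbar := hN
  tendsto_Lbar := by
    have h1 : ∀ᶠ m in atTop, D.Nbar m / (D.Nbar m + D.Lbar m) < (1 + ρ) / 2 :=
      hρlim.eventually_lt_const (by linarith [hρ.2])
    have h2 : Tendsto (fun m => D.Nbar m * ((1 - ρ) / 2)) atTop atTop :=
      hN.atTop_mul_const (by linarith [hρ.2])
    refine tendsto_atTop_mono' _ ?_ h2
    filter_upwards [h1, hN.eventually_gt_atTop 0] with m hm hm0
    have hL := D.Lbar_nonneg m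
    rw [div_lt_iff₀ (by linarith)] at hm
    nlinarith [hρ.1, hρ.2]
  share j := by
    by_cases hj : j ∈ T
    · simpa [hj] using hshare j hj
    · simp only [hj, if_false]
      rw [← littleOP_iff_tendstoInMeasure]
      refine (littleOP_zero (P := P)).of_le
        (whp_of_ae (G := fun _ => {ω | ∀ m, D.count m ω j = 0}) fun _ => ae_count_eq_zero hD hT hj)
        (Eventually.of_forall fun m ω hω => ?_)
      have : D.count m ω j = 0 := hω m
      simp [this]
  share_nonneg j := by
    by_cases hj : j ∈ T
    · simpa [hj] using (hshare_pos j hj).le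
    · simp [hj]

end Rounds

/-! ### Inequalities for the logistic function -/

section Sigmoid

lemma inv_sigmoid (t : ℝ) : (Real.sigmoid t)⁻¹ = 1 + Real.exp (-t) := by
  rw [Real.sigmoid_def, inv_inv]

lemma inv_one_sub_sigmoid (t : ℝ) : (1 - Real.sigmoid t)⁻¹ = 1 + Real.exp t := by
  rw [← Real.sigmoid_neg, inv_sigmoid, neg_neg]

lemma abs_sigmoid_sub_le (u t : ℝ) : |Real.sigmoid u - Real.sigmoid t| ≤ |u - t| := by
  have h := Convex.norm_image_sub_le_of_norm_deriv_le (𝕜 := ℝ) (f := Real.sigmoid) (C := 1)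
    (s := Set.univ) (x := t) (y := u) (fun x _ => differentiableAt_sigmoid)
    (fun x _ => ?_) convex_univ (Set.mem_univ _) (Set.mem_univ _)
  · simpa using h
  · rw [Real.deriv_sigmoid, Real.norm_eq_abs, abs_of_nonneg]
    · nlinarith [Real.sigmoid_nonneg x, Real.sigmoid_le_one x]
    · exact mul_nonneg (Real.sigmoid_nonneg x) (by linarith [Real.sigmoid_le_one x])

/-- Apply the mean value inequality to the sigmoid minus its linear part. The derivative is `(σ x -
σ t)(1 - σ x - σ t)`, of modulus at most `|x - t| ≤ |s|` between `t` and `t + s`. -/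
lemma abs_sigmoid_taylor_le (t s : ℝ) :
    |Real.sigmoid (t + s) - Real.sigmoid t - Real.sigmoid t * (1 - Real.sigmoid t) * s| ≤ s ^ 2 := by
  have hd : ∀ x, HasDerivAt (fun u => Real.sigmoid u - Real.sigmoid t * (1 - Real.sigmoid t) * u)
      (Real.sigmoid x * (1 - Real.sigmoid x) - Real.sigmoid t * (1 - Real.sigmoid t)) x := fun x => by
    simpa using (Real.hasDerivAt_sigmoid x).fun_sub
      ((hasDerivAt_id x).const_mul (Real.sigmoid t * (1 - Real.sigmoid t)))
  have h := Convex.norm_image_sub_le_of_norm_hasDerivWithin_le (C := |s|)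
    (s := Set.uIcc t (t + s)) (x := t) (y := t + s)
    (fun x _ => (hd x).hasDerivWithinAt)
    (fun x hx => ?_) (convex_uIcc _ _) Set.left_mem_uIcc Set.right_mem_uIcc
  · have h2 : |s| * ‖t + s - t‖ = s ^ 2 := by
      rw [add_sub_cancel_left, Real.norm_eq_abs, ← sq, sq_abs]
    rw [h2, Real.norm_eq_abs] at h
    refine le_trans (le_of_eq ?_) h
    congr 1
    ring
  · have h1 : |x - t| ≤ |s| := by
      have := Set.abs_sub_left_of_mem_uIcc hx
      simpa using this
    refine le_trans ?_ ((abs_sigmoid_sub_le x t).trans h1)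
    have h3 : Real.sigmoid x * (1 - Real.sigmoid x) - Real.sigmoid t * (1 - Real.sigmoid t) =
        (Real.sigmoid x - Real.sigmoid t) * (1 - Real.sigmoid x - Real.sigmoid t) := by ring
    rw [h3, norm_mul]
    refine mul_le_of_le_one_right (norm_nonneg _) ?_
    rw [Real.norm_eq_abs, abs_le]
    constructor <;> linarith [Real.sigmoid_le_one x, Real.sigmoid_le_one t,
      Real.sigmoid_nonneg x, Real.sigmoid_nonneg t]

/-- On `[-K, K]` both `σ` and `1 - σ` are at least `σ(-K)`, so `σ' ≥ σ(-K)²` and `σ(u) - σ(-K)² u`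
is monotone there. -/
lemma sigmoid_strong_mono {K u t : ℝ} (hu : |u| ≤ K) (ht : |t| ≤ K) :
    Real.sigmoid (-K) ^ 2 * (u - t) ^ 2 ≤ (Real.sigmoid u - Real.sigmoid t) * (u - t) := by
  set c := Real.sigmoid (-K) ^ 2 with hc
  have hd : ∀ x, HasDerivAt (fun u => Real.sigmoid u - c * u)
      (Real.sigmoid x * (1 - Real.sigmoid x) - c) x := fun x => by
    simpa using (Real.hasDerivAt_sigmoid x).fun_sub ((hasDerivAt_id x).const_mul c)
  have hmono : MonotoneOn (fun u => Real.sigmoid u - c * u) (Set.Icc (-K) K) := by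
    refine monotoneOn_of_deriv_nonneg (convex_Icc _ _)
      (fun x _ => (hd x).continuousAt.continuousWithinAt)
      (fun x _ => (hd x).differentiableAt.differentiableWithinAt) fun x hx => ?_
    rw [(hd x).deriv]
    rw [interior_Icc] at hx
    have h1 : Real.sigmoid (-K) ≤ Real.sigmoid x := Real.sigmoid_monotone hx.1.le
    have h2 : Real.sigmoid (-K) ≤ 1 - Real.sigmoid x := by
      rw [← Real.sigmoid_neg]; exact Real.sigmoid_monotone (by linarith [hx.2])
    have := mul_le_mul h1 h2 (Real.sigmoid_nonneg _) (Real.sigmoid_nonneg _)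
    rw [hc, sq]
    linarith
  have hu' : u ∈ Set.Icc (-K) K := abs_le.1 hu
  have ht' : t ∈ Set.Icc (-K) K := abs_le.1 ht
  rcases le_total t u with h | h
  · have := hmono ht' hu' h
    simp only at this
    nlinarith [mul_nonneg (sub_nonneg.2 this) (sub_nonneg.2 h)]
  · have := hmono hu' ht' h
    simp only at this
    nlinarith [mul_nonneg (sub_nonneg.2 this) (sub_nonneg.2 h)]

lemma hasDerivAt_log_one_add_exp (t : ℝ) :
    HasDerivAt (fun u => Real.log (1 + Real.exp u)) (Real.sigmoid t) t := by
  have hpos : (1 : ℝ) + Real.exp t ≠ 0 := by positivity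
  have h := ((Real.hasDerivAt_exp t).const_add 1).log hpos
  convert! h using 1
  rw [Real.sigmoid_def, Real.exp_neg]
  field_simp
  ring

lemma hasDerivAt_log_lik (a : Bool) (t : ℝ) :
    HasDerivAt (fun u => Real.log (if a then Real.sigmoid u else 1 - Real.sigmoid u))
      (val a - Real.sigmoid t) t := by
  have h1 := Real.sigmoid_pos t
  have h2 : 0 < 1 - Real.sigmoid t := by linarith [Real.sigmoid_lt_one t]
  cases a
  · simp only [Bool.false_eq_true, if_false, val_false]
    convert! ((Real.hasDerivAt_sigmoid t).const_sub 1).log h2.ne' using 1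
    field_simp
    ring
  · simp only [if_true, val_true]
    convert! (Real.hasDerivAt_sigmoid t).log h1.ne' using 1
    field_simp

end Sigmoid

/-! ### Roots of the logistic score: existence and location -/

section Dot

variable {d : ℕ}

lemma abs_dotProduct_le {ι : Type*} [Fintype ι] (x u : ι → ℝ) : |x ⬝ᵥ u| ≤ (∑ k, |x k|) * ‖u‖ := by
  rw [dotProduct, Finset.sum_mul]
  refine (Finset.abs_sum_le_sum_abs _ _).trans (Finset.sum_le_sum fun k _ => ?_)
  rw [abs_mul]
  exact mul_le_mul_of_nonneg_left (norm_le_pi_norm u k) (abs_nonneg _)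

/-- The continuous linear functional `u ↦ x ⬝ᵥ u`. -/
def dotCLM {ι : Type*} [Fintype ι] (x : ι → ℝ) : (ι → ℝ) →L[ℝ] ℝ :=
  ∑ k, x k • ContinuousLinearMap.proj k

lemma dotCLM_apply {ι : Type*} [Fintype ι] (x u : ι → ℝ) : dotCLM x u = x ⬝ᵥ u := by
  simp [dotCLM, dotProduct]

end Dot

section LogisticRoot

variable {ι : Type*} [Fintype ι] {d : ℕ} (w : ℝ) (x : ι → Fin d → ℝ) (a : ι → ℝ)

/-- The score of the logistic regression of `a` on `x`, with weight `w` for every unit. -/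
def score (b : Fin d → ℝ) (k : Fin d) : ℝ := w * ∑ i, (a i - Real.sigmoid (x i ⬝ᵥ b)) * x i k

lemma score_dotProduct (b u : Fin d → ℝ) :
    score w x a b ⬝ᵥ u = w * ∑ i, (a i - Real.sigmoid (x i ⬝ᵥ b)) * (x i ⬝ᵥ u) := by
  simp only [score, dotProduct, Finset.mul_sum, Finset.sum_mul]
  rw [Finset.sum_comm]
  refine Finset.sum_congr rfl fun i _ => Finset.sum_congr rfl fun k _ => ?_
  ring

variable {w x a}

lemma score_sub_dotProduct (b b' u : Fin d → ℝ) :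
    score w x a b' ⬝ᵥ u - score w x a b ⬝ᵥ u =
      w * ∑ i, (Real.sigmoid (x i ⬝ᵥ b) - Real.sigmoid (x i ⬝ᵥ b')) * (x i ⬝ᵥ u) := by
  rw [score_dotProduct, score_dotProduct, ← mul_sub, ← Finset.sum_sub_distrib]
  congr 1
  exact Finset.sum_congr rfl fun i _ => by ring

variable {β : Fin d → ℝ} {K c' : ℝ}

/-- Strong monotonicity of the negative score on the unit ball around `β`: bounded linear predictors
keep the slope of the sigmoid away from zero, and `hquad` makes the design nondegenerate. -/
lemma le_score_sub_dotProduct (hw : 0 ≤ w) (hK : ∀ i b, ‖b - β‖ ≤ 1 → |x i ⬝ᵥ b| ≤ K)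
    (hquad : ∀ u, c' * ‖u‖ ^ 2 ≤ w * ∑ i, (x i ⬝ᵥ u) ^ 2) {b : Fin d → ℝ} (hb : ‖b - β‖ ≤ 1) :
    Real.sigmoid (-K) ^ 2 * c' * ‖b - β‖ ^ 2 ≤
      score w x a β ⬝ᵥ (b - β) - score w x a b ⬝ᵥ (b - β) := by
  rw [score_sub_dotProduct]
  have h1 : ∑ i, Real.sigmoid (-K) ^ 2 * (x i ⬝ᵥ (b - β)) ^ 2 ≤
      ∑ i, (Real.sigmoid (x i ⬝ᵥ b) - Real.sigmoid (x i ⬝ᵥ β)) * (x i ⬝ᵥ (b - β)) := by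
    refine Finset.sum_le_sum fun i _ => ?_
    rw [dotProduct_sub]
    exact sigmoid_strong_mono (hK i b hb) (hK i β (by simp))
  rw [← Finset.mul_sum] at h1
  have h2 := mul_le_mul_of_nonneg_left (hquad (b - β)) (sq_nonneg (Real.sigmoid (-K)))
  have h3 := mul_le_mul_of_nonneg_left h1 hw
  calc _ = Real.sigmoid (-K) ^ 2 * (c' * ‖b - β‖ ^ 2) := by ring
    _ ≤ _ := h2
    _ = w * (Real.sigmoid (-K) ^ 2 * ∑ i, (x i ⬝ᵥ (b - β)) ^ 2) := by ring
    _ ≤ _ := h3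

/-- If the score at `β` is small, every root of the score is close to `β`. -/
lemma norm_sub_le_of_score_eq_zero (hw : 0 ≤ w) (hK : ∀ i b, ‖b - β‖ ≤ 1 → |x i ⬝ᵥ b| ≤ K)
    (hc' : 0 < c') (hquad : ∀ u, c' * ‖u‖ ^ 2 ≤ w * ∑ i, (x i ⬝ᵥ u) ^ 2)
    (hs : ∑ k, |score w x a β k| < Real.sigmoid (-K) ^ 2 * c') {b : Fin d → ℝ}
    (hb : score w x a b = 0) :
    ‖b - β‖ ≤ (∑ k, |score w x a β k|) / (Real.sigmoid (-K) ^ 2 * c') := by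
  set s := ∑ k, |score w x a β k| with hsdef
  have hc : 0 < Real.sigmoid (-K) ^ 2 * c' := mul_pos (pow_pos (Real.sigmoid_pos _) 2) hc'
  have hsb := abs_dotProduct_le (score w x a β) (b - β)
  rw [← hsdef] at hsb
  rcases le_or_gt ‖b - β‖ 1 with h1 | h1
  · have h2 := le_score_sub_dotProduct (a := a) hw hK hquad h1
    rw [hb, zero_dotProduct, sub_zero] at h2
    rw [le_div_iff₀ hc]
    rcases (norm_nonneg (b - β)).eq_or_lt with h0 | h0
    · rw [← h0, zero_mul]; exact Finset.sum_nonneg fun _ _ => abs_nonneg _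
    · have h3 := h2.trans ((le_abs_self _).trans hsb)
      refine le_of_mul_le_mul_right ?_ h0
      calc _ = Real.sigmoid (-K) ^ 2 * c' * ‖b - β‖ ^ 2 := by ring
        _ ≤ _ := h3
  · exfalso
    have hr : 0 < ‖b - β‖ := one_pos.trans h1
    set r := ‖b - β‖⁻¹ with hrdef
    have hr0 : 0 < r := inv_pos.2 hr
    -- A root farther than one from `β` is pulled back radially to the unit sphere. Monotonicity of
    -- the sigmoid bounds each summand at `b'` by `r` times the summand at `b`, so the slope bound
    -- at `b'` would force the score at `β` to be too large.
    set b' := β + r • (b - β) with hb'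
    have hb'β : b' - β = r • (b - β) := by simp [hb']
    have hn : ‖b' - β‖ = 1 := by
      rw [hb'β, norm_smul, Real.norm_of_nonneg hr0.le, hrdef, inv_mul_cancel₀ hr.ne']
    have h2 := le_score_sub_dotProduct (a := a) hw hK hquad hn.le
    rw [hn, one_pow, mul_one, score_sub_dotProduct] at h2
    have h3 : ∑ i, (Real.sigmoid (x i ⬝ᵥ b') - Real.sigmoid (x i ⬝ᵥ β)) * (x i ⬝ᵥ (b' - β)) ≤
        r * ∑ i, (Real.sigmoid (x i ⬝ᵥ b) - Real.sigmoid (x i ⬝ᵥ β)) * (x i ⬝ᵥ (b - β)) := by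
      rw [Finset.mul_sum]
      refine Finset.sum_le_sum fun i _ => ?_
      have h4 : x i ⬝ᵥ (b' - β) = r * (x i ⬝ᵥ (b - β)) := by
        rw [hb'β, dotProduct_smul, smul_eq_mul]
      have h5 : x i ⬝ᵥ b' = x i ⬝ᵥ β + r * (x i ⬝ᵥ (b - β)) := by
        rw [hb', dotProduct_add, dotProduct_smul, smul_eq_mul]
      have h6 : x i ⬝ᵥ b = x i ⬝ᵥ β + x i ⬝ᵥ (b - β) := by rw [dotProduct_sub]; ring
      rw [h4, h5, h6]
      set t := x i ⬝ᵥ β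
      set u := x i ⬝ᵥ (b - β)
      have hr1 : r ≤ 1 := inv_le_one_of_one_le₀ h1.le
      rcases le_total 0 u with hu | hu
      · have h7 : Real.sigmoid (t + r * u) ≤ Real.sigmoid (t + u) :=
          Real.sigmoid_monotone (by nlinarith)
        nlinarith [mul_nonneg (mul_nonneg hr0.le hu) (sub_nonneg.2 h7)]
      · have h7 : Real.sigmoid (t + u) ≤ Real.sigmoid (t + r * u) :=
          Real.sigmoid_monotone (by nlinarith)
        nlinarith [mul_nonneg (mul_nonneg hr0.le (neg_nonneg.2 hu)) (sub_nonneg.2 h7)]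
    have h4 := score_sub_dotProduct (w := w) (x := x) (a := a) b β (b - β)
    rw [hb, zero_dotProduct, sub_zero] at h4
    have h5 := mul_le_mul_of_nonneg_left h3 hw
    have h6 : Real.sigmoid (-K) ^ 2 * c' ≤ r * (s * ‖b - β‖) := by
      calc _ ≤ _ := h2
        _ ≤ _ := h5
        _ = r * (score w x a β ⬝ᵥ (b - β)) := by rw [h4]; ring
        _ ≤ _ := mul_le_mul_of_nonneg_left ((le_abs_self _).trans hsb) hr0.le
    have h7 : r * (s * ‖b - β‖) = s := by
      rw [hrdef]; field_simp
    linarith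

/-- If the score at `β` is small, the score has a root. -/
lemma exists_score_eq_zero (hw : 0 ≤ w) (hK : ∀ i b, ‖b - β‖ ≤ 1 → |x i ⬝ᵥ b| ≤ K)
    (hc' : 0 < c') (hquad : ∀ u, c' * ‖u‖ ^ 2 ≤ w * ∑ i, (x i ⬝ᵥ u) ^ 2)
    (hs : ∑ k, |score w x a β k| < Real.sigmoid (-K) ^ 2 * c') :
    ∃ b, score w x a b = 0 := by
  set s := ∑ k, |score w x a β k| with hsdef
  have hc : 0 < Real.sigmoid (-K) ^ 2 * c' := mul_pos (pow_pos (Real.sigmoid_pos _) 2) hc'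
  -- The weighted negative log-likelihood, whose gradient is minus the score. A minimizer over the
  -- closed unit ball exists by compactness; it is a root once shown to be interior.
  set F : (Fin d → ℝ) → ℝ :=
    fun b => w * ∑ i, (Real.log (1 + Real.exp (dotCLM (x i) b)) - a i * dotCLM (x i) b) with hF
  have hFd : ∀ b, HasFDerivAt F (w • ∑ i, (Real.sigmoid (dotCLM (x i) b) • dotCLM (x i) -
      a i • dotCLM (x i))) b := fun b => by
    refine HasFDerivAt.const_mul (HasFDerivAt.fun_sum fun i _ => ?_) w
    exact ((hasDerivAt_log_one_add_exp _).comp_hasFDerivAt b (dotCLM (x i)).hasFDerivAt).sub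
      ((dotCLM (x i)).hasFDerivAt.const_mul _)
  have hFs : ∀ b u, (w • ∑ i, (Real.sigmoid (dotCLM (x i) b) • dotCLM (x i) -
      a i • dotCLM (x i))) u = -(score w x a b ⬝ᵥ u) := fun b u => by
    rw [score_dotProduct]
    simp only [smul_apply, sum_apply, sub_apply, smul_eq_mul, dotCLM_apply]
    rw [← mul_neg, ← Finset.sum_neg_distrib]
    congr 1
    exact Finset.sum_congr rfl fun i _ => by ring
  have hFcont : Continuous F := continuous_iff_continuousAt.2 fun b => (hFd b).continuousAt
  obtain ⟨b, hb, hmin⟩ := (isCompact_closedBall β 1).exists_isMinOn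
    ⟨β, Metric.mem_closedBall_self zero_le_one⟩ hFcont.continuousOn
  have hb1 : ‖b - β‖ ≤ 1 := by rwa [← dist_eq_norm]
  -- First order condition at the constrained minimizer in the direction of the centre. With strong
  -- monotonicity it gives slope times squared distance at most `s` times distance, which excludes
  -- the sphere because `s` is less than the slope.
  have h1 := hmin.localize.hasFDerivWithinAt_nonneg (y := β - b) (hFd b).hasFDerivWithinAt
    (mem_posTangentConeAt_of_segment_subset
      ((convex_closedBall β 1).segment_subset hb (by
        simp)))
  rw [hFs] at h1
  have h2 := le_score_sub_dotProduct (a := a) hw hK hquad hb1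
  have h3 : score w x a b ⬝ᵥ (b - β) = -(score w x a b ⬝ᵥ (β - b)) := by
    rw [← dotProduct_neg, neg_sub]
  have hsb := abs_dotProduct_le (score w x a β) (b - β)
  rw [← hsdef] at hsb
  have h4 : Real.sigmoid (-K) ^ 2 * c' * ‖b - β‖ ^ 2 ≤ s * ‖b - β‖ := by
    linarith [le_abs_self (score w x a β ⬝ᵥ (b - β))]
  have h5 : ‖b - β‖ < 1 := by
    by_contra h
    have h6 : 1 ≤ ‖b - β‖ := not_lt.1 h
    rw [le_antisymm hb1 h6] at h4
    linarith
  have hloc : IsLocalMin F b := hmin.isLocalMin (Metric.closedBall_mem_nhds_of_mem (by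
    rw [Metric.mem_ball, dist_eq_norm]; exact h5))
  have h6 := hloc.hasFDerivAt_eq_zero (hFd b)
  refine ⟨b, funext fun k => ?_⟩
  have h7 := hFs b (Pi.single k 1)
  rw [h6] at h7
  simpa using h7.symm

end LogisticRoot

/-! ### Derivatives of the logistic loss -/

section Gradient

variable {𝓧 : Type*} {J d : ℕ} (ψ : 𝓧 → Fin d → ℝ)

/-- The functional `β ↦ x ⬝ᵥ β^j` of the stacked coefficient vector. -/
def blockDot (j : Fin J) (x : Fin d → ℝ) : (Fin J × Fin d → ℝ) →L[ℝ] ℝ :=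
  ∑ k, x k • ContinuousLinearMap.proj (j, k)

lemma blockDot_apply (j : Fin J) (x : Fin d → ℝ) (b : Fin J × Fin d → ℝ) :
    blockDot j x b = x ⬝ᵥ fun k => b (j, k) := by
  simp [blockDot, dotProduct]

lemma blockDot_single (j : Fin J) (x : Fin d → ℝ) (p : Fin J × Fin d) :
    blockDot j x (Pi.single p 1) = if j = p.1 then x p.2 else 0 := by
  rw [blockDot_apply, dotProduct]
  rcases p with ⟨j', k'⟩
  by_cases h : j = j'
  · subst h
    rw [Finset.sum_eq_single k']
    · simp
    · intro k _ hk
      simp [hk]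
    · simp
  · simp [h]

lemma lik_pos (x : 𝓧) (a : Bool) (β : Fin d → ℝ) : 0 < lik ψ x a β := by
  unfold lik eta
  split_ifs
  · exact Real.sigmoid_pos _
  · linarith [Real.sigmoid_lt_one (ψ x ⬝ᵥ β)]

lemma hasFDerivAt_loss (o : Obs 𝓧 J) (b : Fin J × Fin d → ℝ) :
    HasFDerivAt (loss ψ o) (-∑ j, (val (o.2.1 j) - Real.sigmoid (blockDot j (ψ o.1) b)) •
      blockDot j (ψ o.1)) b := by
  have h1 : loss ψ o = fun b => -∑ j, Real.log (if o.2.1 j then Real.sigmoid (blockDot j (ψ o.1) b)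
      else 1 - Real.sigmoid (blockDot j (ψ o.1) b)) := by
    funext b
    rw [loss, Real.log_prod fun j _ => (lik_pos ψ _ _ _).ne']
    simp only [lik, eta, blockDot_apply]
  rw [h1]
  refine (HasFDerivAt.fun_sum fun j _ => ?_).fun_neg
  exact (hasDerivAt_log_lik (o.2.1 j) _).comp_hasFDerivAt b (blockDot j (ψ o.1)).hasFDerivAt

lemma grad_loss (o : Obs 𝓧 J) (b : Fin J × Fin d → ℝ) (p : Fin J × Fin d) :
    grad (loss ψ o) b p =
      -((val (o.2.1 p.1) - eta ψ o.1 fun k => b (p.1, k)) * ψ o.1 p.2) := by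
  rw [grad, (hasFDerivAt_loss ψ o b).fderiv]
  simp only [neg_apply, sum_apply, smul_apply, blockDot_single, smul_eq_mul, mul_ite, mul_zero,
    Finset.sum_ite_eq', Finset.mem_univ, if_true]
  rw [blockDot_apply, eta]

lemma hess_loss (o : Obs 𝓧 J) (b : Fin J × Fin d → ℝ) (p p' : Fin J × Fin d) :
    hess (loss ψ o) b p p' = if p.1 = p'.1 then
      eta ψ o.1 (fun k => b (p.1, k)) * (1 - eta ψ o.1 fun k => b (p.1, k)) *
        (ψ o.1 p.2 * ψ o.1 p'.2) else 0 := by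
  have h1 : grad (loss ψ o) = fun b p =>
      -((val (o.2.1 p.1) - Real.sigmoid (blockDot p.1 (ψ o.1) b)) * ψ o.1 p.2) := by
    funext b p
    rw [grad_loss, eta, blockDot_apply]
  have h2 : HasFDerivAt (grad (loss ψ o)) (ContinuousLinearMap.pi fun p : Fin J × Fin d =>
      (ψ o.1 p.2 * (Real.sigmoid (blockDot p.1 (ψ o.1) b) *
        (1 - Real.sigmoid (blockDot p.1 (ψ o.1) b)))) • blockDot p.1 (ψ o.1)) b := by
    rw [h1, hasFDerivAt_pi]
    intro p
    have h3 := (Real.hasDerivAt_sigmoid (blockDot p.1 (ψ o.1) b)).comp_hasFDerivAt b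
      (blockDot p.1 (ψ o.1)).hasFDerivAt
    have h4 := ((h3.const_sub (val (o.2.1 p.1))).mul_const (ψ o.1 p.2)).fun_neg
    convert! h4 using 1
    ext v
    simp only [smul_apply, smul_eq_mul, neg_apply]
    ring
  rw [hess, jacobian, Matrix.of_apply, h2.fderiv]
  simp only [ContinuousLinearMap.coe_pi', smul_apply, blockDot_single, smul_eq_mul]
  simp only [eta, blockDot_apply]
  split_ifs <;> ring

end Gradient

/-! ### Second order expansion of the estimating functions -/

section Jacobian

variable {ι κ : Type*} [Fintype ι] [DecidableEq ι] [Fintype κ]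

/-- A function with a second order expansion is differentiable, and its Jacobian matrix is the
matrix of the expansion. -/
lemma hasFDerivAt_of_quadratic_bound {F : (ι → ℝ) → κ → ℝ} {x : ι → ℝ} {A : Matrix κ ι ℝ}
    {M δ : ℝ} (hδ : 0 < δ)
    (h : ∀ e : ι → ℝ, ‖e‖ ≤ δ → ∀ r, |F (x + e) r - F x r - A.mulVec e r| ≤ M * ‖e‖ ^ 2) :
    HasFDerivAt F A.mulVecLin.toContinuousLinearMap x := by
  rw [hasFDerivAt_iff_isLittleO_nhds_zero, Asymptotics.isLittleO_iff]
  intro c hc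
  have h1 : ∀ᶠ e : ι → ℝ in 𝓝 0, ‖e‖ ≤ min δ (c / (|M| + 1)) := by
    have : Metric.closedBall (0 : ι → ℝ) (min δ (c / (|M| + 1))) ∈ 𝓝 0 :=
      Metric.closedBall_mem_nhds _ (by positivity)
    filter_upwards [this] with e he
    simpa using he
  filter_upwards [h1] with e he
  rw [pi_norm_le_iff_of_nonneg (by positivity)]
  intro r
  have h2 := h e (he.trans (min_le_left _ _)) r
  refine h2.trans ?_
  have h3 : ‖e‖ ≤ c / (|M| + 1) := he.trans (min_le_right _ _)
  rw [le_div_iff₀ (by positivity)] at h3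
  calc M * ‖e‖ ^ 2 ≤ (|M| + 1) * ‖e‖ ^ 2 :=
        mul_le_mul_of_nonneg_right (by linarith [le_abs_self M]) (sq_nonneg _)
    _ = (‖e‖ * (|M| + 1)) * ‖e‖ := by ring
    _ ≤ c * ‖e‖ := mul_le_mul_of_nonneg_right h3 (norm_nonneg _)

lemma jacobian_eq_of_quadratic_bound {F : (ι → ℝ) → κ → ℝ} {x : ι → ℝ} {A : Matrix κ ι ℝ}
    {M δ : ℝ} (hδ : 0 < δ)
    (h : ∀ e : ι → ℝ, ‖e‖ ≤ δ → ∀ r, |F (x + e) r - F x r - A.mulVec e r| ≤ M * ‖e‖ ^ 2) :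
    jacobian F x = A := by
  ext r c
  rw [jacobian, Matrix.of_apply, (hasFDerivAt_of_quadratic_bound hδ h).fderiv]
  simp

end Jacobian

section EstFun

variable {𝓧 : Type*} {J d : ℕ} (ψ : 𝓧 → Fin d → ℝ)

/-- Inverse logistic propensities are `1 + exp (∓ψᵀβ)`. In this form the weights are smooth and at
least one, and no division remains to be controlled. -/
lemma div_eta (c : ℝ) (x : 𝓧) (β : Fin d → ℝ) :
    c / eta ψ x β = c * (1 + Real.exp (-(ψ x ⬝ᵥ β))) := by
  rw [div_eq_mul_inv, eta, inv_sigmoid]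

lemma div_one_sub_eta (c : ℝ) (x : 𝓧) (β : Fin d → ℝ) :
    c / (1 - eta ψ x β) = c * (1 + Real.exp (ψ x ⬝ᵥ β)) := by
  rw [div_eq_mul_inv, eta, inv_one_sub_sigmoid]

lemma estFun_inl_zero (j : Fin J) (o : Obs 𝓧 J) (γ : Fin 2 ⊕ Fin d → ℝ) :
    estFun ψ j o γ (Sum.inl 0) = val (o.2.1 j) * (o.2.2 - γ (Sum.inl 0)) *
      (1 + Real.exp (-(ψ o.1 ⬝ᵥ (γ ∘ Sum.inr)))) := by
  simp only [estFun, Sum.elim_inl, Matrix.cons_val_zero, div_eta]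
  ring

lemma estFun_inl_one (j : Fin J) (o : Obs 𝓧 J) (γ : Fin 2 ⊕ Fin d → ℝ) :
    estFun ψ j o γ (Sum.inl 1) = (1 - val (o.2.1 j)) * (o.2.2 - γ (Sum.inl 1)) *
      (1 + Real.exp (ψ o.1 ⬝ᵥ (γ ∘ Sum.inr))) := by
  simp only [estFun, Sum.elim_inl, Matrix.cons_val_one, div_one_sub_eta, Matrix.cons_val_fin_one]
  ring

lemma estFun_inr (j : Fin J) (o : Obs 𝓧 J) (γ : Fin 2 ⊕ Fin d → ℝ) (k : Fin d) :
    estFun ψ j o γ (Sum.inr k) =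
      (val (o.2.1 j) - Real.sigmoid (ψ o.1 ⬝ᵥ (γ ∘ Sum.inr))) * ψ o.1 k := rfl

/-- The Jacobian matrix of `estFun ψ j o`. -/
def estJac (j : Fin J) (o : Obs 𝓧 J) (γ : Fin 2 ⊕ Fin d → ℝ) :
    Matrix (Fin 2 ⊕ Fin d) (Fin 2 ⊕ Fin d) ℝ :=
  let t := ψ o.1 ⬝ᵥ (γ ∘ Sum.inr)
  let a := val (o.2.1 j)
  Matrix.fromBlocks
    !![-(a * (1 + Real.exp (-t))), 0; 0, -((1 - a) * (1 + Real.exp t))]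
    (Matrix.of ![fun l => -(a * (o.2.2 - γ (Sum.inl 0)) * (Real.exp (-t) * ψ o.1 l)),
      fun l => (1 - a) * (o.2.2 - γ (Sum.inl 1)) * (Real.exp t * ψ o.1 l)])
    0
    (Matrix.of fun k l => -(Real.sigmoid t * (1 - Real.sigmoid t) * (ψ o.1 k * ψ o.1 l)))

lemma estJac_mulVec_inl_zero (j : Fin J) (o : Obs 𝓧 J) (γ e : Fin 2 ⊕ Fin d → ℝ) :
    (estJac ψ j o γ).mulVec e (Sum.inl 0) =
      -(val (o.2.1 j) * (1 + Real.exp (-(ψ o.1 ⬝ᵥ (γ ∘ Sum.inr))))) * e (Sum.inl 0) -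
      val (o.2.1 j) * (o.2.2 - γ (Sum.inl 0)) * Real.exp (-(ψ o.1 ⬝ᵥ (γ ∘ Sum.inr))) *
        (ψ o.1 ⬝ᵥ (e ∘ Sum.inr)) := by
  simp only [estJac, Matrix.mulVec, dotProduct, Fintype.sum_sum_type, Matrix.fromBlocks_apply₁₁,
    Matrix.fromBlocks_apply₁₂, Fin.sum_univ_two, Matrix.of_apply, Matrix.cons_val_zero,
    Matrix.cons_val_one, Matrix.cons_val_fin_one, Function.comp_apply, zero_mul, add_zero,
    Finset.mul_sum, sub_eq_add_neg, ← Finset.sum_neg_distrib]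
  congr 1
  exact Finset.sum_congr rfl fun k _ => by ring

lemma estJac_mulVec_inl_one (j : Fin J) (o : Obs 𝓧 J) (γ e : Fin 2 ⊕ Fin d → ℝ) :
    (estJac ψ j o γ).mulVec e (Sum.inl 1) =
      -((1 - val (o.2.1 j)) * (1 + Real.exp (ψ o.1 ⬝ᵥ (γ ∘ Sum.inr)))) * e (Sum.inl 1) +
      (1 - val (o.2.1 j)) * (o.2.2 - γ (Sum.inl 1)) * Real.exp (ψ o.1 ⬝ᵥ (γ ∘ Sum.inr)) *
        (ψ o.1 ⬝ᵥ (e ∘ Sum.inr)) := by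
  simp only [estJac, Matrix.mulVec, dotProduct, Fintype.sum_sum_type, Matrix.fromBlocks_apply₁₁,
    Matrix.fromBlocks_apply₁₂, Fin.sum_univ_two, Matrix.of_apply, Matrix.cons_val_zero,
    Matrix.cons_val_one, Matrix.cons_val_fin_one, Function.comp_apply, zero_mul, zero_add,
    Finset.mul_sum]
  congr 1
  exact Finset.sum_congr rfl fun k _ => by ring

lemma estJac_mulVec_inr (j : Fin J) (o : Obs 𝓧 J) (γ e : Fin 2 ⊕ Fin d → ℝ) (k : Fin d) :
    (estJac ψ j o γ).mulVec e (Sum.inr k) =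
      -(Real.sigmoid (ψ o.1 ⬝ᵥ (γ ∘ Sum.inr)) * (1 - Real.sigmoid (ψ o.1 ⬝ᵥ (γ ∘ Sum.inr))) *
        (ψ o.1 ⬝ᵥ (e ∘ Sum.inr)) * ψ o.1 k) := by
  simp only [estJac, Matrix.mulVec, dotProduct, Fintype.sum_sum_type, Matrix.fromBlocks_apply₂₁,
    Matrix.fromBlocks_apply₂₂, Matrix.zero_apply, zero_mul, Finset.sum_const_zero, zero_add,
    Matrix.of_apply, Function.comp_apply, Finset.mul_sum, Finset.sum_mul, ← Finset.sum_neg_distrib]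
  exact Finset.sum_congr rfl fun l _ => by ring

/-- The envelope of the second order remainder of `estFun ψ j o`. -/
def estEnv (j : Fin J) (o : Obs 𝓧 J) (γ : Fin 2 ⊕ Fin d → ℝ) : ℝ :=
  (∑ k, |ψ o.1 k|) ^ 3 + Real.exp |ψ o.1 ⬝ᵥ (γ ∘ Sum.inr)| *
    ((|val (o.2.1 j) * (o.2.2 - γ (Sum.inl 0))| + |(1 - val (o.2.1 j)) * (o.2.2 - γ (Sum.inl 1))|) *
      (∑ k, |ψ o.1 k|) ^ 2 + 2 * ∑ k, |ψ o.1 k|)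

lemma estEnv_nonneg (j : Fin J) (o : Obs 𝓧 J) (γ : Fin 2 ⊕ Fin d → ℝ) : 0 ≤ estEnv ψ j o γ := by
  have : 0 ≤ ∑ k, |ψ o.1 k| := Finset.sum_nonneg fun _ _ => abs_nonneg _
  unfold estEnv
  positivity

/-- The remainder factors as `E (a y (exp s - 1 - s) - a δ (exp s - 1))`, and for `|s| ≤ 1` the two
brackets are at most `s²` and `2 |s|` in modulus. -/
lemma weighted_taylor_bound {a y δ E s : ℝ} (ha : |a| ≤ 1) (hE : 0 ≤ E) (hs : |s| ≤ 1) :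
    |a * (y - δ) * (1 + E * Real.exp s) - a * y * (1 + E) -
      (-(a * (1 + E)) * δ + a * y * E * s)| ≤ E * (|a * y| * s ^ 2 + 2 * (|δ| * |s|)) := by
  have h1 := Real.abs_exp_sub_one_sub_id_le hs
  have h2 := Real.abs_exp_sub_one_le hs
  have heq : a * (y - δ) * (1 + E * Real.exp s) - a * y * (1 + E) -
      (-(a * (1 + E)) * δ + a * y * E * s) =
      E * (a * y * (Real.exp s - 1 - s) - a * δ * (Real.exp s - 1)) := by ring
  rw [heq, abs_mul, abs_of_nonneg hE]
  refine mul_le_mul_of_nonneg_left ((abs_sub _ _).trans (add_le_add ?_ ?_)) hE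
  · rw [abs_mul]; exact mul_le_mul_of_nonneg_left h1 (abs_nonneg _)
  · rw [abs_mul, abs_mul]
    calc |a| * |δ| * |Real.exp s - 1| ≤ 1 * |δ| * (2 * |s|) :=
          mul_le_mul (mul_le_mul_of_nonneg_right ha (abs_nonneg _)) h2 (abs_nonneg _) (by positivity)
      _ = 2 * (|δ| * |s|) := by ring

/-- The condition `he` keeps the change of the linear predictor within `[-1, 1]`. Then the two
weighted components follow from `weighted_taylor_bound` and the score components from the expansion
of the sigmoid. -/
lemma abs_estFun_sub_le (j : Fin J) (o : Obs 𝓧 J) (γ e : Fin 2 ⊕ Fin d → ℝ)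
    (he : (∑ k, |ψ o.1 k|) * ‖e‖ ≤ 1) (r : Fin 2 ⊕ Fin d) :
    |estFun ψ j o (γ + e) r - estFun ψ j o γ r - (estJac ψ j o γ).mulVec e r| ≤
      estEnv ψ j o γ * ‖e‖ ^ 2 := by
  set B := ∑ k, |ψ o.1 k| with hB
  set t := ψ o.1 ⬝ᵥ (γ ∘ Sum.inr) with ht
  set s := ψ o.1 ⬝ᵥ (e ∘ Sum.inr) with hs
  have hB0 : 0 ≤ B := Finset.sum_nonneg fun _ _ => abs_nonneg _
  have hts : ψ o.1 ⬝ᵥ ((γ + e) ∘ Sum.inr) = t + s := by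
    rw [ht, hs, ← dotProduct_add]; rfl
  have hsB : |s| ≤ B * ‖e‖ := by
    refine (abs_dotProduct_le _ _).trans (mul_le_mul_of_nonneg_left ?_ hB0)
    exact (pi_norm_le_iff_of_nonneg (norm_nonneg _)).2 fun k => norm_le_pi_norm e (Sum.inr k)
  have hs1 : |s| ≤ 1 := hsB.trans he
  have hs2 : s ^ 2 ≤ B ^ 2 * ‖e‖ ^ 2 := by
    rw [← sq_abs, ← mul_pow]; exact pow_le_pow_left₀ (abs_nonneg _) hsB 2
  have hδ : ∀ i, |e i| ≤ ‖e‖ := fun i => norm_le_pi_norm e i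
  have key : ∀ (a y δ E u : ℝ), |a| ≤ 1 → 0 ≤ E → E ≤ Real.exp |t| → |u| = |s| → |δ| ≤ ‖e‖ →
      |a * (y - δ) * (1 + E * Real.exp u) - a * y * (1 + E) -
      (-(a * (1 + E)) * δ + a * y * E * u)| ≤ Real.exp |t| * (|a * y| * B ^ 2 + 2 * B) * ‖e‖ ^ 2 := by
    intro a y δ E u ha hE hEt hu hδ
    refine (weighted_taylor_bound ha hE (by rw [hu]; exact hs1)).trans ?_
    have h1 : u ^ 2 ≤ B ^ 2 * ‖e‖ ^ 2 := by rwa [← sq_abs, hu, sq_abs]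
    have h2 : |δ| * |u| ≤ ‖e‖ * (B * ‖e‖) := by
      rw [hu]; exact mul_le_mul hδ hsB (abs_nonneg _) (norm_nonneg _)
    calc E * (|a * y| * u ^ 2 + 2 * (|δ| * |u|))
        ≤ Real.exp |t| * (|a * y| * (B ^ 2 * ‖e‖ ^ 2) + 2 * (‖e‖ * (B * ‖e‖))) := by
          refine mul_le_mul hEt (add_le_add ?_ ?_) (by positivity) (Real.exp_pos _).le
          · exact mul_le_mul_of_nonneg_left h1 (abs_nonneg _)
          · linarith
      _ = _ := by ring
  have henv : ∀ c : ℝ, c ≤ B ^ 3 ∨ c ≤ Real.exp |t| *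
      (|val (o.2.1 j) * (o.2.2 - γ (Sum.inl 0))| * B ^ 2 + 2 * B) ∨ c ≤ Real.exp |t| *
      (|(1 - val (o.2.1 j)) * (o.2.2 - γ (Sum.inl 1))| * B ^ 2 + 2 * B) →
      c * ‖e‖ ^ 2 ≤ estEnv ψ j o γ * ‖e‖ ^ 2 := by
    intro c hc
    refine mul_le_mul_of_nonneg_right ?_ (sq_nonneg _)
    unfold estEnv
    rw [← hB, ← ht]
    have e1 : 0 ≤ B ^ 3 := by positivity
    have e2 : 0 ≤ Real.exp |t| * (|val (o.2.1 j) * (o.2.2 - γ (Sum.inl 0))| * B ^ 2) := by positivity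
    have e3 : 0 ≤ Real.exp |t| * (|(1 - val (o.2.1 j)) * (o.2.2 - γ (Sum.inl 1))| * B ^ 2) := by
      positivity
    have e4 : 0 ≤ Real.exp |t| * (2 * B) := by positivity
    rcases hc with h | h | h <;> nlinarith
  have ha0 := abs_val_le (o.2.1 j)
  have ha1 : |1 - val (o.2.1 j)| ≤ 1 := by cases o.2.1 j <;> simp
  rcases r with i | k
  · fin_cases i
    · simp only [Fin.zero_eta, Fin.isValue]
      rw [estFun_inl_zero, estFun_inl_zero, estJac_mulVec_inl_zero, hts, ← ht, ← hs]
      refine le_trans (le_of_eq ?_) ((key (val (o.2.1 j)) (o.2.2 - γ (Sum.inl 0)) (e (Sum.inl 0))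
        (Real.exp (-t)) (-s) ha0 (Real.exp_pos _).le (Real.exp_le_exp.2 (neg_le_abs t)) (abs_neg s)
        (hδ _)).trans (henv _ (Or.inr (Or.inl le_rfl))))
      congr 1
      rw [Pi.add_apply, neg_add, Real.exp_add]
      ring
    · simp only [Fin.mk_one, Fin.isValue]
      rw [estFun_inl_one, estFun_inl_one, estJac_mulVec_inl_one, hts, ← ht, ← hs]
      refine le_trans (le_of_eq ?_) ((key (1 - val (o.2.1 j)) (o.2.2 - γ (Sum.inl 1)) (e (Sum.inl 1))
        (Real.exp t) s ha1 (Real.exp_pos _).le (Real.exp_le_exp.2 (le_abs_self t)) rfl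
        (hδ _)).trans (henv _ (Or.inr (Or.inr le_rfl))))
      congr 1
      rw [Pi.add_apply, Real.exp_add]
      ring
  · rw [estFun_inr, estFun_inr, estJac_mulVec_inr, hts, ← ht, ← hs]
    refine le_trans ?_ (henv _ (Or.inl le_rfl))
    have h1 := abs_sigmoid_taylor_le t s
    have h2 : |ψ o.1 k| ≤ B := Finset.single_le_sum (f := fun k => |ψ o.1 k|)
      (fun _ _ => abs_nonneg _) (Finset.mem_univ k)
    have h3 : (val (o.2.1 j) - Real.sigmoid (t + s)) * ψ o.1 k -
        (val (o.2.1 j) - Real.sigmoid t) * ψ o.1 k -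
        -(Real.sigmoid t * (1 - Real.sigmoid t) * s * ψ o.1 k) =
        -((Real.sigmoid (t + s) - Real.sigmoid t - Real.sigmoid t * (1 - Real.sigmoid t) * s) *
          ψ o.1 k) := by ring
    rw [h3, abs_neg, abs_mul]
    calc _ ≤ (B ^ 2 * ‖e‖ ^ 2) * B := mul_le_mul (h1.trans hs2) h2 (abs_nonneg _) (by positivity)
      _ = B ^ 3 * ‖e‖ ^ 2 := by ring

lemma jacobian_estFun (j : Fin J) (o : Obs 𝓧 J) (γ : Fin 2 ⊕ Fin d → ℝ) :
    jacobian (estFun ψ j o) γ = estJac ψ j o γ := by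
  have hB0 : 0 ≤ ∑ k, |ψ o.1 k| := Finset.sum_nonneg fun _ _ => abs_nonneg _
  refine jacobian_eq_of_quadratic_bound (δ := (1 + ∑ k, |ψ o.1 k|)⁻¹) (M := estEnv ψ j o γ)
    (by positivity) fun e he r => abs_estFun_sub_le ψ j o γ e ?_ r
  rw [← one_div, le_div_iff₀ (by positivity)] at he
  nlinarith [norm_nonneg e]

/-- The Jacobian matrix of the stacked estimating function. -/
def stackedJac (o : Obs 𝓧 J) (γ : Fin J × (Fin 2 ⊕ Fin d) → ℝ) :
    Matrix (Fin J × (Fin 2 ⊕ Fin d)) (Fin J × (Fin 2 ⊕ Fin d)) ℝ :=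
  Matrix.of fun p p' => if p.1 = p'.1 then estJac ψ p.1 o (fun r => γ (p.1, r)) p.2 p'.2 else 0

lemma blockMatrix_mulVec {κ : Type*} [Fintype κ] (A : Fin J → Matrix κ κ ℝ) (e : Fin J × κ → ℝ)
    (p : Fin J × κ) :
    (Matrix.of fun p p' : Fin J × κ => if p.1 = p'.1 then A p.1 p.2 p'.2 else 0).mulVec e p =
      (A p.1).mulVec (fun r => e (p.1, r)) p.2 := by
  simp only [Matrix.mulVec, dotProduct, Matrix.of_apply, Fintype.sum_prod_type, ite_mul, zero_mul]
  rw [Finset.sum_eq_single p.1]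
  · simp
  · intro j _ hj
    simp [hj.symm]
  · simp

lemma norm_block_le {κ : Type*} [Fintype κ] (e : Fin J × κ → ℝ) (j : Fin J) :
    ‖fun r => e (j, r)‖ ≤ ‖e‖ :=
  (pi_norm_le_iff_of_nonneg (norm_nonneg _)).2 fun r => norm_le_pi_norm e (j, r)

lemma abs_stackedEstFun_sub_le (o : Obs 𝓧 J) (γ e : Fin J × (Fin 2 ⊕ Fin d) → ℝ)
    (he : (∑ k, |ψ o.1 k|) * ‖e‖ ≤ 1) (p : Fin J × (Fin 2 ⊕ Fin d)) :
    |stackedEstFun ψ o (γ + e) p - stackedEstFun ψ o γ p - (stackedJac ψ o γ).mulVec e p| ≤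
      (∑ j, estEnv ψ j o fun r => γ (j, r)) * ‖e‖ ^ 2 := by
  have hB0 : 0 ≤ ∑ k, |ψ o.1 k| := Finset.sum_nonneg fun _ _ => abs_nonneg _
  have hn := norm_block_le e p.1
  rw [stackedJac, blockMatrix_mulVec fun j => estJac ψ j o fun r => γ (j, r)]
  refine (abs_estFun_sub_le ψ p.1 o (fun r => γ (p.1, r)) (fun r => e (p.1, r))
    ((mul_le_mul_of_nonneg_left hn hB0).trans he) p.2).trans ?_
  refine mul_le_mul ?_ (pow_le_pow_left₀ (norm_nonneg _) hn 2) (sq_nonneg _)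
    (Finset.sum_nonneg fun j _ => estEnv_nonneg _ _ _ _)
  exact Finset.single_le_sum (f := fun j => estEnv ψ j o fun r => γ (j, r))
    (fun j _ => estEnv_nonneg _ _ _ _) (Finset.mem_univ p.1)

lemma jacobian_stackedEstFun (o : Obs 𝓧 J) (γ : Fin J × (Fin 2 ⊕ Fin d) → ℝ) :
    jacobian (stackedEstFun ψ o) γ = stackedJac ψ o γ := by
  have hB0 : 0 ≤ ∑ k, |ψ o.1 k| := Finset.sum_nonneg fun _ _ => abs_nonneg _
  refine jacobian_eq_of_quadratic_bound (δ := (1 + ∑ k, |ψ o.1 k|)⁻¹)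
    (M := ∑ j, estEnv ψ j o fun r => γ (j, r))
    (by positivity) fun e he r => abs_stackedEstFun_sub_le ψ o γ e ?_ r
  rw [← one_div, le_div_iff₀ (by positivity)] at he
  nlinarith [norm_nonneg e]

/-- A block diagonal matrix acts separately on each block, so it is injective when every block is.
-/
lemma det_blockMatrix_ne_zero {κ : Type*} [Fintype κ] [DecidableEq κ] (A : Fin J → Matrix κ κ ℝ)
    (hA : ∀ j, IsUnit (A j).det) :
    IsUnit (Matrix.of fun p p' : Fin J × κ => if p.1 = p'.1 then A p.1 p.2 p'.2 else 0).det := by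
  rw [← Matrix.isUnit_iff_isUnit_det, ← Matrix.mulVec_injective_iff_isUnit]
  intro u v huv
  funext p
  have h1 : (A p.1).mulVec (fun r => u (p.1, r)) = (A p.1).mulVec (fun r => v (p.1, r)) := by
    funext r
    have := congrFun huv (p.1, r)
    rwa [blockMatrix_mulVec, blockMatrix_mulVec] at this
  have h2 := Matrix.mulVec_injective_iff_isUnit.2 ((Matrix.isUnit_iff_isUnit_det _).2 (hA p.1)) h1
  exact congrFun h2 p.2

end EstFun

/-! ### Second moments and concentration for independent samples -/

section Iid

variable {Ω Z I : Type*} [Fintype I] {mΩ : MeasurableSpace Ω} {P : Measure Ω}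
  [IsProbabilityMeasure P] [MeasurableSpace Z] {μ : Measure Z} [IsProbabilityMeasure μ]
  {x : Ω → I → Z} (hx : MeasurePreserving x P (Measure.pi fun _ => μ))

include hx

lemma measurePreserving_coord (i : I) : MeasurePreserving (fun ω => x ω i) P μ :=
  (measurePreserving_eval (fun _ => μ) i).comp hx

lemma ae_forall_coord {p : Z → Prop} (hp : ∀ᵐ z ∂μ, p z) : ∀ᵐ ω ∂P, ∀ i, p (x ω i) :=
  ae_all_iff.2 fun i => (measurePreserving_coord hx i).quasiMeasurePreserving.ae hp

lemma integrable_coord {g : Z → ℝ} (hg : Integrable g μ) (i : I) :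
    Integrable (fun ω => g (x ω i)) P :=
  (measurePreserving_coord hx i).integrable_comp_of_integrable hg

lemma integral_coord {g : Z → ℝ} (hg : Integrable g μ) (i : I) :
    ∫ ω, g (x ω i) ∂P = ∫ z, g z ∂μ := by
  have h := measurePreserving_coord hx i
  rw [← h.map_eq, integral_map h.aemeasurable (by rw [h.map_eq]; exact hg.aestronglyMeasurable)]

lemma integrable_sum_coord {g : Z → ℝ} (hg : Integrable g μ) :
    Integrable (fun ω => ∑ i, g (x ω i)) P :=
  integrable_finsetSum _ fun i _ => integrable_coord hx hg i

lemma integral_sum_coord {g : Z → ℝ} (hg : Integrable g μ) :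
    ∫ ω, ∑ i, g (x ω i) ∂P = Fintype.card I * ∫ z, g z ∂μ := by
  rw [integral_finsetSum _ fun i _ => integrable_coord hx hg i]
  simp [integral_coord hx hg]

lemma memLp_sum_coord {g : Z → ℝ} (hg : MemLp g 2 μ) : MemLp (fun ω => ∑ i, g (x ω i)) 2 P :=
  memLp_finsetSum _ fun i _ => hg.comp_measurePreserving (measurePreserving_coord hx i)

lemma integral_sq_sum_coord {g : Z → ℝ} (hg : MemLp g 2 μ) (h0 : ∫ z, g z ∂μ = 0) :
    ∫ ω, (∑ i, g (x ω i)) ^ 2 ∂P = Fintype.card I * ∫ z, g z ^ 2 ∂μ := by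
  have hm := memLp_sum_coord hx hg
  have hi : ∫ ω, ∑ i, g (x ω i) ∂P = 0 := by
    rw [integral_sum_coord hx (hg.integrable (by norm_num)), h0, mul_zero]
  have hsm : AEStronglyMeasurable (fun y : I → Z => ∑ i, g (y i)) (Measure.pi fun _ => μ) :=
    (memLp_finsetSum (p := 2) Finset.univ fun i _ =>
      hg.comp_measurePreserving (measurePreserving_eval (fun _ => μ) i)).1
  have h1 := variance_sum_pi (μ := fun _ : I => μ) (X := fun _ => g) fun _ => hg
  rw [← variance_of_integral_eq_zero hm.1.aemeasurable hi]
  have h2 : Var[fun ω => ∑ i, g (x ω i); P] =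
      Var[fun y : I → Z => ∑ i, g (y i); Measure.pi fun _ => μ] := by
    rw [← hx.map_eq, variance_map (by rw [hx.map_eq]; exact hsm.aemeasurable) hx.aemeasurable]
    rfl
  have h3 : (∑ i, fun y : I → Z => g (y i)) = fun y => ∑ i, g (y i) := by
    ext y; simp
  rw [h2, ← h3, h1, variance_of_integral_eq_zero hg.1.aemeasurable h0]
  simp

/-- Hoeffding: a variable with values in `[-C, C]` is, once centred, sub-Gaussian with parameter
`C²`, and parameters of independent variables add. -/
lemma measureReal_le_sum_coord {g : Z → ℝ} (hg : Measurable g) {C : ℝ}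
    (hC : ∀ᵐ z ∂μ, |g z| ≤ C) {t : ℝ} (ht : 0 ≤ t) :
    P.real {ω | t ≤ ∑ i, (g (x ω i) - ∫ z, g z ∂μ)} ≤
      Real.exp (-t ^ 2 / (2 * (Fintype.card I * C ^ 2))) := by
  have hind : iIndepFun (fun i ω => g (x ω i) - ∫ z, g z ∂μ) P := by
    have h0 : iIndepFun (fun i ω => x ω i) P := by
      rw [iIndepFun_iff_map_fun_eq_pi_map
        fun i => (measurePreserving_coord hx i).aemeasurable]
      refine hx.map_eq.trans ?_
      congr 1
      funext i
      exact (measurePreserving_coord hx i).map_eq.symm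
    exact h0.comp (fun _ z => g z - ∫ z, g z ∂μ) fun _ => hg.sub_const _
  have hsub : ∀ i, HasSubgaussianMGF (fun ω => g (x ω i) - ∫ z, g z ∂μ) ((‖C - -C‖₊ / 2) ^ 2) P := by
    intro i
    have hm := measurePreserving_coord hx i
    have h1 := hasSubgaussianMGF_of_mem_Icc (μ := P) (X := fun ω => g (x ω i)) (a := -C) (b := C)
      (hg.comp hm.measurable).aemeasurable
      ((hm.quasiMeasurePreserving.ae hC).mono fun ω h => abs_le.1 h)
    have h2 : ∫ ω, g (x ω i) ∂P = ∫ z, g z ∂μ := by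
      rw [← hm.map_eq, integral_map hm.aemeasurable hg.aestronglyMeasurable]
    rwa [h2] at h1
  refine (HasSubgaussianMGF.measure_sum_ge_le_of_iIndepFun hind (s := Finset.univ)
    (fun i _ => hsub i) ht).trans (le_of_eq ?_)
  congr 3
  simp [div_pow]
  left
  rw [← two_mul, mul_pow]
  ring

/-- A two-sided Hoeffding inequality. -/
lemma measureReal_le_abs_sum_coord {g : Z → ℝ} (hg : Measurable g) {C : ℝ}
    (hC : ∀ᵐ z ∂μ, |g z| ≤ C) {t : ℝ} (ht : 0 ≤ t) :
    P.real {ω | t ≤ |∑ i, (g (x ω i) - ∫ z, g z ∂μ)|} ≤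
      2 * Real.exp (-t ^ 2 / (2 * (Fintype.card I * C ^ 2))) := by
  have h1 := measureReal_le_sum_coord hx hg hC ht
  have h2 := measureReal_le_sum_coord hx hg.neg (C := C) (by simpa using hC) ht
  have h3 : {ω | t ≤ |∑ i, (g (x ω i) - ∫ z, g z ∂μ)|} ⊆
      {ω | t ≤ ∑ i, (g (x ω i) - ∫ z, g z ∂μ)} ∪
        {ω | t ≤ ∑ i, ((-g) (x ω i) - ∫ z, (-g) z ∂μ)} := by
    intro ω hω
    have hω' : t ≤ |∑ i, (g (x ω i) - ∫ z, g z ∂μ)| := hω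
    rcases le_abs.1 hω' with h | h
    · exact Or.inl h
    · refine Or.inr ?_
      have : ∑ i, ((-g) (x ω i) - ∫ z, (-g) z ∂μ) = -∑ i, (g (x ω i) - ∫ z, g z ∂μ) := by
        rw [← Finset.sum_neg_distrib]
        refine Finset.sum_congr rfl fun i _ => ?_
        simp only [Pi.neg_apply, integral_neg]
        ring
      show t ≤ _
      rwa [this]
  calc _ ≤ _ := measureReal_mono h3
    _ ≤ _ := measureReal_union_le _ _
    _ ≤ _ := by rw [two_mul]; exact add_le_add h1 h2

end Iid

/-! ### Empirical means over the observational units -/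

section Empirical

variable {Ω 𝓧 𝓤 : Type*} {J : ℕ} [mΩ : MeasurableSpace Ω] [MeasurableSpace 𝓧] [MeasurableSpace 𝓤]
  {P : Measure Ω} [IsProbabilityMeasure P]
  {Q : Measure (UnitRec 𝓧 𝓤 J)} [IsProbabilityMeasure Q] {f : 𝓧 × 𝓤 → Fin J → Bool}
  {D : Rounds Ω 𝓧 𝓤 J} {ℱ : Filtration ℕ mΩ}

lemma measurable_observe (hf : Measurable f) : Measurable (observe f : UnitRec 𝓧 𝓤 J → Obs 𝓧 J) := by
  have h1 : Measurable fun z : UnitRec 𝓧 𝓤 J => f (z.1, z.2.1) := by fun_prop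
  exact measurable_fst.prodMk (h1.prodMk (measurable_eval_apply.comp (h1.prodMk (by fun_prop))))

lemma isProbabilityMeasure_obsLaw (hf : Measurable f) : IsProbabilityMeasure (obsLaw Q f) :=
  Measure.isProbabilityMeasure_map (measurable_observe hf).aemeasurable

lemma measurePreserving_observe (hf : Measurable f) :
    MeasurePreserving (observe f) Q (obsLaw Q f) := ⟨measurable_observe hf, rfl⟩

lemma integral_observe (hf : Measurable f) {g : Obs 𝓧 J → ℝ} (hg : Measurable g) :
    ∫ z, g (observe f z) ∂Q = ∫ o, g o ∂(obsLaw Q f) :=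
  (integral_map (measurable_observe hf).aemeasurable hg.aestronglyMeasurable).symm

namespace Rounds

/-- The observed triples of the first `m` rounds. -/
def sample (D : Rounds Ω 𝓧 𝓤 J) (f : 𝓧 × 𝓤 → Fin J → Bool) (m : ℕ) (ω : Ω)
    (p : Σ ν : Fin m, Fin (D.N ν)) : Obs 𝓧 J := observe f (D.obs p.1 p.2 ω)

lemma empMean_eq (m : ℕ) (ω : Ω) (g : Obs 𝓧 J → ℝ) :
    D.empMean f m ω g = (D.Nbar m)⁻¹ * ∑ p, g (D.sample f m ω p) := by
  rw [empMean, Finset.sum_range fun ν => ∑ i : Fin (D.N ν), g (observe f (D.obs ν i ω)),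
    ← Fintype.sum_sigma' (fun (ν : Fin m) (i : Fin (D.N ν)) => g (observe f (D.obs ν i ω)))]
  rfl

lemma empMean_eq_unitSum (m : ℕ) (ω : Ω) (g : Obs 𝓧 J → ℝ) :
    D.empMean f m ω g = (D.Nbar m)⁻¹ * D.unitSum (fun z => g (observe f z)) m ω := rfl

lemma card_sample (D : Rounds Ω 𝓧 𝓤 J) (m : ℕ) :
    (Fintype.card (Σ ν : Fin m, Fin (D.N ν)) : ℝ) = D.Nbar m := by
  rw [Fintype.card_sigma, Nbar, Finset.sum_range fun ν => (D.N ν : ℝ)]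
  simp

lemma measurePreserving_sample (hD : D.IsSampled P ℱ Q) (hf : Measurable f) (m : ℕ) :
    MeasurePreserving (D.sample f m) P (Measure.pi fun _ => obsLaw Q f) := by
  have := isProbabilityMeasure_obsLaw (Q := Q) hf
  have h1 : MeasurePreserving (fun ω (p : Σ ν : Fin m, Fin (D.N ν)) => D.obs p.1 p.2 ω) P
      (Measure.pi fun _ => Q) :=
    ⟨measurable_pi_lambda _ fun p => hD.measurable_obs _ _, hD.map_obs m⟩
  exact (measurePreserving_pi (fun _ : Σ ν : Fin m, Fin (D.N ν) => Q) (fun _ => obsLaw Q f)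
    fun _ => measurePreserving_observe hf).comp h1

lemma measurable_empMean (hD : D.IsSampled P ℱ Q) (hf : Measurable f) {g : Obs 𝓧 J → ℝ}
    (hg : Measurable g) (m : ℕ) : Measurable fun ω => D.empMean f m ω g := by
  have h1 : ∀ ω, D.empMean f m ω g = (D.Nbar m)⁻¹ * D.unitSum (fun z => g (observe f z)) m ω :=
    fun ω => empMean_eq_unitSum m ω g
  simp_rw [h1]
  exact (hD.measurable_unitSum (hg.comp (measurable_observe hf)) m).const_mul _

lemma integrable_empMean (hD : D.IsSampled P ℱ Q) (hf : Measurable f) {g : Obs 𝓧 J → ℝ}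
    (hg : Integrable g (obsLaw Q f)) (m : ℕ) : Integrable (fun ω => D.empMean f m ω g) P := by
  have := isProbabilityMeasure_obsLaw (Q := Q) hf
  simp_rw [empMean_eq]
  exact (integrable_sum_coord (measurePreserving_sample hD hf m) hg).const_mul _

lemma integral_empMean (hD : D.IsSampled P ℱ Q) (hf : Measurable f) {g : Obs 𝓧 J → ℝ}
    (hg : Integrable g (obsLaw Q f)) {m : ℕ} (hm : 0 < D.Nbar m) :
    ∫ ω, D.empMean f m ω g ∂P = ∫ o, g o ∂(obsLaw Q f) := by
  have := isProbabilityMeasure_obsLaw (Q := Q) hf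
  simp_rw [empMean_eq]
  rw [integral_const_mul, integral_sum_coord (measurePreserving_sample hD hf m) hg, card_sample,
    inv_mul_cancel_left₀ hm.ne']

lemma memLp_empMean (hD : D.IsSampled P ℱ Q) (hf : Measurable f) {g : Obs 𝓧 J → ℝ}
    (hg : MemLp g 2 (obsLaw Q f)) (m : ℕ) : MemLp (fun ω => D.empMean f m ω g) 2 P := by
  have := isProbabilityMeasure_obsLaw (Q := Q) hf
  simp_rw [empMean_eq]
  exact (memLp_sum_coord (measurePreserving_sample hD hf m) hg).const_mul _

lemma integral_sq_empMean (hD : D.IsSampled P ℱ Q) (hf : Measurable f) {g : Obs 𝓧 J → ℝ}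
    (hg : MemLp g 2 (obsLaw Q f)) (h0 : ∫ o, g o ∂(obsLaw Q f) = 0) {m : ℕ} (hm : 0 < D.Nbar m) :
    ∫ ω, D.empMean f m ω g ^ 2 ∂P = (D.Nbar m)⁻¹ * ∫ o, g o ^ 2 ∂(obsLaw Q f) := by
  have := isProbabilityMeasure_obsLaw (Q := Q) hf
  simp_rw [empMean_eq, mul_pow]
  rw [integral_const_mul, integral_sq_sum_coord (measurePreserving_sample hD hf m) hg h0,
    card_sample]
  field_simp

lemma empMean_add (m : ℕ) (ω : Ω) (g h : Obs 𝓧 J → ℝ) :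
    D.empMean f m ω (fun o => g o + h o) = D.empMean f m ω g + D.empMean f m ω h := by
  simp only [empMean_eq, Finset.sum_add_distrib, mul_add]

lemma empMean_sub (m : ℕ) (ω : Ω) (g h : Obs 𝓧 J → ℝ) :
    D.empMean f m ω (fun o => g o - h o) = D.empMean f m ω g - D.empMean f m ω h := by
  simp only [empMean_eq, Finset.sum_sub_distrib, mul_sub]

lemma empMean_const_mul (m : ℕ) (ω : Ω) (c : ℝ) (g : Obs 𝓧 J → ℝ) :
    D.empMean f m ω (fun o => c * g o) = c * D.empMean f m ω g := by
  simp only [empMean_eq, ← Finset.mul_sum]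
  ring

lemma empMean_mul_const (m : ℕ) (ω : Ω) (c : ℝ) (g : Obs 𝓧 J → ℝ) :
    D.empMean f m ω (fun o => g o * c) = D.empMean f m ω g * c := by
  simp only [empMean_eq, ← Finset.sum_mul]
  ring

lemma empMean_neg (m : ℕ) (ω : Ω) (g : Obs 𝓧 J → ℝ) :
    D.empMean f m ω (fun o => -g o) = -D.empMean f m ω g := by
  simp only [empMean_eq, Finset.sum_neg_distrib, mul_neg]

lemma empMean_sum {ι : Type*} (s : Finset ι) (m : ℕ) (ω : Ω) (g : ι → Obs 𝓧 J → ℝ) :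
    D.empMean f m ω (fun o => ∑ i ∈ s, g i o) = ∑ i ∈ s, D.empMean f m ω (g i) := by
  simp only [empMean_eq]
  rw [Finset.sum_comm, Finset.mul_sum]

lemma empMean_const {m : ℕ} (hm : 0 < D.Nbar m) (ω : Ω) (c : ℝ) :
    D.empMean f m ω (fun _ => c) = c := by
  rw [empMean_eq, Finset.sum_const, Finset.card_univ, nsmul_eq_mul, card_sample,
    inv_mul_cancel_left₀ hm.ne']

lemma empMean_mono {m : ℕ} {ω : Ω} {g h : Obs 𝓧 J → ℝ}
    (hgh : ∀ p, g (D.sample f m ω p) ≤ h (D.sample f m ω p)) :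
    D.empMean f m ω g ≤ D.empMean f m ω h := by
  rw [empMean_eq, empMean_eq]
  exact mul_le_mul_of_nonneg_left (Finset.sum_le_sum fun p _ => hgh p)
    (inv_nonneg.2 (D.Nbar_nonneg m))

lemma empMean_nonneg {m : ℕ} {ω : Ω} {g : Obs 𝓧 J → ℝ} (hg : ∀ p, 0 ≤ g (D.sample f m ω p)) :
    0 ≤ D.empMean f m ω g := by
  rw [empMean_eq]
  exact mul_nonneg (inv_nonneg.2 (D.Nbar_nonneg m)) (Finset.sum_nonneg fun p _ => hg p)

lemma abs_empMean_le {m : ℕ} {ω : Ω} {g h : Obs 𝓧 J → ℝ}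
    (hgh : ∀ p, |g (D.sample f m ω p)| ≤ h (D.sample f m ω p)) :
    |D.empMean f m ω g| ≤ D.empMean f m ω h := by
  rw [abs_le, ← empMean_neg]
  exact ⟨empMean_mono fun p => (abs_le.1 (hgh p)).1, empMean_mono fun p => (abs_le.1 (hgh p)).2⟩

/-- Nonnegativity of the empirical variance. -/
lemma sq_empMean_le {m : ℕ} (hm : 0 < D.Nbar m) (ω : Ω) (g : Obs 𝓧 J → ℝ) :
    D.empMean f m ω g ^ 2 ≤ D.empMean f m ω fun o => g o ^ 2 := by
  have h1 : 0 ≤ D.empMean f m ω fun o => (g o - D.empMean f m ω g) ^ 2 :=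
    empMean_nonneg fun p => sq_nonneg _
  have h2 : (fun o => (g o - D.empMean f m ω g) ^ 2) = fun o => g o ^ 2 + (-2 * D.empMean f m ω g) * g o +
      D.empMean f m ω g ^ 2 := by
    funext o; ring
  rw [h2, empMean_add, empMean_add, empMean_const_mul, empMean_const hm] at h1
  nlinarith

/-- Events whose complements have probability `o(n⁻²)`, where `n` is the number of observational
units. -/
def FastWhp (D : Rounds Ω 𝓧 𝓤 J) (P : Measure Ω) (G : ℕ → Set Ω) : Prop :=
  Tendsto (fun m => D.Nbar m ^ 2 * P.real (G m)ᶜ) atTop (𝓝 0)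

lemma FastWhp.mono {G G' : ℕ → Set Ω} (h : D.FastWhp P G) (hGG' : ∀ᶠ m in atTop, G m ⊆ G' m) :
    D.FastWhp P G' := by
  refine tendsto_of_tendsto_of_tendsto_of_le_of_le' tendsto_const_nhds h
    (Eventually.of_forall fun m => by positivity) ?_
  filter_upwards [hGG'] with m hm
  exact mul_le_mul_of_nonneg_left (measureReal_mono (Set.compl_subset_compl.2 hm)) (sq_nonneg _)

lemma FastWhp.inter {G G' : ℕ → Set Ω} (h : D.FastWhp P G) (h' : D.FastWhp P G') :
    D.FastWhp P fun m => G m ∩ G' m := by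
  have := h.add h'
  rw [add_zero] at this
  refine tendsto_of_tendsto_of_tendsto_of_le_of_le tendsto_const_nhds this
    (fun m => by positivity) fun m => ?_
  show D.Nbar m ^ 2 * P.real (G m ∩ G' m)ᶜ ≤ _
  rw [Set.compl_inter, ← mul_add]
  exact mul_le_mul_of_nonneg_left (measureReal_union_le _ _) (sq_nonneg _)

lemma fastWhp_of_forall {G : ℕ → Set Ω} (h : ∀ᶠ m in atTop, G m = Set.univ) : D.FastWhp P G := by
  refine tendsto_const_nhds.congr' ?_
  filter_upwards [h] with m hm
  simp [hm]

lemma FastWhp.forall_fintype {ι : Type*} [Fintype ι] {p : ι → ℕ → Ω → Prop}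
    (h : ∀ i, D.FastWhp P fun m => {ω | p i m ω}) : D.FastWhp P fun m => {ω | ∀ i, p i m ω} := by
  classical
  have key : ∀ s : Finset ι, D.FastWhp P fun m => {ω | ∀ i ∈ s, p i m ω} := by
    intro s
    induction s using Finset.induction_on with
    | empty => exact fastWhp_of_forall (Eventually.of_forall fun m => by simp)
    | insert a s ha ih =>
      refine ((h a).inter ih).mono (Eventually.of_forall fun m ω hω i hi => ?_)
      rcases Finset.mem_insert.1 hi with rfl | hi
      · exact hω.1
      · exact hω.2 i hi
  exact (key Finset.univ).mono (Eventually.of_forall fun m ω hω i => hω i (Finset.mem_univ i))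

lemma FastWhp.whp (hN : Tendsto D.Nbar atTop atTop) {G : ℕ → Set Ω} (h : D.FastWhp P G) :
    Whp P G := by
  have h1 : Tendsto (fun m => P.real (G m)ᶜ) atTop (𝓝 0) := by
    refine tendsto_of_tendsto_of_tendsto_of_le_of_le' tendsto_const_nhds h
      (Eventually.of_forall fun m => measureReal_nonneg) ?_
    filter_upwards [hN.eventually_ge_atTop 1] with m hm
    exact le_mul_of_one_le_left measureReal_nonneg (one_le_pow₀ hm)
  exact (ENNReal.tendsto_toReal_iff (fun m => measure_ne_top _ _) ENNReal.zero_ne_top).1 h1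

/-- Empirical means of bounded functions are close to their expectations, up to an event of
exponentially small probability. -/
lemma fastWhp_abs_empMean_sub_lt (hD : D.IsSampled P ℱ Q) (hN : Tendsto D.Nbar atTop atTop)
    (hf : Measurable f) {g : Obs 𝓧 J → ℝ} (hg : Measurable g) {C : ℝ}
    (hC : ∀ᵐ o ∂(obsLaw Q f), |g o| ≤ C) {δ : ℝ} (hδ : 0 < δ) :
    D.FastWhp P fun m => {ω | |D.empMean f m ω g - ∫ o, g o ∂(obsLaw Q f)| < δ} := by
  have := isProbabilityMeasure_obsLaw (Q := Q) hf
  -- The Hoeffding exponent per observation, with `|C| + 1` in place of `C` to keep the denominator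
  -- positive. Any power of the sample size is beaten by `exp (-c n)`.
  set c : ℝ := δ ^ 2 / (2 * (|C| + 1) ^ 2) with hc
  have hc0 : 0 < c := by positivity
  have hlim : Tendsto (fun m => 2 * (D.Nbar m ^ 2 * Real.exp (-c * D.Nbar m))) atTop (𝓝 0) := by
    have h1 := (Real.tendsto_pow_mul_exp_neg_atTop_nhds_zero 2).comp (hN.const_mul_atTop hc0)
    have h2 := h1.const_mul (2 / c ^ 2)
    rw [mul_zero] at h2
    refine h2.congr fun m => ?_
    simp only [Function.comp_apply]
    rw [neg_mul]
    field_simp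
  refine tendsto_of_tendsto_of_tendsto_of_le_of_le' tendsto_const_nhds hlim
    (Eventually.of_forall fun m => by positivity) ?_
  filter_upwards [hN.eventually_gt_atTop 0] with m hm
  have h1 := measureReal_le_abs_sum_coord (measurePreserving_sample hD hf m) hg (C := |C| + 1)
    (hC.mono fun o h => by linarith [le_abs_self C]) (t := D.Nbar m * δ) (by positivity)
  rw [card_sample] at h1
  have h2 : -(D.Nbar m * δ) ^ 2 / (2 * (D.Nbar m * (|C| + 1) ^ 2)) = -c * D.Nbar m := by
    rw [hc]; field_simp
  rw [h2] at h1
  have h3 : {ω | |D.empMean f m ω g - ∫ o, g o ∂(obsLaw Q f)| < δ}ᶜ ⊆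
      {ω | D.Nbar m * δ ≤ |∑ p, (g (D.sample f m ω p) - ∫ o, g o ∂(obsLaw Q f))|} := by
    intro ω hω
    have hω' : δ ≤ |D.empMean f m ω g - ∫ o, g o ∂(obsLaw Q f)| := not_lt.1 hω
    have h4 : ∑ p, (g (D.sample f m ω p) - ∫ o, g o ∂(obsLaw Q f)) =
        D.Nbar m * (D.empMean f m ω g - ∫ o, g o ∂(obsLaw Q f)) := by
      rw [Finset.sum_sub_distrib, Finset.sum_const, Finset.card_univ, nsmul_eq_mul, card_sample,
        empMean_eq, mul_sub, mul_inv_cancel_left₀ hm.ne']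
    show D.Nbar m * δ ≤ |∑ p, (g (D.sample f m ω p) - ∫ o, g o ∂(obsLaw Q f))|
    rw [h4, abs_mul, abs_of_pos hm]
    exact mul_le_mul_of_nonneg_left hω' hm.le
  calc _ ≤ D.Nbar m ^ 2 * (2 * Real.exp (-c * D.Nbar m)) :=
        mul_le_mul_of_nonneg_left ((measureReal_mono h3).trans h1) (sq_nonneg _)
    _ = _ := by ring

variable {q : Fin J → ℝ}

lemma isCentered_observe (hf : Measurable f) {g : Obs 𝓧 J → ℝ} (hg : Measurable g)
    (h2 : MemLp g 2 (obsLaw Q f)) (h0 : ∫ o, g o ∂(obsLaw Q f) = 0) :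
    IsCentered Q (fun z => g (observe f z)) fun _ _ => 0 where
  measurable_unit := hg.comp (measurable_observe hf)
  memLp_unit := h2.comp_measurePreserving (measurePreserving_observe hf)
  integral_unit := by rw [integral_observe hf hg, h0]
  measurable_arm _ := measurable_const
  memLp_arm _ := MemLp.zero'
  integral_arm _ := by simp

/-- Holds for an empty sample too, where both sides are zero by the convention for inverses. -/
lemma sqrt_Nbar_mul_empMean (m : ℕ) (ω : Ω) (g : Obs 𝓧 J → ℝ) :
    √(D.Nbar m) * D.empMean f m ω g =
      D.normSum (fun z => g (observe f z)) (fun _ _ => 0) m ω := by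
  rw [normSum_zero_right, empMean_eq_unitSum, ← mul_assoc]
  congr 1
  rcases (D.Nbar_nonneg m).eq_or_lt with h | h
  · simp [← h]
  · have := Real.mul_self_sqrt h.le
    have h' := Real.sqrt_pos.2 h
    field_simp
    rw [sq, this]

lemma IsAsymptotic.bigOP_sqrt_mul_empMean (hA : D.IsAsymptotic P ℱ Q q) (hf : Measurable f)
    {g : Obs 𝓧 J → ℝ} (hg : Measurable g)
    (h2 : MemLp g 2 (obsLaw Q f)) (h0 : ∫ o, g o ∂(obsLaw Q f) = 0) :
    BigOP P fun m ω => √(D.Nbar m) * D.empMean f m ω g := by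
  simp_rw [sqrt_Nbar_mul_empMean]
  exact hA.bigOP_normSum (isCentered_observe hf hg h2 h0)

/-- The weak law of large numbers. -/
lemma IsAsymptotic.littleOP_empMean_sub (hA : D.IsAsymptotic P ℱ Q q) (hf : Measurable f)
    {g : Obs 𝓧 J → ℝ} (hg : Measurable g) (h2 : MemLp g 2 (obsLaw Q f)) :
    LittleOP P fun m ω => D.empMean f m ω g - ∫ o, g o ∂(obsLaw Q f) := by
  have := isProbabilityMeasure_obsLaw (Q := Q) hf
  have h1 := hA.bigOP_sqrt_mul_empMean hf (hg.sub_const (∫ o, g o ∂(obsLaw Q f)))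
    (h2.sub (memLp_const _)) (by
      rw [integral_sub (h2.integrable (by norm_num)) (integrable_const _)]; simp)
  have h3 := h1.mul_littleOP (littleOP_of_tendsto (P := P) (tendsto_inv_sqrt hA.tendsto_Nbar))
  refine h3.of_le whp_univ ?_
  filter_upwards [hA.tendsto_Nbar.eventually_gt_atTop 0] with m hm ω _
  have h' := Real.sqrt_pos.2 hm
  rw [empMean_sub, empMean_const hm, mul_right_comm, mul_inv_cancel₀ h'.ne', one_mul]

lemma IsAsymptotic.bigOP_empMean (hA : D.IsAsymptotic P ℱ Q q) (hf : Measurable f)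
    {g : Obs 𝓧 J → ℝ} (hg : Measurable g) (h2 : MemLp g 2 (obsLaw Q f)) :
    BigOP P fun m ω => D.empMean f m ω g := by
  refine ((hA.littleOP_empMean_sub hf hg h2).bigOP.add
    (bigOP_const (∫ o, g o ∂(obsLaw Q f)))).of_abs_le fun m ω => ?_
  simp

end Rounds

end Empirical

/-! ### Consequences of the regularity conditions: envelopes, positivity, nondegeneracy -/

section Regularity

variable {𝓧 : Type*} {J d : ℕ} [MeasurableSpace 𝓧] {ψ : 𝓧 → Fin d → ℝ} {μ : Measure (Obs 𝓧 J)}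
  {β : Fin J × Fin d → ℝ}

/-- The residual outcome of the units with intervention `j` on. -/
def residOn (ψ : 𝓧 → Fin d → ℝ) (μ : Measure (Obs 𝓧 J)) (β : Fin J × Fin d → ℝ) (j : Fin J)
    (o : Obs 𝓧 J) : ℝ := val (o.2.1 j) * (o.2.2 - tauO1 ψ μ β j)

/-- The residual outcome of the units with intervention `j` off. -/
def residOff (ψ : 𝓧 → Fin d → ℝ) (μ : Measure (Obs 𝓧 J)) (β : Fin J × Fin d → ℝ) (j : Fin J)
    (o : Obs 𝓧 J) : ℝ := (1 - val (o.2.1 j)) * (o.2.2 - tauO0 ψ μ β j)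

/-- An envelope of the estimating function and of its derivatives. -/
def residEnv (ψ : 𝓧 → Fin d → ℝ) (μ : Measure (Obs 𝓧 J)) (β : Fin J × Fin d → ℝ) (j : Fin J)
    (o : Obs 𝓧 J) : ℝ := 1 + |residOn ψ μ β j o| + |residOff ψ μ β j o|

lemma one_le_residEnv (j : Fin J) (o : Obs 𝓧 J) : 1 ≤ residEnv ψ μ β j o := by
  unfold residEnv
  linarith [abs_nonneg (residOn ψ μ β j o), abs_nonneg (residOff ψ μ β j o)]

lemma gammaStar_inl_zero (j : Fin J) : gammaStar ψ μ β j (Sum.inl 0) = tauO1 ψ μ β j := rfl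

lemma gammaStar_inl_one (j : Fin J) : gammaStar ψ μ β j (Sum.inl 1) = tauO0 ψ μ β j := rfl

lemma measurable_status (j : Fin J) : Measurable fun o : Obs 𝓧 J => val (o.2.1 j) :=
  measurable_val.comp ((measurable_pi_apply j).comp (measurable_fst.comp measurable_snd))

lemma measurable_feature (hψ : Measurable ψ) (k : Fin d) : Measurable fun o : Obs 𝓧 J => ψ o.1 k :=
  (measurable_pi_apply k).comp (hψ.comp measurable_fst)

lemma measurable_feature_dotProduct (hψ : Measurable ψ) (b : Fin d → ℝ) :
    Measurable fun o : Obs 𝓧 J => ψ o.1 ⬝ᵥ b :=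
  Finset.measurable_fun_sum _ fun k _ => (measurable_feature hψ k).mul_const _

lemma measurable_sigmoid_comp {Z : Type*} [MeasurableSpace Z] {g : Z → ℝ} (hg : Measurable g) :
    Measurable fun z => Real.sigmoid (g z) :=
  continuous_sigmoid.measurable.comp hg

lemma measurable_residOn (j : Fin J) : Measurable (residOn ψ μ β j) :=
  (measurable_status j).mul ((measurable_snd.comp measurable_snd).sub_const _)

lemma measurable_residOff (j : Fin J) : Measurable (residOff ψ μ β j) :=
  ((measurable_status j).const_sub _).mul ((measurable_snd.comp measurable_snd).sub_const _)

lemma measurable_residEnv (j : Fin J) : Measurable (residEnv ψ μ β j) :=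
  ((measurable_residOn j).abs.const_add _).add (measurable_residOff j).abs

lemma measurable_estFun (hψ : Measurable ψ) (j : Fin J) (γ : Fin 2 ⊕ Fin d → ℝ) (r : Fin 2 ⊕ Fin d) :
    Measurable fun o => estFun ψ j o γ r := by
  have h1 := measurable_status (𝓧 := 𝓧) j
  have h2 := measurable_feature_dotProduct (J := J) hψ (γ ∘ Sum.inr)
  have h3 : Measurable fun o : Obs 𝓧 J => o.2.2 := by fun_prop
  rcases r with i | k
  · fin_cases i
    · simp only [Fin.zero_eta, estFun_inl_zero]
      fun_prop
    · simp only [Fin.mk_one, estFun_inl_one]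
      fun_prop
  · simp only [estFun_inr]
    exact (h1.sub (measurable_sigmoid_comp h2)).mul (measurable_feature hψ k)

lemma measurable_estJac (hψ : Measurable ψ) (j : Fin J) (γ : Fin 2 ⊕ Fin d → ℝ)
    (r c : Fin 2 ⊕ Fin d) : Measurable fun o => estJac ψ j o γ r c := by
  have h1 := measurable_status (𝓧 := 𝓧) j
  have h2 := measurable_feature_dotProduct (J := J) hψ (γ ∘ Sum.inr)
  have h3 : Measurable fun o : Obs 𝓧 J => o.2.2 := by fun_prop
  have h4 := fun k => measurable_feature (J := J) hψ k
  have h5 := measurable_sigmoid_comp h2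
  rcases r with i | k <;> rcases c with i' | l
  · fin_cases i <;> fin_cases i' <;> simp [estJac] <;> fun_prop
  · fin_cases i <;> simp [estJac] <;> fun_prop
  · simp [estJac]
  · simp only [estJac, Matrix.fromBlocks_apply₂₂, Matrix.of_apply]
    exact ((h5.mul (h5.const_sub _)).mul ((h4 k).mul (h4 l))).neg

lemma measurable_estEnv (hψ : Measurable ψ) (j : Fin J) (γ : Fin 2 ⊕ Fin d → ℝ) :
    Measurable fun o => estEnv ψ j o γ := by
  have h1 := measurable_status (𝓧 := 𝓧) j
  have h2 := measurable_feature_dotProduct (J := J) hψ (γ ∘ Sum.inr)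
  have h3 : Measurable fun o : Obs 𝓧 J => o.2.2 := by fun_prop
  have h4 : Measurable fun o : Obs 𝓧 J => ∑ k, |ψ o.1 k| :=
    Finset.measurable_fun_sum _ fun k _ => (measurable_feature hψ k).abs
  unfold estEnv
  have h5 : Measurable fun o : Obs 𝓧 J => Real.exp |ψ o.1 ⬝ᵥ (γ ∘ Sum.inr)| :=
    Real.measurable_exp.comp h2.abs
  refine (h4.pow_const 3).add (h5.mul (((Measurable.add (Measurable.abs ?_) (Measurable.abs ?_)).mul
    (h4.pow_const 2)).add (h4.const_mul 2)))
  · exact h1.mul (h3.sub_const _)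
  · exact (h1.const_sub _).mul (h3.sub_const _)

lemma abs_dotProduct_block_le {x : Fin d → ℝ} {B : ℝ} (hB : ∑ k, |x k| ≤ B) (b : Fin d → ℝ) :
    |x ⬝ᵥ b| ≤ B * ‖b‖ :=
  (abs_dotProduct_le x b).trans (mul_le_mul_of_nonneg_right hB (norm_nonneg _))

/-- The constant in the envelope bounds. -/
def envConst (B : ℝ) (β : Fin J × Fin d → ℝ) : ℝ := (1 + Real.exp (B * ‖β‖)) * (1 + B) ^ 3

/-- With bounded features all exponentials are bounded, and the outcome enters the Jacobian only
linearly, through the residuals. Hence the Jacobian inherits the second moments of the residuals. -/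
lemma abs_estJac_le {o : Obs 𝓧 J} {B : ℝ} (hB : ∑ k, |ψ o.1 k| ≤ B) (j : Fin J)
    (r c : Fin 2 ⊕ Fin d) :
    |estJac ψ j o (gammaStar ψ μ β j) r c| ≤ envConst B β * residEnv ψ μ β j o := by
  have hB0 : 0 ≤ B := (Finset.sum_nonneg fun _ _ => abs_nonneg _).trans hB
  set t := ψ o.1 ⬝ᵥ fun k => β (j, k) with ht
  have htB : |t| ≤ B * ‖β‖ := (abs_dotProduct_block_le hB _).trans
    (mul_le_mul_of_nonneg_left (norm_block_le β j) hB0)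
  have he1 : Real.exp t ≤ Real.exp (B * ‖β‖) := Real.exp_le_exp.2 ((le_abs_self t).trans htB)
  have he2 : Real.exp (-t) ≤ Real.exp (B * ‖β‖) := Real.exp_le_exp.2 ((neg_le_abs t).trans htB)
  set M := Real.exp (B * ‖β‖) with hM
  have hM0 : 0 < M := Real.exp_pos _
  have hψB : ∀ k, |ψ o.1 k| ≤ B := fun k => (Finset.single_le_sum (f := fun k => |ψ o.1 k|)
      (fun _ _ => abs_nonneg _) (Finset.mem_univ k)).trans hB
  set V := residEnv ψ μ β j o with hV
  have hV1 : 1 ≤ V := one_le_residEnv j o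
  have hVon : |residOn ψ μ β j o| ≤ V := by
    rw [hV, residEnv]; linarith [abs_nonneg (residOff ψ μ β j o)]
  have hVoff : |residOff ψ μ β j o| ≤ V := by
    rw [hV, residEnv]; linarith [abs_nonneg (residOn ψ μ β j o)]
  have hc1 : (1 + M) ≤ envConst B β := by
    unfold envConst
    rw [← hM]
    have : (1 : ℝ) ≤ (1 + B) ^ 3 := one_le_pow₀ (by linarith)
    nlinarith
  have hc2 : M * B ≤ envConst B β := by
    unfold envConst
    rw [← hM]
    have : B ≤ (1 + B) ^ 3 := by nlinarith [mul_nonneg hB0 hB0, mul_nonneg (mul_nonneg hB0 hB0) hB0]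
    exact mul_le_mul (by linarith) this hB0 (by positivity)
  have hc3 : B * B ≤ envConst B β := by
    unfold envConst
    rw [← hM]
    have : B * B ≤ (1 + B) ^ 3 := by
      nlinarith [mul_nonneg hB0 hB0, mul_nonneg (mul_nonneg hB0 hB0) hB0]
    have h1 : (1 + B) ^ 3 ≤ (1 + M) * (1 + B) ^ 3 :=
      le_mul_of_one_le_left (by positivity) (by linarith)
    linarith
  have hc0 : 0 ≤ envConst B β := by unfold envConst; positivity
  have ha0 := abs_val_le (o.2.1 j)
  have ha1 : |1 - val (o.2.1 j)| ≤ 1 := by cases o.2.1 j <;> simp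
  have bound1 : ∀ a E : ℝ, |a| ≤ 1 → 0 < E → E ≤ M →
      |-(a * (1 + E))| ≤ envConst B β * V := by
    intro a E ha hE hEM
    rw [abs_neg, abs_mul, abs_of_pos (by linarith : 0 < 1 + E)]
    calc |a| * (1 + E) ≤ 1 * (1 + M) := mul_le_mul ha (by linarith) (by linarith) zero_le_one
      _ ≤ envConst B β * V := by rw [one_mul]; exact hc1.trans (le_mul_of_one_le_right hc0 hV1)
  have bound2 : ∀ v E x : ℝ, |v| ≤ V → 0 < E → E ≤ M → |x| ≤ B →
      |v * (E * x)| ≤ envConst B β * V := by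
    intro v E x hv hE hEM hx
    rw [abs_mul, abs_mul, abs_of_pos hE]
    calc |v| * (E * |x|) ≤ V * (M * B) :=
          mul_le_mul hv (mul_le_mul hEM hx (abs_nonneg _) hM0.le) (by positivity) (by linarith)
      _ = (M * B) * V := by ring
      _ ≤ _ := mul_le_mul_of_nonneg_right hc2 (by linarith)
  have hzero : |(0 : ℝ)| ≤ envConst B β * V := by rw [abs_zero]; positivity
  rcases r with i | k <;> rcases c with i' | l
  · fin_cases i <;> fin_cases i'
    · exact bound1 _ _ ha0 (Real.exp_pos _) he2
    · exact hzero
    · exact hzero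
    · exact bound1 _ _ ha1 (Real.exp_pos _) he1
  · fin_cases i
    · show |-(residOn ψ μ β j o * (Real.exp (-t) * ψ o.1 l))| ≤ _
      rw [abs_neg]
      exact bound2 _ _ _ hVon (Real.exp_pos _) he2 (hψB l)
    · exact bound2 _ _ _ hVoff (Real.exp_pos _) he1 (hψB l)
  · exact hzero
  · show |-(Real.sigmoid t * (1 - Real.sigmoid t) * (ψ o.1 k * ψ o.1 l))| ≤ _
    have hs0 := Real.sigmoid_pos t
    have hs1 := Real.sigmoid_lt_one t
    rw [abs_neg, abs_mul, abs_mul (ψ o.1 k), abs_of_nonneg (by nlinarith)]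
    calc Real.sigmoid t * (1 - Real.sigmoid t) * (|ψ o.1 k| * |ψ o.1 l|) ≤ 1 * (B * B) :=
          mul_le_mul (by nlinarith) (mul_le_mul (hψB k) (hψB l) (abs_nonneg _) hB0)
            (by positivity) zero_le_one
      _ ≤ envConst B β * V := by rw [one_mul]; exact hc3.trans (le_mul_of_one_le_right hc0 hV1)

/-- The second order remainder is again linear in the residuals, so its envelope is square
integrable. -/
lemma estEnv_le {o : Obs 𝓧 J} {B : ℝ} (hB : ∑ k, |ψ o.1 k| ≤ B) (j : Fin J) :
    estEnv ψ j o (gammaStar ψ μ β j) ≤ 3 * envConst B β * residEnv ψ μ β j o := by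
  have hS0 : 0 ≤ ∑ k, |ψ o.1 k| := Finset.sum_nonneg fun _ _ => abs_nonneg _
  have hB0 : 0 ≤ B := hS0.trans hB
  have htB : |ψ o.1 ⬝ᵥ (gammaStar ψ μ β j ∘ Sum.inr)| ≤ B * ‖β‖ :=
    (abs_dotProduct_block_le hB _).trans (mul_le_mul_of_nonneg_left (norm_block_le β j) hB0)
  have he := Real.exp_le_exp.2 htB
  unfold estEnv envConst
  rw [gammaStar_inl_zero, gammaStar_inl_one]
  set S := ∑ k, |ψ o.1 k|
  set M := Real.exp (B * ‖β‖) with hM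
  have hM0 : 0 < M := Real.exp_pos _
  have hS2 : S ^ 2 ≤ B ^ 2 := pow_le_pow_left₀ hS0 hB 2
  have hS3 : S ^ 3 ≤ B ^ 3 := pow_le_pow_left₀ hS0 hB 3
  have hV1 : 1 ≤ residEnv ψ μ β j o := one_le_residEnv j o
  set v := |val (o.2.1 j) * (o.2.2 - tauO1 ψ μ β j)| + |(1 - val (o.2.1 j)) * (o.2.2 - tauO0 ψ μ β j)|
    with hv
  have hv0 : 0 ≤ v := by positivity
  have hvV : residEnv ψ μ β j o = 1 + v := by rw [residEnv, residOn, residOff, hv, add_assoc]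
  rw [hvV]
  have h1 : v * S ^ 2 + 2 * S ≤ v * B ^ 2 + 2 * B := by
    have := mul_le_mul_of_nonneg_left hS2 hv0
    linarith
  have h2 := mul_le_mul he h1 (by positivity) hM0.le
  have hB3 : B ^ 3 ≤ (1 + B) ^ 3 := pow_le_pow_left₀ hB0 (by linarith) 3
  have hB2 : B ^ 2 ≤ (1 + B) ^ 3 := by
    nlinarith [mul_nonneg hB0 hB0, mul_nonneg (mul_nonneg hB0 hB0) hB0]
  have hB1 : B ≤ (1 + B) ^ 3 := by nlinarith [mul_nonneg hB0 hB0, mul_nonneg (mul_nonneg hB0 hB0) hB0]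
  set c := (1 + B) ^ 3
  have hc : 0 ≤ c := by positivity
  have h3 : v * B ^ 2 + 2 * B ≤ c * (v + 2) := by nlinarith [mul_le_mul_of_nonneg_left hB2 hv0]
  have h4 : M * (v * B ^ 2 + 2 * B) ≤ M * (c * (v + 2)) := mul_le_mul_of_nonneg_left h3 hM0.le
  have h5 : 0 ≤ M * c * v := by positivity
  have h6 : 0 ≤ c * v := by positivity
  have h7 : 0 ≤ M * c := by positivity
  calc _ ≤ c + M * (c * (v + 2)) := add_le_add (hS3.trans hB3) (h2.trans h4)
    _ ≤ _ := by nlinarith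

namespace Regular

variable (hreg : Regular ψ μ β)

include hreg

lemma exists_bound : ∃ B > 0, ∀ᵐ o ∂μ, ∑ k, |ψ o.1 k| ≤ B := by
  obtain ⟨C, hC⟩ := hreg.b3
  refine ⟨d * |C| + 1, by positivity, ?_⟩
  filter_upwards [hC] with o ho
  calc ∑ k, |ψ o.1 k| ≤ ∑ _k : Fin d, |C| := Finset.sum_le_sum fun k _ => (ho k).trans (le_abs_self C)
    _ ≤ d * |C| + 1 := by simp

lemma memLp_estFun (hψ : Measurable ψ) (j : Fin J) (r : Fin 2 ⊕ Fin d) :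
    MemLp (fun o => estFun ψ j o (gammaStar ψ μ β j) r) 2 μ := by
  have hm := (measurable_estFun hψ j (gammaStar ψ μ β j) r)
  rw [memLp_two_iff_integrable_sq hm.aestronglyMeasurable]
  refine (hreg.c2 j).mono' (hm.pow_const 2).aestronglyMeasurable (ae_of_all _ fun o => ?_)
  rw [Real.norm_eq_abs, abs_of_nonneg (sq_nonneg _)]
  exact Finset.single_le_sum (f := fun r => estFun ψ j o (gammaStar ψ μ β j) r ^ 2)
    (fun _ _ => sq_nonneg _) (Finset.mem_univ r)

lemma integral_estFun (j : Fin J) (r : Fin 2 ⊕ Fin d) :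
    ∫ o, estFun ψ j o (gammaStar ψ μ β j) r ∂μ = 0 := (hreg.c1 j _).2 rfl r

/-- Inverse propensity weights are at least one, so the residual is dominated by the first component
of the estimating function, which is square integrable by (C2). -/
lemma memLp_residOn (hψ : Measurable ψ) (j : Fin J) : MemLp (residOn ψ μ β j) 2 μ := by
  refine (hreg.memLp_estFun hψ j (Sum.inl 0)).mono (measurable_residOn j).aestronglyMeasurable
    (ae_of_all _ fun o => ?_)
  rw [estFun_inl_zero, Real.norm_eq_abs, Real.norm_eq_abs, abs_mul]
  refine le_mul_of_one_le_right (abs_nonneg _) ?_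
  rw [abs_of_pos (by positivity)]
  linarith [Real.exp_pos (-(ψ o.1 ⬝ᵥ (gammaStar ψ μ β j ∘ Sum.inr)))]

lemma memLp_residOff (hψ : Measurable ψ) (j : Fin J) : MemLp (residOff ψ μ β j) 2 μ := by
  refine (hreg.memLp_estFun hψ j (Sum.inl 1)).mono (measurable_residOff j).aestronglyMeasurable
    (ae_of_all _ fun o => ?_)
  rw [estFun_inl_one, Real.norm_eq_abs, Real.norm_eq_abs, abs_mul]
  refine le_mul_of_one_le_right (abs_nonneg _) ?_
  rw [abs_of_pos (by positivity)]
  linarith [Real.exp_pos (ψ o.1 ⬝ᵥ (gammaStar ψ μ β j ∘ Sum.inr))]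

lemma memLp_residEnv [IsProbabilityMeasure μ] (hψ : Measurable ψ) (j : Fin J) :
    MemLp (residEnv ψ μ β j) 2 μ := by
  have h1 : MemLp (fun o => |residOn ψ μ β j o|) 2 μ := (hreg.memLp_residOn hψ j).abs
  have h2 : MemLp (fun o => |residOff ψ μ β j o|) 2 μ := (hreg.memLp_residOff hψ j).abs
  have h0 : MemLp (fun _ : Obs 𝓧 J => (1 : ℝ)) 2 μ := memLp_const 1
  exact (h0.add h1).add h2

lemma memLp_estJac [IsProbabilityMeasure μ] (hψ : Measurable ψ) (j : Fin J) (r c : Fin 2 ⊕ Fin d) :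
    MemLp (fun o => estJac ψ j o (gammaStar ψ μ β j) r c) 2 μ := by
  obtain ⟨B, hB0, hB⟩ := hreg.exists_bound
  refine (hreg.memLp_residEnv hψ j).of_le_mul (c := envConst B β)
    (measurable_estJac hψ j _ r c).aestronglyMeasurable ?_
  filter_upwards [hB] with o ho
  rw [Real.norm_eq_abs, Real.norm_eq_abs, abs_of_nonneg (zero_le_one.trans (one_le_residEnv j o))]
  exact abs_estJac_le ho j r c

lemma memLp_estEnv [IsProbabilityMeasure μ] (hψ : Measurable ψ) (j : Fin J) :
    MemLp (fun o => estEnv ψ j o (gammaStar ψ μ β j)) 2 μ := by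
  obtain ⟨B, hB0, hB⟩ := hreg.exists_bound
  refine (hreg.memLp_residEnv hψ j).of_le_mul (c := 3 * envConst B β)
    (measurable_estEnv hψ j _).aestronglyMeasurable ?_
  filter_upwards [hB] with o ho
  rw [Real.norm_eq_abs, Real.norm_eq_abs, abs_of_nonneg (zero_le_one.trans (one_le_residEnv j o)),
    abs_of_nonneg (estEnv_nonneg ψ j o _)]
  exact estEnv_le ho j

lemma isUnit_det_expJac (j : Fin J) :
    IsUnit (expMatrix μ fun o => estJac ψ j o (gammaStar ψ μ β j)).det := by
  have h := (hreg.c3 j).2.2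
  simp_rw [jacobian_estFun] at h
  exact h

lemma isUnit_det_expStackedJac :
    IsUnit (expMatrix μ fun o => stackedJac ψ o (gammaStarAll ψ μ β)).det := by
  have h := det_blockMatrix_ne_zero (fun j => expMatrix μ fun o => estJac ψ j o (gammaStar ψ μ β j))
    fun j => hreg.isUnit_det_expJac j
  convert! h using 2
  ext p p'
  simp only [expMatrix, stackedJac, Matrix.of_apply]
  split_ifs
  · rfl
  · simp

lemma not_ae_row_eq_zero (j : Fin J) (r : Fin 2 ⊕ Fin d) :
    ¬ ∀ᵐ o ∂μ, ∀ c, estJac ψ j o (gammaStar ψ μ β j) r c = 0 := by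
  intro h
  refine (hreg.isUnit_det_expJac j).ne_zero (Matrix.det_eq_zero_of_row_eq_zero r fun c => ?_)
  rw [expMatrix, Matrix.of_apply]
  exact integral_eq_zero_of_ae (h.mono fun o ho => ho c)

/-- Positivity comes from (C3): if intervention `j` were almost never on, a whole row of the
expected Jacobian would vanish, since all its entries carry the factor `A^j`. -/
lemma integral_status_pos [IsProbabilityMeasure μ] (j : Fin J) : 0 < ∫ o, val (o.2.1 j) ∂μ := by
  have h0 : ∀ o : Obs 𝓧 J, 0 ≤ val (o.2.1 j) := fun o => by cases o.2.1 j <;> simp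
  refine lt_of_le_of_ne (integral_nonneg h0) fun h => hreg.not_ae_row_eq_zero j (Sum.inl 0) ?_
  have hi : Integrable (fun o : Obs 𝓧 J => val (o.2.1 j)) μ :=
    Integrable.of_bound (measurable_status j).aestronglyMeasurable 1
      (ae_of_all _ fun o => abs_val_le _)
  have h1 := (integral_eq_zero_iff_of_nonneg h0 hi).1 h.symm
  filter_upwards [h1] with o ho c
  have ho' : val (o.2.1 j) = 0 := ho
  rcases c with i | l
  · fin_cases i <;> simp [estJac, ho']
  · simp [estJac, ho']

lemma integral_one_sub_status_pos [IsProbabilityMeasure μ] (j : Fin J) :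
    0 < ∫ o, (1 - val (o.2.1 j)) ∂μ := by
  have h0 : ∀ o : Obs 𝓧 J, 0 ≤ 1 - val (o.2.1 j) := fun o => by cases o.2.1 j <;> simp
  refine lt_of_le_of_ne (integral_nonneg h0) fun h => hreg.not_ae_row_eq_zero j (Sum.inl 1) ?_
  have hi : Integrable (fun o : Obs 𝓧 J => 1 - val (o.2.1 j)) μ :=
    Integrable.of_bound ((measurable_status j).const_sub 1).aestronglyMeasurable 1
      (ae_of_all _ fun o => by cases o.2.1 j <;> simp)
  have h1 := (integral_eq_zero_iff_of_nonneg h0 hi).1 h.symm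
  filter_upwards [h1] with o ho c
  have ho' : 1 - val (o.2.1 j) = 0 := ho
  rcases c with i | l
  · fin_cases i <;> simp [estJac, ho']
  · simp [estJac, ho']

/-- Placed in block `j` and continued by zero, such a `u` would lie in the kernel of the expected
Hessian, against (B2). -/
lemma not_ae_dotProduct_eq_zero (j : Fin J) {u : Fin d → ℝ} (hu : u ≠ 0) :
    ¬ ∀ᵐ o ∂μ, ψ o.1 ⬝ᵥ u = 0 := by
  intro h
  set v : Fin J × Fin d → ℝ := fun p => if p.1 = j then u p.2 else 0 with hv
  have hv0 : v ≠ 0 := by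
    intro h0
    refine hu (funext fun k => ?_)
    have := congrFun h0 (j, k)
    simpa [hv] using this
  have h1 := hreg.b2.2.dotProduct_mulVec_pos hv0
  have h2 : (expMatrix μ fun o => hess (loss ψ o) β).mulVec v = 0 := by
    funext p
    simp only [Matrix.mulVec, dotProduct, expMatrix, Matrix.of_apply, Pi.zero_apply]
    simp_rw [← integral_mul_const]
    rw [← integral_finsetSum _ fun p' _ => (hreg.b2.1 p p').mul_const _]
    refine integral_eq_zero_of_ae ?_
    filter_upwards [h] with o ho
    simp only [hess_loss, Fintype.sum_prod_type, hv, Pi.zero_apply]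
    refine Finset.sum_eq_zero fun j' _ => ?_
    by_cases h3 : j' = j
    · by_cases h4 : p.1 = j'
      · simp only [h3, h4, if_true]
        have h5 : ∀ c : ℝ, ∑ k, c * (ψ o.1 p.2 * ψ o.1 k) * u k = c * ψ o.1 p.2 * (ψ o.1 ⬝ᵥ u) := by
          intro c
          rw [dotProduct, Finset.mul_sum]
          exact Finset.sum_congr rfl fun k _ => by ring
        rw [h5, ho, mul_zero]
      · simp [h4]
    · simp [h3]
  rw [h2] at h1
  simp at h1

lemma integrable_feature_mul [IsProbabilityMeasure μ] (hψ : Measurable ψ) (k l : Fin d) :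
    Integrable (fun o => ψ o.1 k * ψ o.1 l) μ := by
  obtain ⟨C, hC⟩ := hreg.b3
  refine Integrable.of_bound ((measurable_feature hψ k).mul
    (measurable_feature hψ l)).aestronglyMeasurable (C * C) ?_
  filter_upwards [hC] with o ho
  rw [norm_mul]
  exact mul_le_mul (ho k) (ho l) (norm_nonneg _) ((abs_nonneg _).trans (ho k))

end Regular

lemma sq_dotProduct (x u : Fin d → ℝ) : (x ⬝ᵥ u) ^ 2 = ∑ k, ∑ l, x k * x l * (u k * u l) := by
  rw [sq, dotProduct, Finset.sum_mul_sum]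
  exact Finset.sum_congr rfl fun k _ => Finset.sum_congr rfl fun l _ => by ring

namespace Regular

/-- The second moments of the features are bounded below. -/
lemma exists_quadratic_lower_bound [IsProbabilityMeasure μ] (hreg : Regular ψ μ β)
    (hψ : Measurable ψ) (j : Fin J) : ∃ c > 0, ∀ u : Fin d → ℝ,
      c * ‖u‖ ^ 2 ≤ ∑ k, ∑ l, (∫ o, ψ o.1 k * ψ o.1 l ∂μ) * (u k * u l) := by
  set F : (Fin d → ℝ) → ℝ := fun u => ∑ k, ∑ l, (∫ o, ψ o.1 k * ψ o.1 l ∂μ) * (u k * u l) with hF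
  have hFint : ∀ u, F u = ∫ o, (ψ o.1 ⬝ᵥ u) ^ 2 ∂μ := by
    intro u
    simp_rw [sq_dotProduct]
    have hi : ∀ k l, Integrable (fun o : Obs 𝓧 J => ψ o.1 k * ψ o.1 l * (u k * u l)) μ :=
      fun k l => (hreg.integrable_feature_mul hψ k l).mul_const _
    rw [integral_finsetSum _ fun k _ => integrable_finsetSum _ fun l _ => hi k l]
    refine Finset.sum_congr rfl fun k _ => ?_
    rw [integral_finsetSum _ fun l _ => hi k l]
    exact Finset.sum_congr rfl fun l _ => (integral_mul_const _ _).symm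
  have hFpos : ∀ u, u ≠ 0 → 0 < F u := by
    intro u hu
    rw [hFint]
    refine lt_of_le_of_ne (integral_nonneg fun _ => sq_nonneg _) fun h =>
      hreg.not_ae_dotProduct_eq_zero j hu ?_
    have hi : Integrable (fun o : Obs 𝓧 J => (ψ o.1 ⬝ᵥ u) ^ 2) μ := by
      simp_rw [sq_dotProduct]
      exact integrable_finsetSum _ fun k _ => integrable_finsetSum _ fun l _ =>
        (hreg.integrable_feature_mul hψ k l).mul_const _
    have h1 := (integral_eq_zero_iff_of_nonneg (fun _ => sq_nonneg _) hi).1 h.symm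
    filter_upwards [h1] with o ho
    simpa using ho
  have hFcont : Continuous F := by fun_prop
  have hFsmul : ∀ (t : ℝ) u, F (t • u) = t ^ 2 * F u := by
    intro t u
    simp only [hF, Finset.mul_sum, Pi.smul_apply, smul_eq_mul]
    exact Finset.sum_congr rfl fun k _ => Finset.sum_congr rfl fun l _ => by ring
  -- The constant is the minimum of the quadratic form on the unit sphere, extended by homogeneity.
  -- The sphere is empty when there are no features, and then every `u` is zero.
  rcases (Metric.sphere (0 : Fin d → ℝ) 1).eq_empty_or_nonempty with he | hne
  · refine ⟨1, one_pos, fun u => ?_⟩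
    have hu : u = 0 := by
      by_contra hu
      have : (‖u‖⁻¹ • u) ∈ Metric.sphere (0 : Fin d → ℝ) 1 := by
        rw [mem_sphere_zero_iff_norm, norm_smul, norm_inv, norm_norm,
          inv_mul_cancel₀ (norm_ne_zero_iff.2 hu)]
      rw [he] at this
      exact this
    simp [hu]
  · obtain ⟨u₀, hu₀, hmin⟩ := (isCompact_sphere (0 : Fin d → ℝ) 1).exists_isMinOn hne
      hFcont.continuousOn
    have hu₀' : ‖u₀‖ = 1 := by simpa using hu₀
    refine ⟨F u₀, hFpos u₀ (by rintro rfl; simp at hu₀'), fun u => ?_⟩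
    show _ ≤ F u
    rcases eq_or_ne u 0 with rfl | hu
    · simp [hF]
    have hn : ‖u‖ ≠ 0 := norm_ne_zero_iff.2 hu
    have h1 : (‖u‖⁻¹ • u) ∈ Metric.sphere (0 : Fin d → ℝ) 1 := by
      rw [mem_sphere_zero_iff_norm, norm_smul, norm_inv, norm_norm, inv_mul_cancel₀ hn]
    have h2 : F u₀ ≤ F (‖u‖⁻¹ • u) := hmin h1
    rw [hFsmul, inv_pow] at h2
    have h3 := mul_le_mul_of_nonneg_right h2 (sq_nonneg ‖u‖)
    rwa [mul_right_comm, inv_mul_cancel₀ (pow_ne_zero 2 hn), one_mul] at h3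

end Regular

end Regularity

/-- Convexity in the form `exp t ≥ exp u (1 + t - u)`, used in both orders. -/
lemma abs_exp_sub_exp_le {K u t : ℝ} (hu : |u| ≤ K) (ht : |t| ≤ K) :
    |Real.exp u - Real.exp t| ≤ Real.exp K * |u - t| := by
  have key : ∀ u t : ℝ, |u| ≤ K → Real.exp u - Real.exp t ≤ Real.exp K * |u - t| := by
    intro u t hu
    have h1 := Real.add_one_le_exp (t - u)
    have h2 : Real.exp t = Real.exp u * Real.exp (t - u) := by rw [← Real.exp_add]; ring_nf
    have h3 : Real.exp u - Real.exp t ≤ Real.exp u * (u - t) := by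
      rw [h2]; nlinarith [Real.exp_pos u]
    calc _ ≤ Real.exp u * (u - t) := h3
      _ ≤ Real.exp u * |u - t| := mul_le_mul_of_nonneg_left (le_abs_self _) (Real.exp_pos _).le
      _ ≤ _ := mul_le_mul_of_nonneg_right (Real.exp_le_exp.2 ((le_abs_self u).trans hu))
        (abs_nonneg _)
  rw [abs_le]
  constructor
  · have := key t u ht
    rw [abs_sub_comm] at this
    linarith
  · exact key u t hu

lemma exists_pos_forall_le {ι : Type*} [Finite ι] {a : ι → ℝ} (ha : ∀ i, 0 < a i) :
    ∃ p > 0, ∀ i, p ≤ a i := by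
  rcases isEmpty_or_nonempty ι with h | h
  · exact ⟨1, one_pos, fun i => h.elim i⟩
  · obtain ⟨i, hi⟩ := Finite.exists_min a
    exact ⟨a i, ha i, hi⟩

/-! ### Deterministic error bounds on good samples -/

section Deterministic

variable {Ω 𝓧 𝓤 : Type*} {J d : ℕ} [MeasurableSpace Ω] [MeasurableSpace 𝓧] [MeasurableSpace 𝓤]
  (D : Rounds Ω 𝓧 𝓤 J) (f : 𝓧 × 𝓤 → Fin J → Bool) (ψ : 𝓧 → Fin d → ℝ) (μ : Measure (Obs 𝓧 J))
  (β : Fin J × Fin d → ℝ)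

namespace Rounds

/-- The empirical mean of the estimating function at the population parameter. -/
def empEst (m : ℕ) (ω : Ω) (j : Fin J) (r : Fin 2 ⊕ Fin d) : ℝ :=
  D.empMean f m ω fun o => estFun ψ j o (gammaStar ψ μ β j) r

/-- The lower bound for the slope of the score near the population parameter. -/
def slope (β : Fin J × Fin d → ℝ) (B c : ℝ) : ℝ := Real.sigmoid (-(B * (‖β‖ + 1))) ^ 2 * c

lemma slope_pos {β : Fin J × Fin d → ℝ} (B : ℝ) {c : ℝ} (hc : 0 < c) : 0 < slope β B c :=
  mul_pos (pow_pos (Real.sigmoid_pos _) 2) hc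

/-- The samples for which the observational estimator is well behaved. -/
structure IsGood (B c p : ℝ) (m : ℕ) (ω : Ω) : Prop where
  bound : ∀ i, ∑ k, |ψ (D.sample f m ω i).1 k| ≤ B
  -- The dummy index makes the condition void when there are no interventions: the Hessian is then
  -- an empty matrix and says nothing about the features.
  quad : ∀ (_ : Fin J) (u : Fin d → ℝ), c * ‖u‖ ^ 2 ≤ D.empMean f m ω fun o => (ψ o.1 ⬝ᵥ u) ^ 2
  score_lt : ∀ j, ∑ k, |D.empEst f ψ μ β m ω j (Sum.inr k)| < slope β B c
  on : ∀ j, p ≤ D.empMean f m ω fun o => val (o.2.1 j)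
  off : ∀ j, p ≤ D.empMean f m ω fun o => 1 - val (o.2.1 j)

/-- The solution `γ̂^j` of the sample estimating equations, for propensity coefficients `b`. -/
def gammaHat (m : ℕ) (ω : Ω) (b : Fin J × Fin d → ℝ) (j : Fin J) : Fin 2 ⊕ Fin d → ℝ :=
  Sum.elim
    ![D.empMean f m ω (fun o => val (o.2.1 j) * o.2.2 / eta ψ o.1 fun k => b (j, k)) /
        D.empMean f m ω (fun o => val (o.2.1 j) / eta ψ o.1 fun k => b (j, k)),
      D.empMean f m ω (fun o => (1 - val (o.2.1 j)) * o.2.2 / (1 - eta ψ o.1 fun k => b (j, k))) /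
        D.empMean f m ω (fun o => (1 - val (o.2.1 j)) / (1 - eta ψ o.1 fun k => b (j, k)))]
    fun k => b (j, k)

variable {D f ψ μ β}

lemma tauO_eq_gammaHat (m : ℕ) (ω : Ω) (b : Fin J × Fin d → ℝ) (j : Fin J) :
    D.tauO f ψ m ω b j =
      D.gammaHat f ψ m ω b j (Sum.inl 0) - D.gammaHat f ψ m ω b j (Sum.inl 1) := rfl

lemma score_eq_empMean (m : ℕ) (ω : Ω) (j : Fin J) (b : Fin d → ℝ) (k : Fin d) :
    score (D.Nbar m)⁻¹ (fun i => ψ (D.sample f m ω i).1) (fun i => val ((D.sample f m ω i).2.1 j)) b k =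
      D.empMean f m ω fun o => (val (o.2.1 j) - Real.sigmoid (ψ o.1 ⬝ᵥ b)) * ψ o.1 k := by
  rw [empMean_eq, score]

lemma score_eq_empEst (m : ℕ) (ω : Ω) (j : Fin J) (k : Fin d) :
    score (D.Nbar m)⁻¹ (fun i => ψ (D.sample f m ω i).1) (fun i => val ((D.sample f m ω i).2.1 j))
      (fun k => β (j, k)) k = D.empEst f ψ μ β m ω j (Sum.inr k) :=
  score_eq_empMean m ω j _ k

/-- The log-likelihood is a sum over the interventions, so the joint score equation splits into `J`
separate logistic regressions. -/
lemma solvesScore_iff (m : ℕ) (ω : Ω) (b : Fin J × Fin d → ℝ) :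
    D.SolvesScore f ψ m ω b ↔ ∀ j, score (D.Nbar m)⁻¹ (fun i => ψ (D.sample f m ω i).1)
      (fun i => val ((D.sample f m ω i).2.1 j)) (fun k => b (j, k)) = 0 := by
  have h : ∀ j k, D.empMean f m ω (fun o => grad (loss ψ o) b (j, k)) =
      -score (D.Nbar m)⁻¹ (fun i => ψ (D.sample f m ω i).1)
        (fun i => val ((D.sample f m ω i).2.1 j)) (fun k => b (j, k)) k := by
    intro j k
    simp_rw [grad_loss]
    rw [score_eq_empMean, empMean_neg]
    rfl
  constructor
  · intro hb j
    funext k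
    have := hb (j, k)
    rw [h] at this
    simpa using this
  · rintro hb ⟨j, k⟩
    rw [h, hb j]
    simp

namespace IsGood

variable {B c p : ℝ} {m : ℕ} {ω : Ω} (hG : D.IsGood f ψ μ β B c p m ω)

include hG

lemma Nbar_pos (hp : 0 < p) (j : Fin J) : 0 < D.Nbar m := by
  refine lt_of_le_of_ne (D.Nbar_nonneg m) fun h => ?_
  have h1 := hG.on j
  rw [empMean_eq, ← h, inv_zero, zero_mul] at h1
  linarith

lemma abs_dotProduct_le (hB : 0 ≤ B) (j : Fin J) (i) {b : Fin d → ℝ}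
    (hb : ‖b - fun k => β (j, k)‖ ≤ 1) :
    |ψ (D.sample f m ω i).1 ⬝ᵥ b| ≤ B * (‖β‖ + 1) := by
  refine (abs_dotProduct_block_le (hG.bound i) b).trans (mul_le_mul_of_nonneg_left ?_ hB)
  have h1 : b = (fun k => β (j, k)) + (b - fun k => β (j, k)) := by abel
  rw [h1]
  exact (norm_add_le _ _).trans (add_le_add (norm_block_le β j) hb)

lemma quad' (j : Fin J) (u : Fin d → ℝ) :
    c * ‖u‖ ^ 2 ≤ (D.Nbar m)⁻¹ * ∑ i, (ψ (D.sample f m ω i).1 ⬝ᵥ u) ^ 2 := by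
  have h := hG.quad j u
  rwa [empMean_eq] at h

lemma exists_solvesScore (hB : 0 ≤ B) (hc : 0 < c) : ∃ b, D.SolvesScore f ψ m ω b := by
  have h1 : ∀ j, ∃ b, score (D.Nbar m)⁻¹ (fun i => ψ (D.sample f m ω i).1)
      (fun i => val ((D.sample f m ω i).2.1 j)) b = 0 := by
    intro j
    refine exists_score_eq_zero (β := fun k => β (j, k)) (inv_nonneg.2 (D.Nbar_nonneg m))
      (fun i b hb => hG.abs_dotProduct_le hB j i hb) hc (hG.quad' j) ?_
    simp_rw [score_eq_empEst (μ := μ)]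
    exact hG.score_lt j
  choose b hb using h1
  exact ⟨fun q => b q.1 q.2, (solvesScore_iff m ω _).2 hb⟩

lemma norm_sub_le (hB : 0 ≤ B) (hc : 0 < c) {b : Fin J × Fin d → ℝ} (hb : D.SolvesScore f ψ m ω b)
    (j : Fin J) : ‖(fun k => b (j, k)) - fun k => β (j, k)‖ ≤
      (∑ k, |D.empEst f ψ μ β m ω j (Sum.inr k)|) / slope β B c := by
  have h1 : ∑ k, |score (D.Nbar m)⁻¹ (fun i => ψ (D.sample f m ω i).1)
      (fun i => val ((D.sample f m ω i).2.1 j)) (fun k => β (j, k)) k| < slope β B c := by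
    simp_rw [score_eq_empEst (μ := μ)]
    exact hG.score_lt j
  have h2 := norm_sub_le_of_score_eq_zero (inv_nonneg.2 (D.Nbar_nonneg m))
    (fun i b hb => hG.abs_dotProduct_le hB j i hb) hc (hG.quad' j) h1
    ((solvesScore_iff m ω b).1 hb j)
  simp_rw [score_eq_empEst (μ := μ)] at h2
  exact h2

lemma norm_sub_le_one (hB : 0 ≤ B) (hc : 0 < c) {b : Fin J × Fin d → ℝ}
    (hb : D.SolvesScore f ψ m ω b) (j : Fin J) :
    ‖(fun k => b (j, k)) - fun k => β (j, k)‖ ≤ 1 :=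
  (hG.norm_sub_le hB hc hb j).trans ((div_le_one (slope_pos B hc)).2 (hG.score_lt j).le)

lemma empMean_on_div_eta (j : Fin J) (b : Fin d → ℝ) :
    p ≤ D.empMean f m ω fun o => val (o.2.1 j) / eta ψ o.1 b := by
  refine (hG.on j).trans (empMean_mono fun i => ?_)
  rw [div_eta]
  refine le_mul_of_one_le_right ?_ (by linarith [Real.exp_pos (-(ψ (D.sample f m ω i).1 ⬝ᵥ b))])
  cases (D.sample f m ω i).2.1 j <;> simp

lemma empMean_off_div_one_sub_eta (j : Fin J) (b : Fin d → ℝ) :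
    p ≤ D.empMean f m ω fun o => (1 - val (o.2.1 j)) / (1 - eta ψ o.1 b) := by
  refine (hG.off j).trans (empMean_mono fun i => ?_)
  rw [div_one_sub_eta]
  refine le_mul_of_one_le_right ?_ (by linarith [Real.exp_pos (ψ (D.sample f m ω i).1 ⬝ᵥ b)])
  cases (D.sample f m ω i).2.1 j <;> simp

/-- The normalized weighted means are by construction the roots of the first two empirical
equations, their denominators being at least `p`; the others are the score equations. -/
lemma empMean_estFun_gammaHat (hp : 0 < p) {b : Fin J × Fin d → ℝ}
    (hb : D.SolvesScore f ψ m ω b) (j : Fin J) (r : Fin 2 ⊕ Fin d) :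
    D.empMean f m ω (fun o => estFun ψ j o (D.gammaHat f ψ m ω b j) r) = 0 := by
  have h1 := hG.empMean_on_div_eta j fun k => b (j, k)
  have h2 := hG.empMean_off_div_one_sub_eta j fun k => b (j, k)
  rcases r with i | k
  · fin_cases i
    · show D.empMean f m ω (fun o => val (o.2.1 j) * o.2.2 / (eta ψ o.1 fun k => b (j, k)) -
        _ / _ * (val (o.2.1 j) / eta ψ o.1 fun k => b (j, k))) = 0
      rw [empMean_sub, empMean_const_mul, div_mul_cancel₀ _ (hp.trans_le h1).ne', sub_self]
    · show D.empMean f m ω (fun o => (1 - val (o.2.1 j)) * o.2.2 / (1 - eta ψ o.1 fun k => b (j, k)) -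
        _ / _ * ((1 - val (o.2.1 j)) / (1 - eta ψ o.1 fun k => b (j, k)))) = 0
      rw [empMean_sub, empMean_const_mul, div_mul_cancel₀ _ (hp.trans_le h2).ne', sub_self]
  · have := congrFun ((solvesScore_iff m ω b).1 hb j) k
    rw [score_eq_empMean] at this
    exact this

omit hG in
lemma one_le_empMean_residEnv (hm : 0 < D.Nbar m) (j : Fin J) :
    1 ≤ D.empMean f m ω (residEnv ψ μ β j) := by
  have h := empMean_mono (D := D) (f := f) (m := m) (ω := ω) (g := fun _ => 1)
    (h := residEnv ψ μ β j) fun i => one_le_residEnv j _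
  rwa [empMean_const hm] at h

/-- A weighted mean of the outcomes is close to `τ` when the weights are close to weights for which
the weighted mean of the residuals is small. -/
lemma abs_weighted_mean_sub_le (hp : 0 < p) {τ ε : ℝ} {a w w' : Obs 𝓧 J → ℝ} {y : Obs 𝓧 J → ℝ}
    (hden : p ≤ D.empMean f m ω fun o => a o * w o)
    (hw : ∀ i, |w (D.sample f m ω i) - w' (D.sample f m ω i)| ≤ ε) :
    |D.empMean f m ω (fun o => a o * y o * w o) / D.empMean f m ω (fun o => a o * w o) - τ| ≤
      p⁻¹ * (|D.empMean f m ω fun o => a o * (y o - τ) * w' o| +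
        ε * D.empMean f m ω fun o => |a o * (y o - τ)|) := by
  have hd : 0 < D.empMean f m ω fun o => a o * w o := hp.trans_le hden
  have h1 : D.empMean f m ω (fun o => a o * y o * w o) / D.empMean f m ω (fun o => a o * w o) - τ =
      (D.empMean f m ω fun o => a o * (y o - τ) * w o) / D.empMean f m ω fun o => a o * w o := by
    have h2 : (fun o => a o * (y o - τ) * w o) = fun o => a o * y o * w o - τ * (a o * w o) := by
      funext o; ring
    rw [h2, empMean_sub, empMean_const_mul]
    field_simp
  have h3 : (fun o => a o * (y o - τ) * w o) = fun o =>
      a o * (y o - τ) * w' o + a o * (y o - τ) * (w o - w' o) := by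
    funext o; ring
  have h4 : |D.empMean f m ω fun o => a o * (y o - τ) * (w o - w' o)| ≤
      ε * D.empMean f m ω fun o => |a o * (y o - τ)| := by
    rw [← empMean_const_mul]
    refine abs_empMean_le fun i => ?_
    rw [abs_mul, mul_comm]
    exact mul_le_mul_of_nonneg_right (hw i) (abs_nonneg _)
  rw [h1, abs_div, abs_of_pos hd, div_eq_mul_inv, mul_comm]
  refine mul_le_mul (inv_anti₀ hp hden) ?_ (abs_nonneg _) (inv_nonneg.2 hp.le)
  rw [h3, empMean_add]
  exact (abs_add_le _ _).trans (add_le_add le_rfl h4)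

omit hG in
/-- The constant in the error bound of the observational estimator. -/
def errConst (β : Fin J × Fin d → ℝ) (B c p : ℝ) : ℝ :=
  p⁻¹ * (1 + Real.exp (B * (‖β‖ + 1)) * B / slope β B c) + (slope β B c)⁻¹

/-- With `S` the size of the empirical estimating function at the truth, the coefficients move by at
most `S / slope` and the weights by a multiple of that. Each weighted mean then errs by at most
`p⁻¹` times `S` plus the weight change times the mean residual. As the envelope mean `V` is at least
one, all of this is a multiple of `S * V`. -/
lemma abs_gammaHat_sub_le (hB : 0 ≤ B) (hc : 0 < c) (hp : 0 < p) {b : Fin J × Fin d → ℝ}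
    (hb : D.SolvesScore f ψ m ω b) (j : Fin J) (r : Fin 2 ⊕ Fin d) :
    |D.gammaHat f ψ m ω b j r - gammaStar ψ μ β j r| ≤ errConst β B c p *
      ((∑ r, |D.empEst f ψ μ β m ω j r|) * D.empMean f m ω (residEnv ψ μ β j)) := by
  have hb1 := hG.norm_sub_le_one hB hc hb j
  have hbn := hG.norm_sub_le hB hc hb j
  have hm := hG.Nbar_pos hp j
  have hV := one_le_empMean_residEnv (f := f) (ψ := ψ) (μ := μ) (β := β) (ω := ω) hm j
  set V := D.empMean f m ω (residEnv ψ μ β j) with hVdef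
  set S := ∑ r, |D.empEst f ψ μ β m ω j r| with hS
  have hSr : ∀ r, |D.empEst f ψ μ β m ω j r| ≤ S := fun r =>
    Finset.single_le_sum (f := fun r => |D.empEst f ψ μ β m ω j r|) (fun _ _ => abs_nonneg _)
      (Finset.mem_univ r)
  have hS0 : 0 ≤ S := Finset.sum_nonneg fun _ _ => abs_nonneg _
  have hSk : ∑ k, |D.empEst f ψ μ β m ω j (Sum.inr k)| ≤ S := by
    rw [hS, Fintype.sum_sum_type]
    exact le_add_of_nonneg_left (Finset.sum_nonneg fun _ _ => abs_nonneg _)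
  set κ := slope β B c with hκ
  have hκ0 : 0 < κ := slope_pos B hc
  have hbS : ‖(fun k => b (j, k)) - fun k => β (j, k)‖ ≤ S / κ :=
    hbn.trans (div_le_div_of_nonneg_right hSk hκ0.le)
  set K := B * (‖β‖ + 1) with hK
  set ε := Real.exp K * (B * (S / κ)) with hε
  have hε0 : 0 ≤ ε := by positivity
  have hSV : S ≤ S * V := le_mul_of_one_le_right hS0 hV
  have hdot : ∀ i, |ψ (D.sample f m ω i).1 ⬝ᵥ (fun k => b (j, k)) -
      ψ (D.sample f m ω i).1 ⬝ᵥ fun k => β (j, k)| ≤ B * (S / κ) := by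
    intro i
    rw [← dotProduct_sub]
    exact (abs_dotProduct_block_le (hG.bound i) _).trans (mul_le_mul_of_nonneg_left hbS hB)
  have hexp : ∀ s : ℝ, |s| = 1 → ∀ i,
      |(1 + Real.exp (s * (ψ (D.sample f m ω i).1 ⬝ᵥ fun k => b (j, k)))) -
        (1 + Real.exp (s * (ψ (D.sample f m ω i).1 ⬝ᵥ fun k => β (j, k))))| ≤ ε := by
    intro s hs i
    rw [add_sub_add_left_eq_sub]
    have h1 := hG.abs_dotProduct_le hB j i hb1
    have h2 := hG.abs_dotProduct_le hB j i (b := fun k => β (j, k)) (by simp)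
    refine (abs_exp_sub_exp_le (K := K) (by rw [abs_mul, hs, one_mul]; exact h1)
      (by rw [abs_mul, hs, one_mul]; exact h2)).trans ?_
    rw [← mul_sub, abs_mul, hs, one_mul]
    exact mul_le_mul_of_nonneg_left (hdot i) (Real.exp_pos _).le
  have hmain : ∀ e v : ℝ, e ≤ S → v ≤ V → p⁻¹ * (e + ε * v) ≤ errConst β B c p * (S * V) := by
    intro e v he hv
    have h1 : e + ε * v ≤ (1 + Real.exp K * B / κ) * (S * V) := by
      have h2 : ε * v ≤ Real.exp K * B / κ * (S * V) := by
        calc ε * v ≤ ε * V := mul_le_mul_of_nonneg_left hv hε0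
          _ = _ := by rw [hε]; ring
      rw [add_mul, one_mul]
      exact add_le_add (he.trans hSV) h2
    have h3 := mul_le_mul_of_nonneg_left h1 (inv_nonneg.2 hp.le)
    have h4 : 0 ≤ κ⁻¹ * (S * V) := by positivity
    rw [errConst, ← hκ, ← hK, add_mul, mul_assoc]
    linarith
  rcases r with i | k
  · fin_cases i
    · have hden := hG.empMean_on_div_eta j fun k => b (j, k)
      simp_rw [div_eta] at hden
      have h := abs_weighted_mean_sub_le hG (τ := tauO1 ψ μ β j) (y := fun o => o.2.2) hp hden
        (w' := fun o => 1 + Real.exp (-(ψ o.1 ⬝ᵥ fun k => β (j, k))))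
        (ε := ε) (fun i => by simpa using hexp (-1) (by simp) i)
      show |D.empMean f m ω _ / D.empMean f m ω _ - tauO1 ψ μ β j| ≤ _
      simp_rw [div_eta]
      refine h.trans (hmain _ _ ?_ ?_)
      · have h1 := hSr (Sum.inl 0)
        simp only [empEst, estFun_inl_zero] at h1
        exact h1
      · refine empMean_mono fun i => ?_
        show |residOn ψ μ β j _| ≤ _
        rw [residEnv]
        linarith [abs_nonneg (residOff ψ μ β j (D.sample f m ω i))]
    · have hden := hG.empMean_off_div_one_sub_eta j fun k => b (j, k)
      simp_rw [div_one_sub_eta] at hden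
      have h := abs_weighted_mean_sub_le hG (τ := tauO0 ψ μ β j) (y := fun o => o.2.2) hp hden
        (w' := fun o => 1 + Real.exp (ψ o.1 ⬝ᵥ fun k => β (j, k)))
        (ε := ε) (fun i => by simpa using hexp 1 (by simp) i)
      show |D.empMean f m ω _ / D.empMean f m ω _ - tauO0 ψ μ β j| ≤ _
      simp_rw [div_one_sub_eta]
      refine h.trans (hmain _ _ ?_ ?_)
      · have h1 := hSr (Sum.inl 1)
        simp only [empEst, estFun_inl_one] at h1
        exact h1
      · refine empMean_mono fun i => ?_
        show |residOff ψ μ β j _| ≤ _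
        rw [residEnv]
        linarith [abs_nonneg (residOn ψ μ β j (D.sample f m ω i))]
  · have h1 : |b (j, k) - β (j, k)| ≤ S / κ :=
      (norm_le_pi_norm ((fun k => b (j, k)) - fun k => β (j, k)) k).trans hbS
    refine h1.trans ?_
    have h2 : 0 ≤ p⁻¹ * (1 + Real.exp K * B / κ) * (S * V) := by positivity
    have h3 : κ⁻¹ * S ≤ κ⁻¹ * (S * V) := mul_le_mul_of_nonneg_left hSV (inv_nonneg.2 hκ0.le)
    rw [errConst, ← hκ, ← hK, add_mul, div_eq_mul_inv, mul_comm S]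
    linarith

end IsGood

end Rounds

end Deterministic

/-! ### Good samples are overwhelmingly likely; the linearization remainder -/

section Observational

variable {Ω 𝓧 𝓤 : Type*} {J d : ℕ} [mΩ : MeasurableSpace Ω] [MeasurableSpace 𝓧] [MeasurableSpace 𝓤]
  {P : Measure Ω} [IsProbabilityMeasure P]
  {Q : Measure (UnitRec 𝓧 𝓤 J)} [IsProbabilityMeasure Q] {f : 𝓧 × 𝓤 → Fin J → Bool}
  {D : Rounds Ω 𝓧 𝓤 J} {ℱ : Filtration ℕ mΩ} {q : Fin J → ℝ} {ψ : 𝓧 → Fin d → ℝ}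
  {β : Fin J × Fin d → ℝ}

namespace Rounds

/-- Perturbing each of the `d²` coefficients by at most `δ` changes the quadratic form by at most
`d² δ ‖u‖²`, that is, by half of the population lower bound. -/
lemma quadratic_lower_bound_of_close {m : ℕ} {ω : Ω} {c δ : ℝ} {E : Fin d → Fin d → ℝ}
    (hE : ∀ u : Fin d → ℝ, c * ‖u‖ ^ 2 ≤ ∑ k, ∑ l, E k l * (u k * u l))
    (hδ : (d : ℝ) ^ 2 * δ ≤ c / 2)
    (hc : ∀ k l, |D.empMean f m ω (fun o => ψ o.1 k * ψ o.1 l) - E k l| ≤ δ) (u : Fin d → ℝ) :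
    c / 2 * ‖u‖ ^ 2 ≤ D.empMean f m ω fun o => (ψ o.1 ⬝ᵥ u) ^ 2 := by
  have h1 : D.empMean f m ω (fun o => (ψ o.1 ⬝ᵥ u) ^ 2) =
      ∑ k, ∑ l, D.empMean f m ω (fun o => ψ o.1 k * ψ o.1 l) * (u k * u l) := by
    simp_rw [sq_dotProduct, empMean_sum, empMean_mul_const]
  have h2 : |∑ k, ∑ l, (D.empMean f m ω (fun o => ψ o.1 k * ψ o.1 l) - E k l) * (u k * u l)| ≤
      ∑ _k : Fin d, ∑ _l : Fin d, δ * ‖u‖ ^ 2 := by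
    refine (Finset.abs_sum_le_sum_abs _ _).trans (Finset.sum_le_sum fun k _ => ?_)
    refine (Finset.abs_sum_le_sum_abs _ _).trans (Finset.sum_le_sum fun l _ => ?_)
    rw [abs_mul, abs_mul, sq]
    exact mul_le_mul (hc k l) (mul_le_mul (norm_le_pi_norm u k) (norm_le_pi_norm u l)
      (abs_nonneg _) (norm_nonneg _)) (by positivity) ((abs_nonneg _).trans (hc k l))
  have h3 : ∑ _k : Fin d, ∑ _l : Fin d, δ * ‖u‖ ^ 2 = (d : ℝ) ^ 2 * δ * ‖u‖ ^ 2 := by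
    simp; ring
  have h4 : ∑ k, ∑ l, (D.empMean f m ω (fun o => ψ o.1 k * ψ o.1 l) - E k l) * (u k * u l) =
      D.empMean f m ω (fun o => (ψ o.1 ⬝ᵥ u) ^ 2) - ∑ k, ∑ l, E k l * (u k * u l) := by
    rw [h1]
    simp_rw [sub_mul, Finset.sum_sub_distrib]
  rw [h4, h3] at h2
  have h5 := (abs_le.1 h2).1
  have h6 := mul_le_mul_of_nonneg_right hδ (sq_nonneg ‖u‖)
  linarith [hE u]

/-- Up to events of exponentially small probability the observational sample is well behaved. -/
lemma IsSampled.exists_isGood (hD : D.IsSampled P ℱ Q) (hN : Tendsto D.Nbar atTop atTop)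
    (hf : Measurable f) (hψ : Measurable ψ) (hreg : Regular ψ (obsLaw Q f) β) :
    ∃ B > 0, ∃ c > 0, ∃ p > 0, ∃ G : ℕ → Set Ω, (∀ m, MeasurableSet (G m)) ∧ D.FastWhp P G ∧
      ∀ m, ∀ᵐ ω ∂P, ω ∈ G m → D.IsGood f ψ (obsLaw Q f) β B c p m ω := by
  have := isProbabilityMeasure_obsLaw (Q := Q) hf
  obtain ⟨B, hB0, hB⟩ := hreg.exists_bound
  have hψB : ∀ᵐ o ∂(obsLaw Q f), ∀ k, |ψ o.1 k| ≤ B := hB.mono fun o ho k =>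
    (Finset.single_le_sum (f := fun k => |ψ o.1 k|) (fun _ _ => abs_nonneg _)
      (Finset.mem_univ k)).trans ho
  obtain ⟨c, hc0, hc⟩ : ∃ c > 0, ∀ (_ : Fin J) (u : Fin d → ℝ),
      c * ‖u‖ ^ 2 ≤ ∑ k, ∑ l, (∫ o, ψ o.1 k * ψ o.1 l ∂(obsLaw Q f)) * (u k * u l) := by
    rcases isEmpty_or_nonempty (Fin J) with h | ⟨⟨j⟩⟩
    · exact ⟨1, one_pos, fun j => h.elim j⟩
    · obtain ⟨c, hc0, hc⟩ := hreg.exists_quadratic_lower_bound hψ j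
      exact ⟨c, hc0, fun _ => hc⟩
  obtain ⟨p, hp0, hp⟩ := exists_pos_forall_le fun j => hreg.integral_status_pos j
  obtain ⟨p', hp0', hp'⟩ := exists_pos_forall_le fun j => hreg.integral_one_sub_status_pos j
  -- Population frequencies of both statuses are at least `2 r`, so empirical ones within `r` of
  -- them are at least `r`.
  set r := min p p' / 2 with hr
  have hr0 : 0 < r := half_pos (lt_min hp0 hp0')
  -- Chosen so that `d² δ ≤ c / 2`; likewise `δ'` below is chosen so that `d δ' < κ`. The added ones
  -- cover `d = 0`.
  set δ := c / (2 * ((d : ℝ) ^ 2 + 1)) with hδ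
  have hδ0 : 0 < δ := by positivity
  have hκ0 := slope_pos (β := β) B (half_pos hc0)
  set κ := slope β B (c / 2) with hκ
  set δ' := κ / (d + 1) with hδ'
  have hδ0' : 0 < δ' := by positivity
  set G1 : ℕ → Set Ω := fun m => {ω | ∀ kl : Fin d × Fin d, |D.empMean f m ω (fun o => ψ o.1 kl.1 *
    ψ o.1 kl.2) - ∫ o, ψ o.1 kl.1 * ψ o.1 kl.2 ∂(obsLaw Q f)| < δ} with hG1
  set G2 : ℕ → Set Ω := fun m => {ω | ∀ jk : Fin J × Fin d, |D.empMean f m ω (fun o =>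
    estFun ψ jk.1 o (gammaStar ψ (obsLaw Q f) β jk.1) (Sum.inr jk.2)) -
    ∫ o, estFun ψ jk.1 o (gammaStar ψ (obsLaw Q f) β jk.1) (Sum.inr jk.2) ∂(obsLaw Q f)| < δ'} with hG2
  set G3 : ℕ → Set Ω := fun m => {ω | ∀ j : Fin J, |D.empMean f m ω (fun o => val (o.2.1 j)) -
    ∫ o, val (o.2.1 j) ∂(obsLaw Q f)| < r} with hG3
  set G4 : ℕ → Set Ω := fun m => {ω | ∀ j : Fin J, |D.empMean f m ω (fun o => 1 - val (o.2.1 j)) -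
    ∫ o, (1 - val (o.2.1 j)) ∂(obsLaw Q f)| < r} with hG4
  have hmeas : ∀ (g : Obs 𝓧 J → ℝ) (s t : ℝ) m, Measurable g →
      MeasurableSet {ω | |D.empMean f m ω g - s| < t} := fun g s t m hg =>
    measurableSet_lt (((measurable_empMean hD hf hg m).sub_const s).abs) measurable_const
  have hm1 : ∀ k l, Measurable fun o : Obs 𝓧 J => ψ o.1 k * ψ o.1 l := fun k l =>
    (measurable_feature hψ k).mul (measurable_feature hψ l)
  have hm2 := fun (j : Fin J) (k : Fin d) =>
    measurable_estFun hψ j (gammaStar ψ (obsLaw Q f) β j) (Sum.inr k)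
  have hm3 := fun j : Fin J => measurable_status (𝓧 := 𝓧) j
  refine ⟨B, hB0, c / 2, half_pos hc0, r, hr0, fun m => G1 m ∩ (G2 m ∩ (G3 m ∩ G4 m)),
    fun m => ?_, ?_, fun m => ?_⟩
  · refine MeasurableSet.inter ?_ (MeasurableSet.inter ?_ (MeasurableSet.inter ?_ ?_))
    · simp only [hG1, Set.ofPred_forall]
      exact MeasurableSet.iInter fun kl => hmeas _ _ _ m (hm1 _ _)
    · simp only [hG2, Set.ofPred_forall]
      exact MeasurableSet.iInter fun jk => hmeas _ _ _ m (hm2 _ _)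
    · simp only [hG3, Set.ofPred_forall]
      exact MeasurableSet.iInter fun j => hmeas _ _ _ m (hm3 _)
    · simp only [hG4, Set.ofPred_forall]
      exact MeasurableSet.iInter fun j => hmeas _ _ _ m ((hm3 _).const_sub 1)
  · refine FastWhp.inter ?_ (FastWhp.inter ?_ (FastWhp.inter ?_ ?_))
    · refine FastWhp.forall_fintype fun kl => ?_
      refine fastWhp_abs_empMean_sub_lt hD hN hf (hm1 _ _) (C := B * B) (hψB.mono fun o ho => ?_) hδ0
      rw [abs_mul]
      exact mul_le_mul (ho _) (ho _) (abs_nonneg _) hB0.le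
    · refine FastWhp.forall_fintype fun jk => ?_
      refine fastWhp_abs_empMean_sub_lt hD hN hf (hm2 _ _) (C := 1 * B) (hψB.mono fun o ho => ?_) hδ0'
      rw [estFun_inr, abs_mul]
      refine mul_le_mul ?_ (ho _) (abs_nonneg _) zero_le_one
      have h1 := Real.sigmoid_pos (ψ o.1 ⬝ᵥ (gammaStar ψ (obsLaw Q f) β jk.1 ∘ Sum.inr))
      have h2 := Real.sigmoid_lt_one (ψ o.1 ⬝ᵥ (gammaStar ψ (obsLaw Q f) β jk.1 ∘ Sum.inr))
      rw [abs_le]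
      cases o.2.1 jk.1
      · rw [val_false]; constructor <;> linarith
      · rw [val_true]; constructor <;> linarith
    · exact FastWhp.forall_fintype fun j => fastWhp_abs_empMean_sub_lt hD hN hf (hm3 j) (C := 1)
        (ae_of_all _ fun o => abs_val_le _) hr0
    · exact FastWhp.forall_fintype fun j => fastWhp_abs_empMean_sub_lt hD hN hf ((hm3 j).const_sub 1)
        (C := 1) (ae_of_all _ fun o => by cases o.2.1 j <;> simp) hr0
  · filter_upwards [ae_forall_coord (measurePreserving_sample hD hf m) hB] with ω hω
    rintro ⟨h1, h2, h3, h4⟩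
    refine ⟨hω, fun j => quadratic_lower_bound_of_close (hc j) ?_ fun k l => (h1 (k, l)).le,
      fun j => ?_, fun j => ?_, fun j => ?_⟩
    · rw [hδ, ← mul_div_assoc, div_le_div_iff₀ (by positivity) two_pos]
      nlinarith
    · have h5 : ∀ k, |D.empEst f ψ (obsLaw Q f) β m ω j (Sum.inr k)| ≤ δ' := fun k => by
        have := h2 (j, k)
        simp only [hreg.integral_estFun, sub_zero] at this
        exact this.le
      calc _ ≤ ∑ _k : Fin d, δ' := Finset.sum_le_sum fun k _ => h5 k
        _ = d * δ' := by simp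
        _ < κ := by
          rw [hδ', ← mul_div_assoc, div_lt_iff₀ (by positivity)]
          nlinarith
    · have h5 := (abs_lt.1 (h3 j)).1
      have h6 : min p p' ≤ ∫ o, val (o.2.1 j) ∂(obsLaw Q f) := (min_le_left _ _).trans (hp j)
      have h7 : min p p' = 2 * r := by rw [hr]; ring
      linarith
    · have h5 := (abs_lt.1 (h4 j)).1
      have h6 : min p p' ≤ ∫ o, (1 - val (o.2.1 j)) ∂(obsLaw Q f) := (min_le_right _ _).trans (hp' j)
      have h7 : min p p' = 2 * r := by rw [hr]; ring
      linarith

/-- A bound for the error of the observational estimator. -/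
def errBound (D : Rounds Ω 𝓧 𝓤 J) (f : 𝓧 × 𝓤 → Fin J → Bool) (ψ : 𝓧 → Fin d → ℝ)
    (μ : Measure (Obs 𝓧 J)) (β : Fin J × Fin d → ℝ) (m : ℕ) (ω : Ω) : ℝ :=
  ∑ j, (∑ r, |D.empEst f ψ μ β m ω j r|) * D.empMean f m ω (residEnv ψ μ β j)

lemma errBound_nonneg (μ : Measure (Obs 𝓧 J)) (m : ℕ) (ω : Ω) : 0 ≤ D.errBound f ψ μ β m ω :=
  Finset.sum_nonneg fun _ _ => mul_nonneg (Finset.sum_nonneg fun _ _ => abs_nonneg _)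
    (empMean_nonneg fun _ => zero_le_one.trans (one_le_residEnv _ _))

lemma le_errBound (μ : Measure (Obs 𝓧 J)) (m : ℕ) (ω : Ω) (j : Fin J) :
    (∑ r, |D.empEst f ψ μ β m ω j r|) * D.empMean f m ω (residEnv ψ μ β j) ≤
      D.errBound f ψ μ β m ω :=
  Finset.single_le_sum (f := fun j => (∑ r, |D.empEst f ψ μ β m ω j r|) *
    D.empMean f m ω (residEnv ψ μ β j)) (fun _ _ => mul_nonneg (Finset.sum_nonneg fun _ _ =>
      abs_nonneg _) (empMean_nonneg fun _ => zero_le_one.trans (one_le_residEnv _ _)))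
    (Finset.mem_univ j)

lemma errConst_nonneg {B c p : ℝ} (hB : 0 ≤ B) (hc : 0 < c) (hp : 0 < p) :
    0 ≤ IsGood.errConst β B c p := by
  have := slope_pos (β := β) B hc
  unfold IsGood.errConst
  positivity

lemma IsAsymptotic.bigOP_sqrt_mul_empEst (hA : D.IsAsymptotic P ℱ Q q) (hf : Measurable f)
    (hψ : Measurable ψ) (hreg : Regular ψ (obsLaw Q f) β) (j : Fin J) (r : Fin 2 ⊕ Fin d) :
    BigOP P fun m ω => √(D.Nbar m) * D.empEst f ψ (obsLaw Q f) β m ω j r :=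
  hA.bigOP_sqrt_mul_empMean hf (measurable_estFun hψ j _ r) (hreg.memLp_estFun hψ j r)
    (hreg.integral_estFun j r)

lemma IsAsymptotic.bigOP_sqrt_mul_errBound (hA : D.IsAsymptotic P ℱ Q q) (hf : Measurable f)
    (hψ : Measurable ψ) (hreg : Regular ψ (obsLaw Q f) β) :
    BigOP P fun m ω => √(D.Nbar m) * D.errBound f ψ (obsLaw Q f) β m ω := by
  have := isProbabilityMeasure_obsLaw (Q := Q) hf
  have h1 : BigOP P fun m ω => ∑ j, (∑ r, |√(D.Nbar m) * D.empEst f ψ (obsLaw Q f) β m ω j r|) *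
      D.empMean f m ω (residEnv ψ (obsLaw Q f) β j) :=
    BigOP.sum _ fun j _ => (BigOP.sum _ fun r _ =>
      (hA.bigOP_sqrt_mul_empEst hf hψ hreg j r).abs).mul
        (hA.bigOP_empMean hf (measurable_residEnv j) (hreg.memLp_residEnv hψ j))
  refine h1.of_abs_le fun m ω => le_of_eq ?_
  congr 1
  rw [errBound, Finset.mul_sum]
  refine Finset.sum_congr rfl fun j _ => ?_
  simp_rw [abs_mul, abs_of_nonneg (Real.sqrt_nonneg _), ← Finset.mul_sum, mul_assoc]

lemma IsAsymptotic.littleOP_errBound (hA : D.IsAsymptotic P ℱ Q q) (hf : Measurable f)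
    (hψ : Measurable ψ) (hreg : Regular ψ (obsLaw Q f) β) :
    LittleOP P fun m ω => D.errBound f ψ (obsLaw Q f) β m ω := by
  have h3 := (hA.bigOP_sqrt_mul_errBound hf hψ hreg).mul_littleOP
    (littleOP_of_tendsto (P := P) (tendsto_inv_sqrt hA.tendsto_Nbar))
  refine h3.of_le whp_univ ?_
  filter_upwards [hA.tendsto_Nbar.eventually_gt_atTop 0] with m hm ω _
  have h' := Real.sqrt_pos.2 hm
  rw [mul_right_comm, mul_inv_cancel₀ h'.ne', one_mul]

/-- The remainder in the linearization of the estimating equations. -/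
def linRem (D : Rounds Ω 𝓧 𝓤 J) (f : 𝓧 × 𝓤 → Fin J → Bool) (ψ : 𝓧 → Fin d → ℝ)
    (μ : Measure (Obs 𝓧 J)) (β : Fin J × Fin d → ℝ) (C : ℝ) (m : ℕ) (ω : Ω)
    (p : Fin J × (Fin 2 ⊕ Fin d)) : ℝ :=
  (∑ p', |D.empMean f m ω (fun o => stackedJac ψ o (gammaStarAll ψ μ β) p p') -
    ∫ o, stackedJac ψ o (gammaStarAll ψ μ β) p p' ∂μ|) * (C * D.errBound f ψ μ β m ω) +
  (∑ j, D.empMean f m ω fun o => estEnv ψ j o (gammaStar ψ μ β j)) *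
    (C * D.errBound f ψ μ β m ω) ^ 2

lemma measurable_stackedJac (hψ : Measurable ψ) (γ : Fin J × (Fin 2 ⊕ Fin d) → ℝ)
    (p p' : Fin J × (Fin 2 ⊕ Fin d)) : Measurable fun o : Obs 𝓧 J => stackedJac ψ o γ p p' := by
  simp only [stackedJac, Matrix.of_apply]
  split_ifs
  · exact measurable_estJac hψ _ _ _ _
  · exact measurable_const

lemma memLp_stackedJac {μ : Measure (Obs 𝓧 J)} [IsProbabilityMeasure μ] (hreg : Regular ψ μ β)
    (hψ : Measurable ψ) (p p' : Fin J × (Fin 2 ⊕ Fin d)) :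
    MemLp (fun o => stackedJac ψ o (gammaStarAll ψ μ β) p p') 2 μ := by
  simp only [stackedJac, Matrix.of_apply]
  split_ifs
  · exact hreg.memLp_estJac hψ _ _ _
  · exact MemLp.zero'

/-- Since `√n` times the error bound is bounded in probability, the first term is `o_P(1) O_P(1)` by
the law of large numbers for the Jacobian. In the second, one of the two error factors absorbs `√n`
and the other tends to zero. -/
lemma IsAsymptotic.littleOP_sqrt_mul_linRem (hA : D.IsAsymptotic P ℱ Q q) (hf : Measurable f)
    (hψ : Measurable ψ) (hreg : Regular ψ (obsLaw Q f) β) (C : ℝ) (p : Fin J × (Fin 2 ⊕ Fin d)) :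
    LittleOP P fun m ω => √(D.Nbar m) * D.linRem f ψ (obsLaw Q f) β C m ω p := by
  have := isProbabilityMeasure_obsLaw (Q := Q) hf
  have h1 := (hA.bigOP_sqrt_mul_errBound hf hψ hreg).const_mul C
  have h2 := (hA.littleOP_errBound hf hψ hreg).const_mul C
  have h3 : LittleOP P fun m ω => ∑ p', |D.empMean f m ω (fun o =>
      stackedJac ψ o (gammaStarAll ψ (obsLaw Q f) β) p p') -
      ∫ o, stackedJac ψ o (gammaStarAll ψ (obsLaw Q f) β) p p' ∂(obsLaw Q f)| :=
    LittleOP.sum _ fun p' _ => (hA.littleOP_empMean_sub hf (measurable_stackedJac hψ _ p p')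
      (memLp_stackedJac hreg hψ p p')).abs
  have h4 : BigOP P fun m ω => ∑ j, D.empMean f m ω fun o =>
      estEnv ψ j o (gammaStar ψ (obsLaw Q f) β j) :=
    BigOP.sum _ fun j _ => hA.bigOP_empMean hf (measurable_estEnv hψ j _) (hreg.memLp_estEnv hψ j)
  refine ((h1.mul_littleOP h3).add ((h4.mul h1).mul_littleOP h2)).of_abs_le
    fun m ω => le_of_eq ?_
  congr 1
  rw [linRem]
  ring

/-- The stacked estimation error is linear in the empirical estimating function, up to a remainder
of second order. -/
lemma abs_gammaHat_sub_add_le {μ : Measure (Obs 𝓧 J)} {B c p : ℝ} {m : ℕ} {ω : Ω}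
    (hreg : Regular ψ μ β)
    (hG : D.IsGood f ψ μ β B c p m ω) (hB : 0 ≤ B) (hc : 0 < c) (hp : 0 < p)
    {b : Fin J × Fin d → ℝ} (hb : D.SolvesScore f ψ m ω b)
    (hsmall : B * (IsGood.errConst β B c p * D.errBound f ψ μ β m ω) ≤ 1)
    (r : Fin J × (Fin 2 ⊕ Fin d)) :
    let G := expMatrix μ fun o => stackedJac ψ o (gammaStarAll ψ μ β)
    |(D.gammaHat f ψ m ω b r.1 r.2 - gammaStarAll ψ μ β r) +
      ∑ s, G⁻¹ r s * D.empEst f ψ μ β m ω s.1 s.2| ≤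
      ∑ s, |G⁻¹ r s| * D.linRem f ψ μ β (IsGood.errConst β B c p) m ω s := by
  intro G
  set C := IsGood.errConst β B c p with hC
  have hC0 : 0 ≤ C := errConst_nonneg hB hc hp
  set R := C * D.errBound f ψ μ β m ω with hR
  have hR0 : 0 ≤ R := mul_nonneg hC0 (errBound_nonneg _ _ _)
  set e : Fin J × (Fin 2 ⊕ Fin d) → ℝ :=
    fun s => D.gammaHat f ψ m ω b s.1 s.2 - gammaStarAll ψ μ β s with he
  have heR : ‖e‖ ≤ R := (pi_norm_le_iff_of_nonneg hR0).2 fun s =>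
    (hG.abs_gammaHat_sub_le hB hc hp hb s.1 s.2).trans
      (mul_le_mul_of_nonneg_left (le_errBound μ m ω s.1) hC0)
  have hstk : ∀ o s, stackedEstFun ψ o (gammaStarAll ψ μ β + e) s =
      estFun ψ s.1 o (D.gammaHat f ψ m ω b s.1) s.2 := by
    intro o s
    have : (fun r => (gammaStarAll ψ μ β + e) (s.1, r)) = D.gammaHat f ψ m ω b s.1 := by
      funext r
      simp [he]
    rw [stackedEstFun, this]
  -- Average the second order expansion over the sample. The value at the estimate vanishes because
  -- it solves the empirical equations; replacing the empirical Jacobian by `G` costs the first term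
  -- of `linRem`, and the envelope gives the second.
  have hrem : ∀ s, |D.empEst f ψ μ β m ω s.1 s.2 + G.mulVec e s| ≤
      D.linRem f ψ μ β C m ω s := by
    intro s
    have h1 : |D.empMean f m ω fun o => stackedEstFun ψ o (gammaStarAll ψ μ β + e) s -
        stackedEstFun ψ o (gammaStarAll ψ μ β) s -
        (stackedJac ψ o (gammaStarAll ψ μ β)).mulVec e s| ≤
        D.empMean f m ω fun o => (∑ j, estEnv ψ j o (gammaStar ψ μ β j)) * ‖e‖ ^ 2 := by
      refine abs_empMean_le fun i => abs_stackedEstFun_sub_le ψ _ _ _ ?_ s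
      exact ((mul_le_mul_of_nonneg_right (hG.bound i) (norm_nonneg _)).trans
        (mul_le_mul_of_nonneg_left heR hB)).trans hsmall
    simp_rw [hstk, Matrix.mulVec, dotProduct] at h1
    rw [empMean_sub, empMean_sub, hG.empMean_estFun_gammaHat hp hb, empMean_sum, empMean_mul_const,
      empMean_sum] at h1
    simp_rw [empMean_mul_const] at h1
    have h2 : D.empEst f ψ μ β m ω s.1 s.2 + G.mulVec e s =
        -(0 - D.empMean f m ω (fun o => stackedEstFun ψ o (gammaStarAll ψ μ β) s) -
          ∑ s', D.empMean f m ω (fun o => stackedJac ψ o (gammaStarAll ψ μ β) s s') * e s') -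
        ∑ s', (D.empMean f m ω (fun o => stackedJac ψ o (gammaStarAll ψ μ β) s s') - G s s') * e s' := by
      simp_rw [sub_mul, Finset.sum_sub_distrib]
      simp only [Matrix.mulVec, dotProduct]
      have : D.empEst f ψ μ β m ω s.1 s.2 =
        D.empMean f m ω (fun o => stackedEstFun ψ o (gammaStarAll ψ μ β) s) := rfl
      rw [this]
      ring
    rw [h2, linRem, add_comm]
    refine (abs_sub _ _).trans (add_le_add ?_ ?_)
    · rw [abs_neg]
      refine h1.trans (mul_le_mul_of_nonneg_left (pow_le_pow_left₀ (norm_nonneg _) heR 2) ?_)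
      exact Finset.sum_nonneg fun j _ => empMean_nonneg fun _ => estEnv_nonneg _ _ _ _
    · rw [Finset.sum_mul]
      refine (Finset.abs_sum_le_sum_abs _ _).trans (Finset.sum_le_sum fun s' _ => ?_)
      rw [abs_mul]
      exact mul_le_mul_of_nonneg_left ((norm_le_pi_norm e s').trans heR) (abs_nonneg _)
  have hinv : e = G⁻¹.mulVec (G.mulVec e) := by
    rw [Matrix.mulVec_mulVec, Matrix.nonsing_inv_mul _ hreg.isUnit_det_expStackedJac,
      Matrix.one_mulVec]
  have h3 : e r + ∑ s, G⁻¹ r s * D.empEst f ψ μ β m ω s.1 s.2 =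
      ∑ s, G⁻¹ r s * (D.empEst f ψ μ β m ω s.1 s.2 + G.mulVec e s) := by
    conv_lhs => rw [hinv]
    simp only [mul_add, Finset.sum_add_distrib]
    rw [add_comm]
    rfl
  show |e r + _| ≤ _
  rw [h3]
  refine (Finset.abs_sum_le_sum_abs _ _).trans (Finset.sum_le_sum fun s _ => ?_)
  rw [abs_mul]
  exact mul_le_mul_of_nonneg_left (hrem s) (abs_nonneg _)

end Rounds

end Observational

/-! ### The influence function of the observational estimator and the sandwich matrix -/

section Influence

variable {𝓧 : Type*} {J d : ℕ} [MeasurableSpace 𝓧]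

/-- The matrix that maps the stacked estimating function to the (negative) influence function of the
observational estimator. -/
def sandwichFactor (ψ : 𝓧 → Fin d → ℝ) (μ : Measure (Obs 𝓧 J)) (β : Fin J × Fin d → ℝ) :
    Matrix (Fin J) (Fin J × (Fin 2 ⊕ Fin d)) ℝ :=
  (contrast : Matrix (Fin J) (Fin J × (Fin 2 ⊕ Fin d)) ℝ) *
    (expMatrix μ fun o => stackedJac ψ o (gammaStarAll ψ μ β))⁻¹

/-- The influence function of the observational estimator of intervention `j`. -/
def obsInfluence (ψ : 𝓧 → Fin d → ℝ) (μ : Measure (Obs 𝓧 J)) (β : Fin J × Fin d → ℝ) (j : Fin J)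
    (o : Obs 𝓧 J) : ℝ :=
  ∑ s, -sandwichFactor ψ μ β j s * estFun ψ s.1 o (gammaStar ψ μ β s.1) s.2

variable {ψ : 𝓧 → Fin d → ℝ} {μ : Measure (Obs 𝓧 J)} {β : Fin J × Fin d → ℝ}

lemma contrast_mulVec (u : Fin J × (Fin 2 ⊕ Fin d) → ℝ) (j : Fin J) :
    (contrast : Matrix (Fin J) (Fin J × (Fin 2 ⊕ Fin d)) ℝ).mulVec u j =
      u (j, Sum.inl 0) - u (j, Sum.inl 1) := by
  have h : ∀ s : Fin J × (Fin 2 ⊕ Fin d), (contrast : Matrix (Fin J) _ ℝ) j s * u s =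
      (if s = (j, Sum.inl 0) then u s else 0) - if s = (j, Sum.inl 1) then u s else 0 := by
    intro s
    simp only [contrast, Matrix.of_apply]
    by_cases h0 : s = (j, Sum.inl 0)
    · simp [h0]
    · by_cases h1 : s = (j, Sum.inl 1) <;> simp [h0, h1]
  simp only [Matrix.mulVec, dotProduct, h, Finset.sum_sub_distrib, Finset.sum_ite_eq',
    Finset.mem_univ, if_true]

lemma measurable_obsInfluence (hψ : Measurable ψ) (j : Fin J) :
    Measurable (obsInfluence ψ μ β j) :=
  Finset.measurable_fun_sum _ fun _ _ => (measurable_estFun hψ _ _ _).const_mul _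

namespace Regular

variable (hreg : Regular ψ μ β)

include hreg

lemma memLp_obsInfluence (hψ : Measurable ψ) (j : Fin J) : MemLp (obsInfluence ψ μ β j) 2 μ :=
  memLp_finsetSum _ fun s _ => (hreg.memLp_estFun hψ s.1 s.2).const_mul _

lemma integral_obsInfluence [IsProbabilityMeasure μ] (hψ : Measurable ψ) (j : Fin J) :
    ∫ o, obsInfluence ψ μ β j o ∂μ = 0 := by
  simp only [obsInfluence]
  rw [integral_finsetSum _ fun s _ =>
    ((hreg.memLp_estFun hψ s.1 s.2).integrable (by norm_num)).const_mul _]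
  refine Finset.sum_eq_zero fun s _ => ?_
  rw [integral_const_mul, hreg.integral_estFun, mul_zero]

/-- With `M = E G⁻¹` the influence vector is `-M U`, so its second moment matrix is `M P(U Uᵀ) Mᵀ`;
the signs cancel. -/
lemma integral_obsInfluence_mul (hψ : Measurable ψ) (i j : Fin J) :
    ∫ o, obsInfluence ψ μ β i o * obsInfluence ψ μ β j o ∂μ = Gam ψ μ β i j := by
  set M := sandwichFactor ψ μ β with hM
  set V := expMatrix μ fun o =>
    Matrix.vecMulVec (stackedEstFun ψ o (gammaStarAll ψ μ β))
      (stackedEstFun ψ o (gammaStarAll ψ μ β)) with hV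
  have h1 : Gam ψ μ β = M * V * M.transpose := by
    unfold Gam
    simp only [jacobian_stackedEstFun]
    rw [hM, hV, sandwichFactor, Matrix.transpose_mul]
    simp only [Matrix.mul_assoc]
  have hi : ∀ s s' : Fin J × (Fin 2 ⊕ Fin d), Integrable (fun o => M i s * M j s' *
      (estFun ψ s.1 o (gammaStar ψ μ β s.1) s.2 * estFun ψ s'.1 o (gammaStar ψ μ β s'.1) s'.2)) μ :=
    fun s s' => ((hreg.memLp_estFun hψ s.1 s.2).integrable_mul
      (hreg.memLp_estFun hψ s'.1 s'.2)).const_mul _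
  have h2 : ∀ o, obsInfluence ψ μ β i o * obsInfluence ψ μ β j o = ∑ s, ∑ s', M i s * M j s' *
      (estFun ψ s.1 o (gammaStar ψ μ β s.1) s.2 * estFun ψ s'.1 o (gammaStar ψ μ β s'.1) s'.2) := by
    intro o
    rw [obsInfluence, obsInfluence, Finset.sum_mul_sum]
    exact Finset.sum_congr rfl fun s _ => Finset.sum_congr rfl fun s' _ => by ring
  simp_rw [h2]
  rw [integral_finsetSum _ fun s _ => integrable_finsetSum _ fun s' _ => hi s s', h1]
  simp only [Matrix.mul_apply, Finset.sum_mul, Matrix.transpose_apply]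
  rw [Finset.sum_comm]
  refine Finset.sum_congr rfl fun s _ => ?_
  rw [integral_finsetSum _ fun s' _ => hi s s']
  refine Finset.sum_congr rfl fun s' _ => ?_
  rw [integral_const_mul]
  have h3 : V s s' = ∫ o, estFun ψ s.1 o (gammaStar ψ μ β s.1) s.2 *
      estFun ψ s'.1 o (gammaStar ψ μ β s'.1) s'.2 ∂μ := rfl
  rw [h3]
  ring

end Regular

end Influence

/-! ### Asymptotic linearity and measurability of the observational estimator -/

section Limit

variable {Ω 𝓧 𝓤 : Type*} {J d : ℕ} [mΩ : MeasurableSpace Ω] [MeasurableSpace 𝓧] [MeasurableSpace 𝓤]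
  {P : Measure Ω} [IsProbabilityMeasure P]
  {Q : Measure (UnitRec 𝓧 𝓤 J)} [IsProbabilityMeasure Q] {f : 𝓧 × 𝓤 → Fin J → Bool}
  {D : Rounds Ω 𝓧 𝓤 J} {ℱ : Filtration ℕ mΩ} {q : Fin J → ℝ} {ψ : 𝓧 → Fin d → ℝ}
  {β : Fin J × Fin d → ℝ}

namespace Rounds

/-- The observational estimator is asymptotically linear. -/
theorem IsAsymptotic.littleOP_tauO (hA : D.IsAsymptotic P ℱ Q q) (hf : Measurable f)
    (hψ : Measurable ψ) (hreg : Regular ψ (obsLaw Q f) β) {βhat : ℕ → Ω → Fin J × Fin d → ℝ}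
    (hβ : ∀ m, ∀ᵐ ω ∂P, (∃ b, D.SolvesScore f ψ m ω b) → D.SolvesScore f ψ m ω (βhat m ω))
    (j : Fin J) :
    LittleOP P fun m ω => √(D.Nbar m) * (D.tauO f ψ m ω (βhat m ω) j -
      (tauO1 ψ (obsLaw Q f) β j - tauO0 ψ (obsLaw Q f) β j)) -
      D.normSum (fun z => obsInfluence ψ (obsLaw Q f) β j (observe f z)) (fun _ _ => 0) m ω := by
  obtain ⟨B, hB, c, hc, p, hp, G, hGm, hGf, hG⟩ :=
    hA.sampled.exists_isGood hA.tendsto_Nbar hf hψ hreg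
  set μ := obsLaw Q f with hμ
  set C := IsGood.errConst β B c p with hC
  set Ginv := (expMatrix μ fun o => stackedJac ψ o (gammaStarAll ψ μ β))⁻¹ with hGinv
  -- On a good sample the score has a root, so the estimated coefficients do solve the score
  -- equation there; their arbitrary value elsewhere is asymptotically irrelevant.
  have hw : Whp P fun m => {ω | D.IsGood f ψ μ β B c p m ω ∧ D.SolvesScore f ψ m ω (βhat m ω)} := by
    have h1 : Whp P fun m => {ω | (ω ∈ G m → D.IsGood f ψ μ β B c p m ω) ∧
        ((∃ b, D.SolvesScore f ψ m ω b) → D.SolvesScore f ψ m ω (βhat m ω))} :=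
      whp_of_ae fun m => (hG m).and (hβ m)
    refine ((hGf.whp hA.tendsto_Nbar).inter h1).mono (Eventually.of_forall fun m ω hω => ?_)
    have h2 : (ω ∈ G m → D.IsGood f ψ μ β B c p m ω) ∧
        ((∃ b, D.SolvesScore f ψ m ω b) → D.SolvesScore f ψ m ω (βhat m ω)) := hω.2
    have h3 := h2.1 hω.1
    exact ⟨h3, h2.2 (h3.exists_solvesScore hB.le hc)⟩
  have hsm := ((hA.littleOP_errBound hf hψ hreg).const_mul (B * C)).whp one_pos
  have hbd : LittleOP P fun m ω => ∑ r : Fin 2,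
      ∑ s, |Ginv (j, Sum.inl r) s| * (√(D.Nbar m) * D.linRem f ψ μ β C m ω s) :=
    LittleOP.sum _ fun r _ => LittleOP.sum _ fun s _ =>
      (hA.littleOP_sqrt_mul_linRem hf hψ hreg C s).const_mul _
  refine hbd.of_le (hw.inter hsm) (Eventually.of_forall fun m ω hω => ?_)
  have hgood : D.IsGood f ψ μ β B c p m ω ∧ D.SolvesScore f ψ m ω (βhat m ω) := hω.1
  have hsmall : |B * C * D.errBound f ψ μ β m ω| < 1 := hω.2
  have hlin := fun r => abs_gammaHat_sub_add_le hreg hgood.1 hB.le hc hp hgood.2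
    (by rw [← mul_assoc]; exact (le_abs_self _).trans hsmall.le) r
  simp only [← hGinv, ← hC] at hlin
  have hinf : D.empMean f m ω (obsInfluence ψ μ β j) =
      -(∑ s, Ginv (j, Sum.inl 0) s * D.empEst f ψ μ β m ω s.1 s.2 -
        ∑ s, Ginv (j, Sum.inl 1) s * D.empEst f ψ μ β m ω s.1 s.2) := by
    have h1 : obsInfluence ψ μ β j = fun o => ∑ s, -sandwichFactor ψ μ β j s *
      estFun ψ s.1 o (gammaStar ψ μ β s.1) s.2 := rfl
    rw [h1, empMean_sum]
    simp_rw [empMean_const_mul]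
    rw [← Finset.sum_sub_distrib, ← Finset.sum_neg_distrib]
    refine Finset.sum_congr rfl fun s _ => ?_
    have h2 : sandwichFactor ψ μ β j s = Ginv (j, Sum.inl 0) s - Ginv (j, Sum.inl 1) s := by
      rw [← contrast_mulVec (fun s' => Ginv s' s) j]
      rfl
    rw [h2, empEst]
    ring
  have hs0 := Real.sqrt_nonneg (D.Nbar m)
  -- Nonnegativity is free: each weighted sum of remainders bounds an absolute value in `hlin`.
  have hpos : 0 ≤ ∑ r : Fin 2, ∑ s, |Ginv (j, Sum.inl r) s| *
      (√(D.Nbar m) * D.linRem f ψ μ β C m ω s) := by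
    refine Finset.sum_nonneg fun r _ => ?_
    have h1 := mul_nonneg hs0 ((abs_nonneg _).trans (hlin (j, Sum.inl r)))
    rw [Finset.mul_sum] at h1
    refine h1.trans (le_of_eq (Finset.sum_congr rfl fun s _ => by ring))
  rw [abs_of_nonneg hpos, ← sqrt_Nbar_mul_empMean (g := obsInfluence ψ μ β j), hinf, ← mul_sub,
    abs_mul, abs_of_nonneg hs0, tauO_eq_gammaHat, Fin.sum_univ_two]
  have h0 := hlin (j, Sum.inl 0)
  have h1 := hlin (j, Sum.inl 1)
  have hg0 : gammaStarAll ψ μ β (j, Sum.inl 0) = tauO1 ψ μ β j := rfl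
  have hg1 : gammaStarAll ψ μ β (j, Sum.inl 1) = tauO0 ψ μ β j := rfl
  rw [hg0] at h0
  rw [hg1] at h1
  have h2 := (abs_sub _ _).trans (add_le_add h0 h1)
  have h3 := mul_le_mul_of_nonneg_left h2 hs0
  rw [mul_add, Finset.mul_sum, Finset.mul_sum] at h3
  refine le_trans (le_of_eq ?_) (h3.trans (le_of_eq ?_))
  · congr 2
    ring
  · congr 1 <;> exact Finset.sum_congr rfl fun s _ => by ring

lemma measurable_empMean_param (hD : D.IsSampled P ℱ Q) (hf : Measurable f)
    {E : Type*} [MeasurableSpace E] {g : E → Obs 𝓧 J → ℝ} (hg : Measurable (Function.uncurry g))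
    {X : Ω → E} (hX : Measurable X) (m : ℕ) : Measurable fun ω => D.empMean f m ω (g (X ω)) := by
  have h : ∀ ω, D.empMean f m ω (g (X ω)) = (D.Nbar m)⁻¹ * ∑ ν ∈ Finset.range m,
    ∑ i : Fin (D.N ν), Function.uncurry g (X ω, observe f (D.obs ν i ω)) := fun ω => rfl
  simp_rw [h]
  refine (Finset.measurable_fun_sum _ fun ν _ => Finset.measurable_fun_sum _ fun i _ => ?_).const_mul _
  exact hg.comp (hX.prodMk ((measurable_observe hf).comp (hD.measurable_obs ν i)))

lemma measurable_tauO (hD : D.IsSampled P ℱ Q) (hf : Measurable f) (hψ : Measurable ψ)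
    {b : Ω → Fin J × Fin d → ℝ} (hb : Measurable b) (m : ℕ) (j : Fin J) :
    Measurable fun ω => D.tauO f ψ m ω (b ω) j := by
  have hη : Measurable fun x : (Fin J × Fin d → ℝ) × Obs 𝓧 J => eta ψ x.2.1 fun k => x.1 (j, k) := by
    refine measurable_sigmoid_comp (Finset.measurable_fun_sum _ fun k _ => ?_)
    exact ((measurable_feature hψ k).comp measurable_snd).mul
      ((measurable_pi_apply (j, k)).comp measurable_fst)
  have ha : Measurable fun x : (Fin J × Fin d → ℝ) × Obs 𝓧 J => val (x.2.2.1 j) :=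
    (measurable_status j).comp measurable_snd
  have hy : Measurable fun x : (Fin J × Fin d → ℝ) × Obs 𝓧 J => x.2.2.2 := by fun_prop
  have h1 := measurable_empMean_param hD hf
    (g := fun (b : Fin J × Fin d → ℝ) o => val (o.2.1 j) * o.2.2 / eta ψ o.1 fun k => b (j, k))
    (by unfold Function.uncurry; exact (ha.mul hy).div hη) hb m
  have h2 := measurable_empMean_param hD hf
    (g := fun (b : Fin J × Fin d → ℝ) o => val (o.2.1 j) / eta ψ o.1 fun k => b (j, k))
    (by unfold Function.uncurry; exact ha.div hη) hb m
  have h3 := measurable_empMean_param hD hf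
    (g := fun (b : Fin J × Fin d → ℝ) o =>
      (1 - val (o.2.1 j)) * o.2.2 / (1 - eta ψ o.1 fun k => b (j, k)))
    (by unfold Function.uncurry; exact ((ha.const_sub 1).mul hy).div (hη.const_sub 1)) hb m
  have h4 := measurable_empMean_param hD hf
    (g := fun (b : Fin J × Fin d → ℝ) o => (1 - val (o.2.1 j)) / (1 - eta ψ o.1 fun k => b (j, k)))
    (by unfold Function.uncurry; exact (ha.const_sub 1).div (hη.const_sub 1)) hb m
  exact (h1.div h2).sub (h3.div h4)

end Rounds

end Limit

/-! ### Convergence of the mean of the observational estimator -/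

section Expectation

variable {Ω 𝓧 𝓤 : Type*} {J d : ℕ} [mΩ : MeasurableSpace Ω] [MeasurableSpace 𝓧] [MeasurableSpace 𝓤]
  {P : Measure Ω} [IsProbabilityMeasure P]
  {Q : Measure (UnitRec 𝓧 𝓤 J)} [IsProbabilityMeasure Q] {f : 𝓧 × 𝓤 → Fin J → Bool}
  {D : Rounds Ω 𝓧 𝓤 J} {ℱ : Filtration ℕ mΩ} {ψ : 𝓧 → Fin d → ℝ}
  {β : Fin J × Fin d → ℝ}

namespace Rounds

/-- A weighted mean of outcomes is at most the Euclidean norm of the outcomes. -/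
lemma abs_weighted_mean_le {m : ℕ} {ω : Ω} {a w y : Obs 𝓧 J → ℝ} (ha : ∀ o, a o * a o = a o)
    (hw : ∀ o, 0 ≤ w o) :
    |D.empMean f m ω (fun o => a o * y o * w o) / D.empMean f m ω (fun o => a o * w o)| ≤
      √(D.Nbar m * D.empMean f m ω fun o => (a o * y o) ^ 2) := by
  set M := √(D.Nbar m * D.empMean f m ω fun o => (a o * y o) ^ 2) with hM
  have ha0 : ∀ o, 0 ≤ a o := fun o => by rw [← ha o]; exact mul_self_nonneg _
  rcases (D.Nbar_nonneg m).eq_or_lt with hn | hn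
  · rw [empMean_eq m ω fun o => a o * w o, ← hn, inv_zero, zero_mul, div_zero, abs_zero]
    exact Real.sqrt_nonneg _
  have hMi : ∀ i, |a (D.sample f m ω i) * y (D.sample f m ω i)| ≤ M := by
    intro i
    refine Real.abs_le_sqrt ?_
    rw [empMean_eq, mul_inv_cancel_left₀ hn.ne']
    exact Finset.single_le_sum
      (f := fun i => (a (D.sample f m ω i) * y (D.sample f m ω i)) ^ 2)
      (fun _ _ => sq_nonneg _) (Finset.mem_univ i)
  have hden : 0 ≤ D.empMean f m ω fun o => a o * w o :=
    empMean_nonneg fun i => mul_nonneg (ha0 _) (hw _)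
  rw [abs_div, abs_of_nonneg hden]
  refine div_le_of_le_mul₀ hden (Real.sqrt_nonneg _) ?_
  rw [← empMean_const_mul]
  refine abs_empMean_le fun i => ?_
  have h1 : a (D.sample f m ω i) * y (D.sample f m ω i) * w (D.sample f m ω i) =
      (a (D.sample f m ω i) * y (D.sample f m ω i)) *
        (a (D.sample f m ω i) * w (D.sample f m ω i)) := by
    nth_rewrite 1 [← ha]
    ring
  rw [h1, abs_mul, abs_of_nonneg (mul_nonneg (ha0 _) (hw _))]
  exact mul_le_mul_of_nonneg_right (hMi i) (mul_nonneg (ha0 _) (hw _))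

/-- The outcomes of the units with intervention `j` on (`b = true`) or off (`b = false`). -/
def armOutcome (j : Fin J) (b : Bool) (o : Obs 𝓧 J) : ℝ :=
  (if b then val (o.2.1 j) else 1 - val (o.2.1 j)) * o.2.2

/-- A normalized weighted mean never exceeds the largest outcome in absolute value. The bound does
not involve `b`, so it also holds where the coefficients are arbitrary. -/
lemma abs_tauO_le (m : ℕ) (ω : Ω) (b : Fin J × Fin d → ℝ) (j : Fin J) :
    |D.tauO f ψ m ω b j| ≤ √(D.Nbar m * D.empMean f m ω fun o => armOutcome j true o ^ 2) +
      √(D.Nbar m * D.empMean f m ω fun o => armOutcome j false o ^ 2) := by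
  refine (abs_sub _ _).trans (add_le_add ?_ ?_)
  · simp_rw [div_eta]
    exact abs_weighted_mean_le (y := fun o => o.2.2) (fun o => val_mul_self _)
      fun o => by positivity
  · simp_rw [div_one_sub_eta]
    exact abs_weighted_mean_le (a := fun o => 1 - val (o.2.1 j)) (y := fun o => o.2.2)
      (fun o => by cases o.2.1 j <;> simp) fun o => by positivity

/-- An integrable bound for the error of the observational estimator; `G` is the event on which the
sample is well behaved. -/
def devBound (D : Rounds Ω 𝓧 𝓤 J) (f : 𝓧 × 𝓤 → Fin J → Bool) (ψ : 𝓧 → Fin d → ℝ)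
    (μ : Measure (Obs 𝓧 J)) (β : Fin J × Fin d → ℝ) (C τ : ℝ) (G : ℕ → Set Ω) (j : Fin J) (m : ℕ)
    (ω : Ω) : ℝ :=
  C * (√(D.Nbar m) * ((d + 2) * ∑ r, D.empEst f ψ μ β m ω j r ^ 2) +
    (√(D.Nbar m))⁻¹ * D.empMean f m ω fun o => residEnv ψ μ β j o ^ 2) +
  (D.Nbar m)⁻¹ * (∑ b, D.empMean f m ω fun o => armOutcome j b o ^ 2) +
  (1 + |τ|) * (D.Nbar m ^ 2 * (G m)ᶜ.indicator (fun _ => (1 : ℝ)) ω)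

/-- Expand `(n⁻¹ √(n x) - n)² ≥ 0`. The weights are such that `n⁻¹ x` vanishes in mean when `x` is
an empirical second moment, while `n²` is compensated by the probability `o(n⁻²)` of a bad sample.
-/
lemma sqrt_mul_le {n x : ℝ} (hn : 0 < n) (hx : 0 ≤ x) : √(n * x) ≤ (n⁻¹ * x + n ^ 2) / 2 := by
  have h1 := Real.sq_sqrt (mul_nonneg hn.le hx)
  have h2 : 0 ≤ (n⁻¹ * √(n * x) - n) ^ 2 := sq_nonneg _
  have h3 : (n⁻¹ * √(n * x) - n) ^ 2 = n⁻¹ * x - 2 * √(n * x) + n ^ 2 := by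
    have : (n⁻¹ * √(n * x) - n) ^ 2 = n⁻¹ ^ 2 * √(n * x) ^ 2 - 2 * (n⁻¹ * n) * √(n * x) + n ^ 2 := by
      ring
    rw [this, h1, inv_mul_cancel₀ hn.ne']
    field_simp
  linarith

/-- On `G` the product is separated by `2 S V ≤ √n S² + V² / √n`, so that only second moments are
needed; off `G` the crude bound by the outcomes is used, with `|τ| ≤ |τ| n²`. -/
lemma abs_tauO_sub_le_devBound {μ : Measure (Obs 𝓧 J)} {B c p : ℝ} (hB : 0 ≤ B) (hc : 0 < c)
    (hp : 0 < p) {m : ℕ} (hm : 1 ≤ D.Nbar m) {ω : Ω} {G : ℕ → Set Ω} {b : Fin J × Fin d → ℝ}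
    (h : ω ∈ G m → D.IsGood f ψ μ β B c p m ω ∧ D.SolvesScore f ψ m ω b) (j : Fin J) :
    |D.tauO f ψ m ω b j - (tauO1 ψ μ β j - tauO0 ψ μ β j)| ≤ D.devBound f ψ μ β
      (IsGood.errConst β B c p) (tauO1 ψ μ β j - tauO0 ψ μ β j) G j m ω := by
  have hn : 0 < D.Nbar m := by linarith
  have hs : 0 < √(D.Nbar m) := Real.sqrt_pos.2 hn
  set C := IsGood.errConst β B c p with hC
  have hC0 : 0 ≤ C := errConst_nonneg hB hc hp
  set τ := tauO1 ψ μ β j - tauO0 ψ μ β j with hτ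
  have hpos1 : 0 ≤ D.empMean f m ω fun o => residEnv ψ μ β j o ^ 2 :=
    empMean_nonneg fun _ => sq_nonneg _
  have hpos2 : ∀ b, 0 ≤ D.empMean f m ω fun o => armOutcome j b o ^ 2 :=
    fun b => empMean_nonneg fun _ => sq_nonneg _
  have hpos3 : 0 ≤ ∑ r, D.empEst f ψ μ β m ω j r ^ 2 := Finset.sum_nonneg fun _ _ => sq_nonneg _
  unfold devBound
  by_cases hω : ω ∈ G m
  · obtain ⟨hG, hb⟩ := h hω
    have h0 := hG.abs_gammaHat_sub_le hB hc hp hb j (Sum.inl 0)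
    have h1 := hG.abs_gammaHat_sub_le hB hc hp hb j (Sum.inl 1)
    rw [gammaStar_inl_zero] at h0
    rw [gammaStar_inl_one] at h1
    rw [← hC] at h0 h1
    set S := ∑ r, |D.empEst f ψ μ β m ω j r| with hS
    set V := D.empMean f m ω (residEnv ψ μ β j) with hV
    have h2 : |D.tauO f ψ m ω b j - τ| ≤ C * (2 * (S * V)) := by
      have h3 : D.tauO f ψ m ω b j - τ = (D.gammaHat f ψ m ω b j (Sum.inl 0) - tauO1 ψ μ β j) -
          (D.gammaHat f ψ m ω b j (Sum.inl 1) - tauO0 ψ μ β j) := by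
        rw [tauO_eq_gammaHat, hτ]; ring
      rw [h3]
      exact ((abs_sub _ _).trans (add_le_add h0 h1)).trans (le_of_eq (by ring))
    have hS2 : S ^ 2 ≤ (d + 2) * ∑ r, D.empEst f ψ μ β m ω j r ^ 2 := by
      have := sq_sum_le_card_mul_sum_sq (s := Finset.univ)
        (f := fun r => |D.empEst f ψ μ β m ω j r|)
      simp only [sq_abs, Finset.card_univ, Fintype.card_sum, Fintype.card_fin, Nat.cast_add,
        Nat.cast_ofNat] at this
      rw [hS, add_comm (d : ℝ)]
      exact this
    have hV2 : V ^ 2 ≤ D.empMean f m ω fun o => residEnv ψ μ β j o ^ 2 := sq_empMean_le hn ω _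
    have h4 : 2 * (S * V) ≤ √(D.Nbar m) * S ^ 2 + (√(D.Nbar m))⁻¹ * V ^ 2 := by
      have h5 : 0 ≤ (√(D.Nbar m))⁻¹ * (√(D.Nbar m) * S - V) ^ 2 := by positivity
      have h6 : (√(D.Nbar m))⁻¹ * (√(D.Nbar m) * S - V) ^ 2 =
          √(D.Nbar m) * S ^ 2 - 2 * (S * V) + (√(D.Nbar m))⁻¹ * V ^ 2 := by
        field_simp
        ring
      linarith
    have h7 : 2 * (S * V) ≤ √(D.Nbar m) * ((d + 2) * ∑ r, D.empEst f ψ μ β m ω j r ^ 2) +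
        (√(D.Nbar m))⁻¹ * D.empMean f m ω fun o => residEnv ψ μ β j o ^ 2 :=
      h4.trans (add_le_add (mul_le_mul_of_nonneg_left hS2 hs.le)
        (mul_le_mul_of_nonneg_left hV2 (inv_nonneg.2 hs.le)))
    have h8 : 0 ≤ (D.Nbar m)⁻¹ * (∑ b, D.empMean f m ω fun o => armOutcome j b o ^ 2) :=
      mul_nonneg (inv_nonneg.2 hn.le) (Finset.sum_nonneg fun b _ => hpos2 b)
    rw [Set.indicator_of_notMem (by simpa using hω), mul_zero, mul_zero, add_zero]
    exact (h2.trans (mul_le_mul_of_nonneg_left h7 hC0)).trans (le_add_of_nonneg_right h8)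
  · rw [Set.indicator_of_mem (by simpa using hω), mul_one]
    have h1 := abs_tauO_le (D := D) (f := f) (ψ := ψ) m ω b j
    have h2 := sqrt_mul_le hn (hpos2 true)
    have h3 := sqrt_mul_le hn (hpos2 false)
    have h4 : |D.tauO f ψ m ω b j - τ| ≤ |D.tauO f ψ m ω b j| + |τ| := abs_sub _ _
    have h5 : 0 ≤ C * (√(D.Nbar m) * ((d + 2) * ∑ r, D.empEst f ψ μ β m ω j r ^ 2) +
        (√(D.Nbar m))⁻¹ * D.empMean f m ω fun o => residEnv ψ μ β j o ^ 2) := by positivity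
    have h6 : |τ| ≤ |τ| * D.Nbar m ^ 2 :=
      le_mul_of_one_le_right (abs_nonneg _) (one_le_pow₀ hm)
    have h7 : 0 ≤ (D.Nbar m)⁻¹ * D.empMean f m ω fun o => armOutcome j true o ^ 2 :=
      mul_nonneg (inv_nonneg.2 hn.le) (hpos2 true)
    have h8 : 0 ≤ (D.Nbar m)⁻¹ * D.empMean f m ω fun o => armOutcome j false o ^ 2 :=
      mul_nonneg (inv_nonneg.2 hn.le) (hpos2 false)
    rw [Fintype.sum_bool, mul_add]
    linarith

/-- The outcome in an arm is its residual plus a bounded term. -/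
lemma memLp_armOutcome {μ : Measure (Obs 𝓧 J)} [IsProbabilityMeasure μ] (hreg : Regular ψ μ β)
    (hψ : Measurable ψ) (j : Fin J) (b : Bool) : MemLp (armOutcome j b) 2 μ := by
  have h1 : MemLp (fun o : Obs 𝓧 J => val (o.2.1 j)) 2 μ :=
    MemLp.of_bound (measurable_status j).aestronglyMeasurable 1 (ae_of_all _ fun o => abs_val_le _)
  have h2 : MemLp (fun o : Obs 𝓧 J => 1 - val (o.2.1 j)) 2 μ := (memLp_const 1).sub h1
  cases b
  · convert! (hreg.memLp_residOff hψ j).add (h2.const_mul (tauO0 ψ μ β j)) using 1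
    funext o
    simp only [armOutcome, residOff, Pi.add_apply]
    simp
    ring
  · convert! (hreg.memLp_residOn hψ j).add (h1.const_mul (tauO1 ψ μ β j)) using 1
    funext o
    simp only [armOutcome, residOn, Pi.add_apply]
    simp
    ring

section Integrals

variable (hD : D.IsSampled P ℱ Q) (hf : Measurable f) (hψ : Measurable ψ)
  (hreg : Regular ψ (obsLaw Q f) β)

include hD hf hψ hreg

lemma integrable_sq_empEst (m : ℕ) (j : Fin J) (r : Fin 2 ⊕ Fin d) :
    Integrable (fun ω => D.empEst f ψ (obsLaw Q f) β m ω j r ^ 2) P :=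
  (memLp_empMean hD hf (hreg.memLp_estFun hψ j r) m).integrable_sq

lemma integrable_devBound (C τ : ℝ) {G : ℕ → Set Ω} (hG : ∀ m, MeasurableSet (G m)) (j : Fin J)
    (m : ℕ) : Integrable (D.devBound f ψ (obsLaw Q f) β C τ G j m) P := by
  have := isProbabilityMeasure_obsLaw (Q := Q) hf
  have h1 := integrable_finsetSum (μ := P) Finset.univ fun r _ =>
    integrable_sq_empEst hD hf hψ hreg m j r
  have h2 := integrable_empMean hD hf (hreg.memLp_residEnv hψ j).integrable_sq m
  have h3 := integrable_finsetSum (μ := P) Finset.univ fun b _ =>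
    integrable_empMean hD hf (memLp_armOutcome hreg hψ j b).integrable_sq m
  have h4 : Integrable ((G m)ᶜ.indicator fun _ => (1 : ℝ)) P :=
    (integrable_const 1).indicator (hG m).compl
  exact ((((h1.const_mul _).const_mul _).add (h2.const_mul _)).const_mul C).add
    (h3.const_mul _) |>.add ((h4.const_mul _).const_mul _)

/-- The empirical estimating function is centred at the truth, so its mean square is of order `n⁻¹`;
against the factor `√n` this leaves `n^(-1/2)`. -/
lemma integral_devBound (C τ : ℝ) {G : ℕ → Set Ω} (hG : ∀ m, MeasurableSet (G m)) (j : Fin J)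
    {m : ℕ} (hm : 0 < D.Nbar m) :
    ∫ ω, D.devBound f ψ (obsLaw Q f) β C τ G j m ω ∂P =
      C * ((√(D.Nbar m))⁻¹ * ((d + 2) * ∑ r, ∫ o, estFun ψ j o (gammaStar ψ (obsLaw Q f) β j) r ^ 2
          ∂(obsLaw Q f)) + (√(D.Nbar m))⁻¹ * ∫ o, residEnv ψ (obsLaw Q f) β j o ^ 2 ∂(obsLaw Q f)) +
      (D.Nbar m)⁻¹ * (∑ b, ∫ o, armOutcome j b o ^ 2 ∂(obsLaw Q f)) +
      (1 + |τ|) * (D.Nbar m ^ 2 * P.real (G m)ᶜ) := by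
  have := isProbabilityMeasure_obsLaw (Q := Q) hf
  have h1' := fun r => integrable_sq_empEst hD hf hψ hreg m j r
  have h1 := integrable_finsetSum (μ := P) Finset.univ fun r _ => h1' r
  have h2 := integrable_empMean hD hf (hreg.memLp_residEnv hψ j).integrable_sq m
  have h3' := fun b => integrable_empMean hD hf (memLp_armOutcome hreg hψ j b).integrable_sq m
  have h3 := integrable_finsetSum (μ := P) Finset.univ fun b _ => h3' b
  have h4 : Integrable ((G m)ᶜ.indicator fun _ => (1 : ℝ)) P :=
    (integrable_const 1).indicator (hG m).compl
  unfold devBound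
  have hA := ((h1.const_mul ((d : ℝ) + 2)).const_mul (√(D.Nbar m)))
  have hB := h2.const_mul (√(D.Nbar m))⁻¹
  have hAB : Integrable (fun ω => C * (√(D.Nbar m) * ((d + 2) *
      ∑ r, D.empEst f ψ (obsLaw Q f) β m ω j r ^ 2) +
      (√(D.Nbar m))⁻¹ * D.empMean f m ω fun o => residEnv ψ (obsLaw Q f) β j o ^ 2)) P :=
    (hA.add hB).const_mul C
  have hE := h3.const_mul (D.Nbar m)⁻¹
  have hF := (h4.const_mul (D.Nbar m ^ 2)).const_mul (1 + |τ|)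
  have hABE : Integrable (fun ω => C * (√(D.Nbar m) * ((d + 2) *
      ∑ r, D.empEst f ψ (obsLaw Q f) β m ω j r ^ 2) +
      (√(D.Nbar m))⁻¹ * D.empMean f m ω fun o => residEnv ψ (obsLaw Q f) β j o ^ 2) +
      (D.Nbar m)⁻¹ * ∑ b, D.empMean f m ω fun o => armOutcome j b o ^ 2) P := hAB.add hE
  rw [integral_add hABE hF, integral_add hAB hE, integral_const_mul, integral_add hA hB,
    integral_const_mul, integral_const_mul, integral_const_mul, integral_const_mul,
    integral_const_mul, integral_const_mul, integral_finsetSum _ fun r _ => h1' r,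
    integral_finsetSum _ fun b _ => h3' b, integral_indicator_const _ (hG m).compl,
    integral_empMean hD hf (hreg.memLp_residEnv hψ j).integrable_sq hm]
  simp_rw [integral_empMean hD hf (memLp_armOutcome hreg hψ j _).integrable_sq hm]
  have h5 : ∀ r, ∫ ω, D.empEst f ψ (obsLaw Q f) β m ω j r ^ 2 ∂P = (D.Nbar m)⁻¹ *
      ∫ o, estFun ψ j o (gammaStar ψ (obsLaw Q f) β j) r ^ 2 ∂(obsLaw Q f) := fun r =>
    integral_sq_empMean hD hf (hreg.memLp_estFun hψ j r) (hreg.integral_estFun j r) hm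
  simp_rw [h5]
  rw [← Finset.mul_sum, smul_eq_mul, mul_one]
  have h6 : √(D.Nbar m) * (D.Nbar m)⁻¹ = (√(D.Nbar m))⁻¹ := by
    have h' := Real.sqrt_pos.2 hm
    rw [← div_eq_mul_inv, div_eq_iff hm.ne', ← div_eq_inv_mul, eq_div_iff h'.ne',
      Real.mul_self_sqrt hm.le]
  congr 4
  rw [mul_left_comm ((d : ℝ) + 2), ← mul_assoc, h6]

/-- The expectation of the observational estimator converges to its population value. -/
theorem tendsto_integral_tauO (hN : Tendsto D.Nbar atTop atTop)
    {βhat : ℕ → Ω → Fin J × Fin d → ℝ} (hβm : ∀ m, Measurable (βhat m))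
    (hβ : ∀ m, ∀ᵐ ω ∂P, (∃ b, D.SolvesScore f ψ m ω b) → D.SolvesScore f ψ m ω (βhat m ω))
    (j : Fin J) :
    Tendsto (fun m => ∫ ω, D.tauO f ψ m ω (βhat m ω) j ∂P) atTop
      (𝓝 (tauO1 ψ (obsLaw Q f) β j - tauO0 ψ (obsLaw Q f) β j)) := by
  obtain ⟨B, hB, c, hc, p, hp, G, hGm, hGf, hG⟩ := hD.exists_isGood hN hf hψ hreg
  set μ := obsLaw Q f with hμ
  set C := IsGood.errConst β B c p with hC
  set τ := tauO1 ψ μ β j - tauO0 ψ μ β j with hτ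
  have hlim : Tendsto (fun m => C * ((√(D.Nbar m))⁻¹ * ((d + 2) * ∑ r,
      ∫ o, estFun ψ j o (gammaStar ψ μ β j) r ^ 2 ∂μ) +
      (√(D.Nbar m))⁻¹ * ∫ o, residEnv ψ μ β j o ^ 2 ∂μ) +
      (D.Nbar m)⁻¹ * (∑ b, ∫ o, armOutcome j b o ^ 2 ∂μ) +
      (1 + |τ|) * (D.Nbar m ^ 2 * P.real (G m)ᶜ)) atTop (𝓝 0) := by
    have h1 := tendsto_inv_sqrt hN
    have h2 := tendsto_inv_atTop_zero.comp hN
    have h3 := ((((h1.mul_const ((d + 2) * ∑ r,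
      ∫ o, estFun ψ j o (gammaStar ψ μ β j) r ^ 2 ∂μ)).add
      (h1.mul_const (∫ o, residEnv ψ μ β j o ^ 2 ∂μ))).const_mul C).add
      (h2.mul_const (∑ b, ∫ o, armOutcome j b o ^ 2 ∂μ))).add
      ((show Tendsto (fun m => D.Nbar m ^ 2 * P.real (G m)ᶜ) atTop (𝓝 0) from hGf).const_mul
        (1 + |τ|))
    simpa using h3
  rw [tendsto_iff_dist_tendsto_zero]
  refine squeeze_zero' (Eventually.of_forall fun m => dist_nonneg) ?_ hlim
  filter_upwards [hN.eventually_ge_atTop 1] with m hm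
  have hm0 : 0 < D.Nbar m := by linarith
  rw [← integral_devBound hD hf hψ hreg C τ hGm j hm0]
  have hbd : ∀ᵐ ω ∂P, |D.tauO f ψ m ω (βhat m ω) j - τ| ≤ D.devBound f ψ μ β C τ G j m ω := by
    filter_upwards [hG m, hβ m] with ω h1 h2
    exact abs_tauO_sub_le_devBound hB.le hc hp hm
      (fun hω => ⟨h1 hω, h2 ((h1 hω).exists_solvesScore hB.le hc)⟩) j
  have hint := integrable_devBound hD hf hψ hreg C τ hGm j m
  have hmeas := measurable_tauO hD hf hψ (hβm m) m j
  have hi1 : Integrable (fun ω => D.tauO f ψ m ω (βhat m ω) j - τ) P :=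
    hint.mono' (hmeas.sub_const τ).aestronglyMeasurable hbd
  have hi2 : Integrable (fun ω => D.tauO f ψ m ω (βhat m ω) j) P := by
    refine (hi1.add (integrable_const τ)).congr (ae_of_all _ fun ω => ?_)
    simp
  have h1 : ∫ ω, D.tauO f ψ m ω (βhat m ω) j ∂P - τ = ∫ ω, (D.tauO f ψ m ω (βhat m ω) j - τ) ∂P := by
    rw [integral_sub hi2 (integrable_const τ)]
    simp
  rw [Real.dist_eq, h1, ← Real.norm_eq_abs]
  exact norm_integral_le_of_norm_le hint hbd

end Integrals

end Rounds

end Expectation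

/-! ### The hat matrix of the least squares problem -/

section LeastSquares

variable {J pv : ℕ} {Ψ : Matrix (Fin J) (Fin pv) ℝ} {T : Finset (Fin J)}

/-- The matrix `Ψ` with the rows outside `T` replaced by zero. -/
def maskRows (Ψ : Matrix (Fin J) (Fin pv) ℝ) (T : Finset (Fin J)) : Matrix (Fin J) (Fin pv) ℝ :=
  Matrix.of fun j k => if j ∈ T then Ψ j k else 0

lemma hat_eq : hat Ψ T = Ψ * (gram Ψ T)⁻¹ * (maskRows Ψ T).transpose := rfl

lemma maskRows_transpose_mulVec (y : Fin J → ℝ) (k : Fin pv) :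
    (maskRows Ψ T).transpose.mulVec y k = ∑ j ∈ T, Ψ j k * y j := by
  simp only [Matrix.mulVec, dotProduct, Matrix.transpose_apply, maskRows, Matrix.of_apply, ite_mul,
    zero_mul, Finset.sum_ite_mem, Finset.univ_inter]

lemma maskRows_transpose_mul : (maskRows Ψ T).transpose * Ψ = gram Ψ T := by
  ext k l
  have h := maskRows_transpose_mulVec (Ψ := Ψ) (T := T) (fun j => Ψ j l) k
  rw [Matrix.mul_apply]
  refine h.trans ?_
  simp only [gram, Matrix.mul_apply, Matrix.transpose_apply, Matrix.submatrix_apply, id]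
  exact (Finset.sum_coe_sort T fun j => Ψ j k * Ψ j l).symm

/-- `Ψ̃ᵀ Ψ` is the Gram matrix on `T`, which its inverse cancels. Thus `1 - H` annihilates every
bias of the form `Ψ θ`. -/
lemma hat_mul (hgram : IsUnit (gram Ψ T).det) : hat Ψ T * Ψ = Ψ := by
  rw [hat_eq, Matrix.mul_assoc, maskRows_transpose_mul, Matrix.mul_assoc,
    Matrix.nonsing_inv_mul _ hgram, Matrix.mul_one]

lemma hat_apply_of_notMem {i j : Fin J} (hj : j ∉ T) : hat Ψ T i j = 0 := by
  rw [hat_eq, Matrix.mul_apply]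
  refine Finset.sum_eq_zero fun k _ => ?_
  simp [maskRows, hj]

/-- At `t = B / (A + 1)` the quadratic is strictly negative unless `B = 0`; the denominator `A + 1`
also covers `A = 0`. -/
lemma eq_zero_of_forall_quadratic_nonneg {A B : ℝ} (hA : 0 ≤ A)
    (h : ∀ t : ℝ, 0 ≤ t ^ 2 * A - 2 * t * B) : B = 0 := by
  have h1 := h (B / (A + 1))
  have hA1 : 0 < A + 1 := by linarith
  have h2 : (B / (A + 1)) ^ 2 * A - 2 * (B / (A + 1)) * B = -(B ^ 2 * (A + 2) / (A + 1) ^ 2) := by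
    field_simp
    ring
  rw [h2] at h1
  have h3 : 0 ≤ B ^ 2 * (A + 2) / (A + 1) ^ 2 := by positivity
  have h4 : B ^ 2 * (A + 2) / (A + 1) ^ 2 = 0 := by linarith
  rw [div_eq_zero_iff] at h4
  rcases h4 with h4 | h4
  · rcases mul_eq_zero.1 h4 with h5 | h5
    · exact pow_eq_zero_iff two_ne_zero |>.1 h5
    · linarith
  · exact absurd h4 (pow_pos hA1 2).ne'

/-- The fitted values of the least squares problem are given by the hat matrix. -/
lemma mulVec_eq_hat_mulVec (hgram : IsUnit (gram Ψ T).det) {y : Fin J → ℝ} {θ : Fin pv → ℝ}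
    (hθ : ∀ θ', ∑ j ∈ T, (y j - Ψ j ⬝ᵥ θ) ^ 2 ≤ ∑ j ∈ T, (y j - Ψ j ⬝ᵥ θ') ^ 2) :
    Ψ.mulVec θ = (hat Ψ T).mulVec y := by
  -- The normal equations, from minimality along each line `θ + t u`.
  have hnormal : ∀ u : Fin pv → ℝ, ∑ j ∈ T, (y j - Ψ j ⬝ᵥ θ) * (Ψ j ⬝ᵥ u) = 0 := by
    intro u
    refine eq_zero_of_forall_quadratic_nonneg (A := ∑ j ∈ T, (Ψ j ⬝ᵥ u) ^ 2)
      (Finset.sum_nonneg fun _ _ => sq_nonneg _) fun t => ?_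
    have h1 := hθ (θ + t • u)
    have h2 : ∑ j ∈ T, (y j - Ψ j ⬝ᵥ (θ + t • u)) ^ 2 = ∑ j ∈ T, (y j - Ψ j ⬝ᵥ θ) ^ 2 +
        (t ^ 2 * ∑ j ∈ T, (Ψ j ⬝ᵥ u) ^ 2 - 2 * t * ∑ j ∈ T, (y j - Ψ j ⬝ᵥ θ) * (Ψ j ⬝ᵥ u)) := by
      simp only [Finset.mul_sum, ← Finset.sum_add_distrib, ← Finset.sum_sub_distrib, dotProduct_add,
        dotProduct_smul, smul_eq_mul]
      exact Finset.sum_congr rfl fun j _ => by ring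
    rw [h2] at h1
    linarith
  have h1 : (gram Ψ T).mulVec θ = (maskRows Ψ T).transpose.mulVec y := by
    rw [← maskRows_transpose_mul, ← Matrix.mulVec_mulVec]
    funext k
    rw [maskRows_transpose_mulVec, maskRows_transpose_mulVec]
    have h2 := hnormal (Pi.single k 1)
    simp only [dotProduct_single, mul_one] at h2
    rw [← sub_eq_zero, ← Finset.sum_sub_distrib, ← neg_eq_zero, ← Finset.sum_neg_distrib, ← h2]
    refine Finset.sum_congr rfl fun j _ => ?_
    simp only [Matrix.mulVec]
    ring
  have h2 : θ = (gram Ψ T)⁻¹.mulVec ((maskRows Ψ T).transpose.mulVec y) := by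
    rw [← h1, Matrix.mulVec_mulVec, Matrix.nonsing_inv_mul _ hgram, Matrix.one_mulVec]
  rw [hat_eq, ← Matrix.mulVec_mulVec, ← Matrix.mulVec_mulVec, ← h2]

end LeastSquares

/-! ### Joint covariance of the two families of estimators -/

section Combination

variable {Ω 𝓧 𝓤 : Type*} {J d : ℕ} [mΩ : MeasurableSpace Ω] [MeasurableSpace 𝓧] [MeasurableSpace 𝓤]
  {P : Measure Ω} [IsProbabilityMeasure P]
  {Q : Measure (UnitRec 𝓧 𝓤 J)} [IsProbabilityMeasure Q] {f : 𝓧 × 𝓤 → Fin J → Bool}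
  {D : Rounds Ω 𝓧 𝓤 J} {ℱ : Filtration ℕ mΩ} {q : Fin J → ℝ} {ψ : 𝓧 → Fin d → ℝ}
  {β : Fin J × Fin d → ℝ}

lemma integral_sum_mul_sum {Z ι : Type*} [Fintype ι] [MeasurableSpace Z] {μ : Measure Z}
    {g : ι → Z → ℝ} (hg : ∀ i, MemLp (g i) 2 μ) (t u : ι → ℝ) :
    ∫ z, (∑ i, t i * g i z) * (∑ i, u i * g i z) ∂μ =
      ∑ i, ∑ k, t i * u k * ∫ z, g i z * g k z ∂μ := by
  have h1 : ∀ z, (∑ i, t i * g i z) * (∑ i, u i * g i z) =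
      ∑ i, ∑ k, t i * u k * (g i z * g k z) := fun z => by
    rw [Finset.sum_mul_sum]
    exact Finset.sum_congr rfl fun i _ => Finset.sum_congr rfl fun k _ => by ring
  simp_rw [h1]
  have hi : ∀ i k, Integrable (fun z => t i * u k * (g i z * g k z)) μ := fun i k =>
    ((hg i).integrable_mul (hg k)).const_mul _
  rw [integral_finsetSum _ fun i _ => integrable_finsetSum _ fun k _ => hi i k]
  refine Finset.sum_congr rfl fun i _ => ?_
  rw [integral_finsetSum _ fun k _ => hi i k]
  exact Finset.sum_congr rfl fun k _ => integral_const_mul _ _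

namespace Rounds

lemma limCov_linear {ι κ : Type*} [Fintype ι] {g : ι → UnitRec 𝓧 𝓤 J → ℝ}
    {h : ι → Fin J → UnitRec 𝓧 𝓤 J × Bool → ℝ} (hc : ∀ i, IsCentered Q (g i) (h i))
    (t : Matrix κ ι ℝ) :
    limCov Q q (fun a z => ∑ i, t a i * g i z) (fun a j p => ∑ i, t a i * h i j p) =
      t * limCov Q q g h * t.transpose := by
  ext a b
  have hL : limCov Q q (fun a z => ∑ i, t a i * g i z) (fun a j p => ∑ i, t a i * h i j p) a b =
      ∑ i, ∑ k, t a i * limCov Q q g h i k * t b k := by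
    simp only [limCov, Matrix.of_apply]
    rw [integral_sum_mul_sum fun i => (hc i).memLp_unit]
    simp_rw [fun j => integral_sum_mul_sum (fun i => (hc i).memLp_arm j)]
    simp only [mul_add, add_mul, Finset.sum_add_distrib, Finset.mul_sum, Finset.sum_mul]
    congr 1
    · exact Finset.sum_congr rfl fun i _ => Finset.sum_congr rfl fun k _ => by ring
    · rw [Finset.sum_comm]
      refine Finset.sum_congr rfl fun i _ => ?_
      rw [Finset.sum_comm]
      exact Finset.sum_congr rfl fun k _ => Finset.sum_congr rfl fun j _ => by ring
  rw [hL, Matrix.mul_apply, Finset.sum_comm]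
  refine Finset.sum_congr rfl fun k _ => ?_
  rw [Matrix.mul_apply, Finset.sum_mul]
  rfl

variable (T : Finset (Fin J))

/-- The observational influence functions, followed by zeros for the RCT estimators. -/
def unitInfluence (Q : Measure (UnitRec 𝓧 𝓤 J)) (f : 𝓧 × 𝓤 → Fin J → Bool) (ψ : 𝓧 → Fin d → ℝ)
    (β : Fin J × Fin d → ℝ) : Fin J ⊕ T → UnitRec 𝓧 𝓤 J → ℝ :=
  Sum.elim (fun j z => obsInfluence ψ (obsLaw Q f) β j (observe f z)) fun _ _ => 0

/-- Zeros for the observational estimators, followed by the RCT influence functions. -/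
def armInfluence (Q : Measure (UnitRec 𝓧 𝓤 J)) (f : 𝓧 × 𝓤 → Fin J → Bool) (q : Fin J → ℝ) :
    Fin J ⊕ T → Fin J → UnitRec 𝓧 𝓤 J × Bool → ℝ :=
  Sum.elim (fun _ _ _ => 0) fun j => arm j (rctInfluence Q f (q j) j)

variable {T}

lemma isCentered_influence (hf : Measurable f) (hψ : Measurable ψ)
    (hreg : Regular ψ (obsLaw Q f) β) (hvar : ∀ j ∈ T, ∀ b, MemLp (policyOutcome f j b) 2 Q)
    (s : Fin J ⊕ T) : IsCentered Q (unitInfluence T Q f ψ β s) (armInfluence T Q f q s) := by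
  have := isProbabilityMeasure_obsLaw (Q := Q) hf
  rcases s with j | j
  · exact isCentered_observe hf (measurable_obsInfluence hψ j) (hreg.memLp_obsInfluence hψ j)
      (hreg.integral_obsInfluence hψ j)
  · exact isCentered_arm _ (measurable_rctInfluence hf _ _) (memLp_rctInfluence (hvar j j.2) _)
      (integral_rctInfluence (hvar j j.2) _)

/-- Different arms have disjoint support in `W`, hence no covariance. On the diagonal the weight `q
j` meets the factor `1 / q j²` of the influence function and leaves `1 / q j`. -/
lemma limCov_rct (hf : Measurable f) (hvar : ∀ j ∈ T, ∀ b, MemLp (policyOutcome f j b) 2 Q)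
    (hq : ∀ j ∈ T, 0 < q j) :
    limCov Q q (fun _ : T => fun _ => 0) (fun j : T => arm j (rctInfluence Q f (q j) j)) =
      (Ups Q f q).submatrix Subtype.val Subtype.val := by
  ext i k
  simp only [limCov, Matrix.of_apply, mul_zero, integral_zero, zero_add, Matrix.submatrix_apply, Ups]
  rw [Finset.sum_eq_single (i : Fin J)]
  · rw [arm_self]
    by_cases hik : i = k
    · subst hik
      rw [arm_self, integral_rctInfluence_sq hf (hvar i i.2), Matrix.diagonal_apply_eq]
      have := (hq i i.2).ne'
      field_simp
    · have hik' : (i : Fin J) ≠ k := fun h => hik (Subtype.ext h)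
      rw [arm_of_ne hik', Matrix.diagonal_apply_ne _ hik']
      simp
  · intro j _ hj
    rw [arm_of_ne hj]
    simp
  · simp

lemma limCov_obs (hf : Measurable f) (hψ : Measurable ψ) (hreg : Regular ψ (obsLaw Q f) β) :
    limCov Q q (fun j z => obsInfluence ψ (obsLaw Q f) β j (observe f z)) (fun _ _ _ => 0) =
      Gam ψ (obsLaw Q f) β := by
  ext i k
  simp only [limCov, Matrix.of_apply, mul_zero, integral_zero, Finset.sum_const_zero, add_zero]
  rw [← hreg.integral_obsInfluence_mul hψ]
  exact integral_observe hf ((measurable_obsInfluence hψ i).mul (measurable_obsInfluence hψ k))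

/-- Off-diagonal blocks vanish because in each product one factor is zero, on the observational
units and on the randomized ones alike. -/
lemma limCov_influence (hf : Measurable f) (hψ : Measurable ψ) (hreg : Regular ψ (obsLaw Q f) β)
    (hvar : ∀ j ∈ T, ∀ b, MemLp (policyOutcome f j b) 2 Q) (hq : ∀ j ∈ T, 0 < q j) :
    limCov Q q (unitInfluence T Q f ψ β) (armInfluence T Q f q) =
      Matrix.fromBlocks (Gam ψ (obsLaw Q f) β) 0 0
        ((Ups Q f q).submatrix Subtype.val Subtype.val) := by
  ext s s'
  rcases s with j | j <;> rcases s' with k | k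
  · rw [Matrix.fromBlocks_apply₁₁, ← limCov_obs (q := q) hf hψ hreg]
    rfl
  · simp [limCov, unitInfluence, armInfluence]
  · simp [limCov, unitInfluence, armInfluence]
  · rw [Matrix.fromBlocks_apply₂₂, ← limCov_rct hf hvar hq]
    rfl

/-- The coefficients of the de-biased estimator in terms of the observational and the RCT
estimators. -/
def debiasCoef (T : Finset (Fin J)) (ρ : ℝ) (H : Matrix (Fin J) (Fin J) ℝ) :
    Matrix (Fin J) (Fin J ⊕ T) ℝ :=
  Matrix.of fun i => Sum.elim (fun k => √(1 - ρ) * (1 - H) i k) fun k => √ρ * H i k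

/-- The block structure separates the two quadratic forms. Since the columns of `H` outside `T`
vanish, the sum over `T` is the full sum, and the diagonal entries outside `T` do not matter. -/
lemma debiasCoef_mul_mul {ρ : ℝ} (hρ : ρ ∈ Set.Ioo (0 : ℝ) 1) {H Γ : Matrix (Fin J) (Fin J) ℝ}
    (hH : ∀ i, ∀ j ∉ T, H i j = 0) {u : Fin J → ℝ} :
    debiasCoef T ρ H * (Matrix.fromBlocks Γ 0 0
      ((Matrix.diagonal u).submatrix (Subtype.val : T → Fin J) Subtype.val) :
        Matrix (Fin J ⊕ T) (Fin J ⊕ T) ℝ) *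
      (debiasCoef T ρ H).transpose = Sig ρ H Γ (Matrix.diagonal u) := by
  have h1 : √(1 - ρ) * √(1 - ρ) = 1 - ρ := Real.mul_self_sqrt (by linarith [hρ.2])
  have h2 : √ρ * √ρ = ρ := Real.mul_self_sqrt hρ.1.le
  have hdiag : (Matrix.diagonal u).submatrix (Subtype.val : T → Fin J) Subtype.val =
      Matrix.diagonal fun j : T => u j := by
    ext i k
    by_cases hik : i = k
    · subst hik; simp
    · rw [Matrix.diagonal_apply_ne _ hik, Matrix.submatrix_apply,
        Matrix.diagonal_apply_ne _ fun h => hik (Subtype.ext h)]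
  ext i j
  rw [hdiag, Sig, Matrix.add_apply, Matrix.smul_apply, Matrix.smul_apply, Matrix.mul_apply,
    Matrix.mul_apply, Matrix.mul_apply, Fintype.sum_sum_type, smul_eq_mul, smul_eq_mul]
  congr 1
  · rw [Finset.mul_sum]
    refine Finset.sum_congr rfl fun k _ => ?_
    rw [Matrix.mul_apply, Matrix.mul_apply, Fintype.sum_sum_type]
    simp only [debiasCoef, Matrix.of_apply, Sum.elim_inl, Sum.elim_inr, Matrix.fromBlocks_apply₁₁,
      Matrix.fromBlocks_apply₂₁, Matrix.zero_apply, mul_zero, Finset.sum_const_zero, add_zero,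
      Matrix.transpose_apply]
    rw [Finset.sum_mul, Finset.sum_mul, Finset.mul_sum]
    refine Finset.sum_congr rfl fun l _ => ?_
    linear_combination ((1 - H) i l * Γ l k * (1 - H) j k) * h1
  · rw [← Finset.sum_subset (Finset.subset_univ T) (fun k _ hk => by
      rw [Matrix.transpose_apply, hH j k hk, mul_zero]), Finset.mul_sum, ← Finset.sum_coe_sort T]
    refine Finset.sum_congr rfl fun k _ => ?_
    rw [Matrix.mul_apply, Fintype.sum_sum_type, Matrix.mul_diagonal]
    simp only [debiasCoef, Matrix.of_apply, Sum.elim_inl, Sum.elim_inr, Matrix.fromBlocks_apply₁₂,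
      Matrix.fromBlocks_apply₂₂, Matrix.zero_apply, mul_zero, Finset.sum_const_zero, zero_add,
      Matrix.transpose_apply]
    rw [Finset.sum_eq_single k (fun l _ hl => by rw [Matrix.diagonal_apply_ne _ hl, mul_zero])
      (by simp), Matrix.diagonal_apply_eq]
    linear_combination (u k * H i k * H j k) * h2

end Rounds

/-- Write `a X - c Y = a (X - Y) + (a - c) Y`. -/
lemma LittleOP.mul_sub_mul {X Y : ℕ → Ω → ℝ} (hXY : LittleOP P fun m ω => X m ω - Y m ω)
    (hY : BigOP P Y) {a : ℕ → ℝ} {c : ℝ} (ha : Tendsto a atTop (𝓝 c)) :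
    LittleOP P fun m ω => a m * X m ω - c * Y m ω := by
  have h1 : LittleOP P fun m (_ : Ω) => a m - c :=
    littleOP_of_tendsto (by simpa using ha.sub_const c)
  have h2 : BigOP P fun m (_ : Ω) => a m := by
    refine (h1.bigOP.add (bigOP_const c)).of_abs_le fun m ω => ?_
    simp
  refine ((h2.mul_littleOP hXY).add (hY.mul_littleOP h1)).of_abs_le fun m ω => le_of_eq ?_
  congr 1
  ring

lemma inv_sqrt_inv_add_inv {n l : ℝ} (hn : 0 < n) (hl : 0 < l) :
    (√(n⁻¹ + l⁻¹))⁻¹ = √(l / (n + l)) * √n ∧ (√(n⁻¹ + l⁻¹))⁻¹ = √(n / (n + l)) * √l := by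
  rw [← Real.sqrt_inv]
  have h1 : (n⁻¹ + l⁻¹)⁻¹ = l / (n + l) * n := by field_simp; ring
  have h2 : (n⁻¹ + l⁻¹)⁻¹ = n / (n + l) * l := by field_simp; ring
  constructor
  · rw [h1, Real.sqrt_mul (by positivity)]
  · rw [h2, Real.sqrt_mul (by positivity)]

end Combination

/-! ### Asymptotic linearity of the de-biased estimator -/

section Debiased

variable {Ω 𝓧 𝓤 : Type*} {J d pv : ℕ} [mΩ : MeasurableSpace Ω] [MeasurableSpace 𝓧]
  [MeasurableSpace 𝓤] {P : Measure Ω} [IsProbabilityMeasure P]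
  {Q : Measure (UnitRec 𝓧 𝓤 J)} [IsProbabilityMeasure Q] {f : 𝓧 × 𝓤 → Fin J → Bool}
  {D : Rounds Ω 𝓧 𝓤 J} {ℱ : Filtration ℕ mΩ} {q : Fin J → ℝ} {ψ : 𝓧 → Fin d → ℝ}
  {β : Fin J × Fin d → ℝ} {T : Finset (Fin J)} {Ψ : Matrix (Fin J) (Fin pv) ℝ}

namespace Rounds

/-- With the exact fitted values on `T`, the error of the de-biased estimator is a linear
combination of the errors of the observational and the RCT estimators. -/
lemma debiased_sub_ate (hgram : IsUnit (gram Ψ T).det) {θstar : Fin pv → ℝ} {m : ℕ} {ω : Ω}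
    (hT : D.Sbar m ω = T) {b : Fin J × Fin d → ℝ} {θ : Fin pv → ℝ}
    (hθ : ∀ θ', D.lsCrit f ψ Ψ m ω b θ ≤ D.lsCrit f ψ Ψ m ω b θ') (i : Fin J) :
    D.debiased f ψ Ψ m ω b θ i - ate Q f i =
      (∑ k, (1 - hat Ψ T) i k *
        (D.tauO f ψ m ω b k - (ate Q f k + Ψ.mulVec θstar k))) +
      ∑ k : T, hat Ψ T i k * (D.tauR f m ω k - ate Q f k) := by
  rw [Finset.sum_coe_sort T fun k => hat Ψ T i k * (D.tauR f m ω k - ate Q f k),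
    Finset.sum_subset (Finset.subset_univ T) (fun k _ hk => by
      rw [hat_apply_of_notMem hk, zero_mul])]
  have h1 := congrFun (mulVec_eq_hat_mulVec hgram
    (y := fun j => D.tauO f ψ m ω b j - D.tauR f m ω j) (θ := θ) fun θ' => by
      simpa only [lsCrit, hT] using hθ θ') i
  -- `H Ψ = Ψ` lets the modelled bias be inserted in the observational errors at no cost.
  have h2 : ∑ k, hat Ψ T i k * Ψ.mulVec θstar k = Ψ.mulVec θstar i := by
    have := congrFun (Matrix.mulVec_mulVec θstar (hat Ψ T) Ψ) i
    rwa [hat_mul hgram] at this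
  have h3 : ∀ y : Fin J → ℝ, ∑ k, (1 - hat Ψ T) i k * y k = y i - ∑ k, hat Ψ T i k * y k :=
    fun y => by
      simp only [Matrix.sub_apply, sub_mul, Finset.sum_sub_distrib]
      congr 1
      exact congrFun (Matrix.one_mulVec y) i
  rw [h3, debiased, h1, ← h2]
  simp only [Matrix.mulVec, dotProduct]
  simp only [mul_sub, mul_add, Finset.sum_sub_distrib, Finset.sum_add_distrib]
  ring

/-- On the event that exactly `T` has been opened, the scaled error is a linear combination of the
two asymptotically linear families. Its coefficients depend on `m` only through the sample fractions
and converge to `debiasCoef`. -/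
lemma IsAsymptotic.littleOP_debiased (hA : D.IsAsymptotic P ℱ Q q) (hf : Measurable f)
    (hψ : Measurable ψ) (hreg : Regular ψ (obsLaw Q f) β)
    (hvar : ∀ j ∈ T, ∀ b, MemLp (policyOutcome f j b) 2 Q) (hq : ∀ j ∈ T, 0 < q j)
    (hT : ∀ m, ∀ᵐ ω ∂P, D.S m ω ⊆ T) {ρ : ℝ}
    (hρlim : Tendsto (fun m => D.Nbar m / (D.Nbar m + D.Lbar m)) atTop (𝓝 ρ))
    (hgram : IsUnit (gram Ψ T).det) {βhat : ℕ → Ω → Fin J × Fin d → ℝ}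
    (hβ : ∀ m, ∀ᵐ ω ∂P, (∃ b, D.SolvesScore f ψ m ω b) → D.SolvesScore f ψ m ω (βhat m ω))
    {θstar : Fin pv → ℝ} (hlim : ∀ j, tauO1 ψ (obsLaw Q f) β j - tauO0 ψ (obsLaw Q f) β j =
      ate Q f j + Ψ.mulVec θstar j)
    {θhat : ℕ → Ω → Fin pv → ℝ} (hθ : ∀ m, ∀ᵐ ω ∂P, ∀ θ,
      D.lsCrit f ψ Ψ m ω (βhat m ω) (θhat m ω) ≤ D.lsCrit f ψ Ψ m ω (βhat m ω) θ) (i : Fin J) :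
    LittleOP P fun m ω => (√((D.Nbar m)⁻¹ + (D.Lbar m)⁻¹))⁻¹ *
        (D.debiased f ψ Ψ m ω (βhat m ω) (θhat m ω) i - ate Q f i) -
      D.normSum (fun z => ∑ s, debiasCoef T ρ (hat Ψ T) i s * unitInfluence T Q f ψ β s z)
        (fun j p => ∑ s, debiasCoef T ρ (hat Ψ T) i s * armInfluence T Q f q s j p) m ω := by
  set est : Fin J ⊕ T → ℕ → Ω → ℝ := Sum.elim
    (fun j m ω => √(D.Nbar m) * (D.tauO f ψ m ω (βhat m ω) j -
      (tauO1 ψ (obsLaw Q f) β j - tauO0 ψ (obsLaw Q f) β j)))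
    (fun j m ω => √(D.Lbar m) * (D.tauR f m ω j - ate Q f j)) with hest
  set a : Fin J ⊕ T → ℕ → ℝ := Sum.elim
    (fun k m => √(D.Lbar m / (D.Nbar m + D.Lbar m)) * (1 - hat Ψ T) i k)
    (fun k m => √(D.Nbar m / (D.Nbar m + D.Lbar m)) * hat Ψ T i k) with ha
  have hlin : ∀ s, LittleOP P fun m ω => est s m ω -
      D.normSum (unitInfluence T Q f ψ β s) (armInfluence T Q f q s) m ω := by
    rintro (j | j)
    · exact hA.littleOP_tauO hf hψ hreg hβ j
    · exact hA.littleOP_tauR hf (hq j j.2) (hvar j j.2)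
  have hpos : ∀ᶠ m in atTop, 0 < D.Nbar m ∧ 0 < D.Lbar m :=
    (hA.tendsto_Nbar.eventually_gt_atTop 0).and (hA.tendsto_Lbar.eventually_gt_atTop 0)
  have hρlim' : Tendsto (fun m => D.Lbar m / (D.Nbar m + D.Lbar m)) atTop (𝓝 (1 - ρ)) := by
    refine (hρlim.const_sub 1).congr' ?_
    filter_upwards [hpos] with m hm
    have : D.Nbar m + D.Lbar m ≠ 0 := (add_pos hm.1 hm.2).ne'
    field_simp
    ring
  have hatend : ∀ s, Tendsto (a s) atTop (𝓝 (debiasCoef T ρ (hat Ψ T) i s)) := by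
    rintro (k | k)
    · exact hρlim'.sqrt.mul_const _
    · exact hρlim.sqrt.mul_const _
  have hsum := LittleOP.sum Finset.univ fun s _ => (hlin s).mul_sub_mul
    (hA.bigOP_normSum (isCentered_influence hf hψ hreg hvar s)) (hatend s)
  refine hsum.of_le ((hA.whp_Sbar_eq hT hq).inter (whp_of_ae hθ)) ?_
  filter_upwards [hpos] with m hm ω hω
  have hω1 : D.Sbar m ω = T := hω.1
  refine le_of_eq (congrArg _ ?_)
  obtain ⟨hs1, hs2⟩ := inv_sqrt_inv_add_inv hm.1 hm.2
  rw [D.normSum_sum_mul, Finset.sum_sub_distrib,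
    debiased_sub_ate (θstar := θstar) hgram hω1 hω.2, mul_add]
  congr 1
  rw [Fintype.sum_sum_type]
  congr 1
  · rw [hs1, Finset.mul_sum]
    refine Finset.sum_congr rfl fun k _ => ?_
    simp only [ha, hest, Sum.elim_inl, hlim]
    ring
  · rw [hs2, Finset.mul_sum]
    refine Finset.sum_congr rfl fun k _ => ?_
    simp only [ha, hest, Sum.elim_inr]
    ring

lemma measurable_debiased (hD : D.IsSampled P ℱ Q) (hf : Measurable f) (hψ : Measurable ψ)
    {b : Ω → Fin J × Fin d → ℝ} (hb : Measurable b) {θ : Ω → Fin pv → ℝ} (hθ : Measurable θ)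
    (m : ℕ) (j : Fin J) : Measurable fun ω => D.debiased f ψ Ψ m ω (b ω) (θ ω) j := by
  refine (measurable_tauO hD hf hψ hb m j).sub ?_
  simp only [Matrix.mulVec, dotProduct]
  exact Finset.measurable_fun_sum _ fun k _ => ((measurable_pi_apply k).comp hθ).const_mul _

end Rounds

end Debiased

end

end DataFusion

/-! ### Assembly of the three limits -/

theorem lemma3p2
    {Ω 𝓧 𝓤 𝓥 : Type*} [mΩ : MeasurableSpace Ω] [MeasurableSpace 𝓧] [MeasurableSpace 𝓤]
    (P : Measure Ω) [IsProbabilityMeasure P] {J d pv : ℕ}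
    -- the population of units, treatment assignment, and the propensity features
    (Q : Measure (DataFusion.UnitRec 𝓧 𝓤 J)) [IsProbabilityMeasure Q]
    (f : 𝓧 × 𝓤 → Fin J → Bool) (hf : Measurable f)
    (ψ : 𝓧 → Fin d → ℝ) (hψ : Measurable ψ)
    -- the rounds
    (D : DataFusion.Rounds Ω 𝓧 𝓤 J) (ℱ : Filtration ℕ mΩ) (hD : D.IsSampled P ℱ Q)
    (hN : Tendsto D.Nbar atTop atTop)
    (ρ : ℝ) (hρ : ρ ∈ Set.Ioo (0 : ℝ) 1)
    (hρlim : Tendsto (fun m => D.Nbar m / (D.Nbar m + D.Lbar m)) atTop (𝓝 ρ))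
    -- the regularity conditions
    (βstar : Fin J × Fin d → ℝ)
    (hreg : DataFusion.Regular ψ (DataFusion.obsLaw Q f) βstar)
    -- existence of the treatment effects, and finite variances in the randomized arms
    (hint : ∀ j b, Integrable (DataFusion.policyOutcome f j b) Q)
    (T : Finset (Fin J))
    (hvar : ∀ j ∈ T, ∀ b, MemLp (DataFusion.policyOutcome f j b) 2 Q)
    -- the randomized interventions and their limiting shares
    (hT : ∀ m, ∀ᵐ ω ∂P, D.S m ω ⊆ T)
    (share : Fin J → ℝ) (hshare_pos : ∀ j ∈ T, 0 < share j)
    (hshare : ∀ j ∈ T,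
      TendstoInMeasure P (fun m ω => D.count m ω j / D.Lbar m) atTop (fun _ => share j))
    -- the attributes and the bias features
    (v : Fin J → 𝓥) (φ : 𝓥 → Fin pv → ℝ) (Ψ : Matrix (Fin J) (Fin pv) ℝ)
    (hΨ : Ψ = Matrix.of fun j => φ (v j))
    (hcard : ∀ᶠ m in atTop, ∀ᵐ ω ∂P, pv ≤ (D.Sbar m ω).card)
    (hgram : IsUnit (DataFusion.gram Ψ T).det)
    -- the maximum likelihood estimator of the propensity coefficients
    (βhat : ℕ → Ω → Fin J × Fin d → ℝ) (hβmeas : ∀ m, Measurable (βhat m))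
    (hβ : ∀ m, ∀ᵐ ω ∂P,
      (∃ b, D.SolvesScore f ψ m ω b) → D.SolvesScore f ψ m ω (βhat m ω))
    -- the bias model
    (θstar : Fin pv → ℝ)
    (hbias : ∀ j, (fun m => (∫ ω, D.tauO f ψ m ω (βhat m ω) j ∂P) -
        (DataFusion.ate Q f j + φ (v j) ⬝ᵥ θstar))
      =o[atTop] fun m => (√(D.Nbar m))⁻¹)
    -- the least squares estimator of the bias parameter
    (θhat : ℕ → Ω → Fin pv → ℝ) (hθmeas : ∀ m, Measurable (θhat m))
    (hθ : ∀ m, ∀ᵐ ω ∂P, ∀ θ,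
      D.lsCrit f ψ Ψ m ω (βhat m ω) (θhat m ω) ≤ D.lsCrit f ψ Ψ m ω (βhat m ω) θ)
    (Γ Υ H Sigma : Matrix (Fin J) (Fin J) ℝ)
    (hΓ : Γ = DataFusion.Gam ψ (DataFusion.obsLaw Q f) βstar)
    (hΥ : Υ = DataFusion.Ups Q f share)
    (hH : H = DataFusion.hat Ψ T)
    (hSigma : Sigma = DataFusion.Sig ρ H Γ Υ) :
    -- `Γ` is the asymptotic covariance of the observational estimator
    (Γ.PosSemidef ∧
      TendstoInDistribution
        (fun (m : ℕ) (ω : Ω) => WithLp.toLp 2 fun j : Fin J =>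
          √(D.Nbar m) * (D.tauO f ψ m ω (βhat m ω) j -
            (DataFusion.tauO1 ψ (DataFusion.obsLaw Q f) βstar j -
              DataFusion.tauO0 ψ (DataFusion.obsLaw Q f) βstar j)))
        atTop (id : EuclideanSpace ℝ (Fin J) → EuclideanSpace ℝ (Fin J)) (fun _ => P)
        (multivariateGaussian 0 Γ)) ∧
    -- `Υ` is the asymptotic covariance of the RCT estimator of the randomized interventions
    ((Υ.submatrix (Subtype.val : T → Fin J) Subtype.val).PosSemidef ∧
      TendstoInDistribution
        (fun (m : ℕ) (ω : Ω) => WithLp.toLp 2 fun j : T =>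
          √(D.Lbar m) * (D.tauR f m ω j - DataFusion.ate Q f j))
        atTop (id : EuclideanSpace ℝ T → EuclideanSpace ℝ T) (fun _ => P)
        (multivariateGaussian 0 (Υ.submatrix (Subtype.val : T → Fin J) Subtype.val))) ∧
    -- the fully de-biased estimator is asymptotically normal
    (Sigma.PosSemidef ∧
      TendstoInDistribution
        (fun (m : ℕ) (ω : Ω) => WithLp.toLp 2 fun j : Fin J =>
          (√((D.Nbar m)⁻¹ + (D.Lbar m)⁻¹))⁻¹ *
            (D.debiased f ψ Ψ m ω (βhat m ω) (θhat m ω) j - DataFusion.ate Q f j))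
        atTop (id : EuclideanSpace ℝ (Fin J) → EuclideanSpace ℝ (Fin J)) (fun _ => P)
        (multivariateGaussian 0 Sigma)) := by
  set q : Fin J → ℝ := fun j => if j ∈ T then share j else 0 with hq_def
  have hqT : ∀ j ∈ T, q j = share j := fun j hj => if_pos hj
  have hq : ∀ j ∈ T, 0 < q j := fun j hj => (hqT j hj).symm ▸ hshare_pos j hj
  have hA : D.IsAsymptotic P ℱ Q q :=
    DataFusion.Rounds.isAsymptotic_of_share hD hN hρ hρlim hT hshare_pos hshare
  have hυ : ((DataFusion.Ups Q f q).submatrix Subtype.val Subtype.val : Matrix T T ℝ) =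
      Υ.submatrix Subtype.val Subtype.val := by
    ext i k
    rw [hΥ, Matrix.submatrix_apply, Matrix.submatrix_apply, DataFusion.Ups, DataFusion.Ups,
      Matrix.diagonal_apply, Matrix.diagonal_apply, hqT i i.2]
  -- The mean of the observational estimator tends both to its population value and, by the bias
  -- model, to the effect plus the modelled bias. Uniqueness of limits makes this an exact identity.
  have hlim : ∀ j, DataFusion.tauO1 ψ (DataFusion.obsLaw Q f) βstar j -
      DataFusion.tauO0 ψ (DataFusion.obsLaw Q f) βstar j =
        DataFusion.ate Q f j + Ψ.mulVec θstar j := by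
    intro j
    have h1 := DataFusion.Rounds.tendsto_integral_tauO hD hf hψ hreg hN hβmeas hβ j
    have h2 := ((hbias j).trans_tendsto (DataFusion.tendsto_inv_sqrt hN)).add_const
      (DataFusion.ate Q f j + φ (v j) ⬝ᵥ θstar)
    simp only [sub_add_cancel, zero_add] at h2
    rw [tendsto_nhds_unique h1 h2, hΨ]
    rfl
  have hcT := DataFusion.Rounds.isCentered_influence (T := T) (q := q) hf hψ hreg hvar
  refine ⟨?_, ?_, ?_⟩
  · have hc : ∀ j, DataFusion.Rounds.IsCentered Q _ _ := fun j : Fin J => hcT (Sum.inl j)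
    rw [hΓ, ← DataFusion.Rounds.limCov_obs (q := q) hf hψ hreg]
    exact ⟨DataFusion.Rounds.posSemidef_limCov hc hA.share_nonneg,
      hA.tendstoInDistribution hc
        (fun m j => (((DataFusion.Rounds.measurable_tauO hD hf hψ (hβmeas m) m j).sub_const
          _).const_mul _).aemeasurable)
        fun j => hA.littleOP_tauO hf hψ hreg hβ j⟩
  · have hc : ∀ j, DataFusion.Rounds.IsCentered Q _ _ := fun j : T => hcT (Sum.inr j)
    rw [← hυ, ← DataFusion.Rounds.limCov_rct hf hvar hq]
    exact ⟨DataFusion.Rounds.posSemidef_limCov hc hA.share_nonneg,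
      hA.tendstoInDistribution hc
        (fun m j => (((DataFusion.Rounds.measurable_tauR hD hf m j).sub_const
          _).const_mul _).aemeasurable)
        fun j => hA.littleOP_tauR hf (hq j j.2) (hvar j j.2)⟩
  -- The limiting covariance of the combination is the block diagonal joint covariance conjugated by
  -- the coefficients, which is `Sigma`.
  · have hcov := DataFusion.Rounds.limCov_linear (q := q) hcT (DataFusion.Rounds.debiasCoef T ρ H)
    rw [DataFusion.Rounds.limCov_influence hf hψ hreg hvar hq, hυ, ← hΓ, hΥ, DataFusion.Ups,
      DataFusion.Rounds.debiasCoef_mul_mul hρ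
        (fun i j hj => hH ▸ DataFusion.hat_apply_of_notMem hj), ← DataFusion.Ups, ← hΥ,
      ← hSigma, hH] at hcov
    have hc := fun i => DataFusion.Rounds.IsCentered.sum_mul Finset.univ
      (DataFusion.Rounds.debiasCoef T ρ (DataFusion.hat Ψ T) i) hcT
    rw [← hcov]
    exact ⟨DataFusion.Rounds.posSemidef_limCov hc hA.share_nonneg,
      hA.tendstoInDistribution hc
        (fun m j => (((DataFusion.Rounds.measurable_debiased hD hf hψ (hβmeas m) (hθmeas m) m
          j).sub_const _).const_mul _).aemeasurable)
        fun i => hA.littleOP_debiased hf hψ hreg hvar hq hT hρlim hgram hβ hlim hθ i⟩
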